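/- **Proposition 5.4.** Let $(G;A,B)$ be a double Lie group: $G$ is a (finite-dimensional, Hausdorff, second countable) real Lie group and $A,B\subset G$ are closed Lie subgroups with $A\cap B=\{e\}$ and $G=AB$. Write $g=a_L(g)b_R(g)=b_L(g)a_R(g)$ with $a_L(g),a_R(g)\in A$, $b_L(g),b_R(g)\in B$. Let $G_A$ be the differential groupoid on $G$ with set of units $A$, multiplication relation $m_A$: $(b_1a)\cdot(ab_2)=b_1ab_2$ ($a\in A$, $b_i\in B$), and inverse $s(g)=a_R(g)b_R(g)^{-1}$; its left and right fibers through $g$ are $F_l(g)=gB$ and $F_r(g)=Bg$, with tangent spaces $T^l_gG_A$, $T^r_gG_A$ at $g$. For a groupoid $\Gamma$, let $\mathcal A(\Gamma)$ be the space of smooth compactly supported bidensities, i.e. sections $\omega$ of the bundle with fibers $\Omega_L^{1/2}(g)\otimes\Omega_R^{1/2}(g)$, where $\Omega_L^{1/2}(g)$ and $\Omega_R^{1/2}(g)$ denote the complex half-densities on $T^l_g\Gamma$ and $T^r_g\Gamma$, with the involution $\omega^*(g)(v\otimes w)=\overline{\omega(s(g))(s_*w\otimes s_*v)}$. For $\omega\in\mathcal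 A(G_A)$ and $\Omega\in\mathcal A(G_A\times G_A)$, let $\hat\delta(\omega)\Omega\in\mathcal A(G_A\times G_A)$ be the action of $\omega$ on $\Omega$ determined by the groupoid morphism $\delta=m_B^T:G_A\to G_A\times G_A$, whose graph consists of the pairs $((a_1b,ba_2),\,a_1ba_2)$ with $a_1,a_2\in A$, $b\in B$. Explicitly, for $z=(z_1,z_2)$ and $x\in F_l(a_L(z_1)a_L(z_2))$ let $\delta^L(x)$ be the point of $F_l(a_L(z_1),a_L(z_2))$ related to $x$ by $\delta$, let $y=s(\delta^L(x))\,z$, and let $\delta^R(x)$ be the point related to $x$ by $\delta$ such that $\delta^R(x)\,y=z$. Let $t$ be the diffeomorphism $(x',y')\mapsto(x',\delta^R(x')y')$ from $\{(x',y'): y'\in F_r(y),\ a_R(x')=a_L(y_1')a_L(y_2')\}$ to $\{(x',z'): z'\in F_r(z),\ a_L(x')=a_L(z_1')a_L(z_2')\}$. If $\omega(x)=\lambda(x)\otimes\rho(x)$ and $\Omega(y)=\lambda'(y)\otimes\rho'(y)$, then push-forward by $t$ (the half-densities on the two manifolds at $(x,y)$ and $(x,z)$ being identified with $\Omega_R^{1/2}(x)\otimes\Omega_R^{1/2}(y)$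 and $\Omega_L^{1/2}(x)\otimes\Omega_R^{1/2}(z)$ through the projections to $y'$ and $z'$) turns $\rho(x)\otimes\rho'(y)$ into some $\tilde\lambda_x\otimes\tilde\rho_z$, and push-forward by $F_l(y)\ni u\mapsto\delta^R(x)u\in F_l(z)$ turns $\lambda'(y)$ into some $\tilde\lambda'_z$; put $$(\hat\delta(\omega)\Omega)(z)=\int_{F_l(a_L(z_1)a_L(z_2))}[\lambda(x)\tilde\lambda_x]\otimes\tilde\lambda'_z\otimes\tilde\rho_z .$$ The adjoint of the multiplier $\hat\delta(\omega)$ is $\hat\delta(\omega^*)$, so that $\Omega\,\hat\delta(\omega)=(\hat\delta(\omega^*)\,\Omega^*)^*$. Define $R$ on $\mathcal A(G_A)$ by $(R\omega)(g)(v\otimes w)=\omega(g^{-1})(w^{-1}\otimes v^{-1})$, where $v^{-1},w^{-1}$ are the images of $v,w$ under the tangent map of $g\mapsto g^{-1}$. For $z\in\mathbb C$ let $\tau_z\omega=|Q|^{iz}\omega$, where $Q(g)=\dfrac{\det(\mathrm{Ad}(g))}{\det(g_1)\det(g_4)}$ and $g_1:\mathfrak a\to\mathfrak a$, $g_4:\mathfrak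 b\to\mathfrak b$ are the diagonal blocks of $\mathrm{Ad}(g)$ with respect to $\mathfrak g=\mathfrak a\oplus\mathfrak b$. Let $R\otimes R$ and $\tau_z\otimes\tau_z$ also denote the natural extensions to $\mathcal A(G_A\times G_A)$, and let $(\sim\Omega)(g_1,g_2)=\Omega(g_2,g_1)$ be the flip on $\mathcal A(G_A\times G_A)$. Then for all $z\in\mathbb C$ and $\omega,\omega_1,\omega_2\in\mathcal A(G_A)$: $$\hat\delta(R\omega)(R\omega_1\otimes R\omega_2)=\ \sim(R\otimes R)\big((\omega_2\otimes\omega_1)\,\hat\delta(\omega)\big),$$ $$\hat\delta(\tau_z\omega)(\omega_1\otimes\omega_2)=(\tau_z\otimes\tau_z)\big(\hat\delta(\omega)(\tau_{-z}\omega_1\otimes\tau_{-z}\omega_2)\big).$$ -/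

import Mathlib

open scoped Manifold Topology
open MeasureTheory Filter

noncomputable section

/-! ## Half-densities -/

/-- The one-dimensional complex space `Ω^{1/2} V ⊗ Ω^{1/2} W` for real vector spaces `V`, `W` of
dimension `#ι`.  As usual, a half-density on `V` is a function `d` of `#ι`-tuples of vectors with
`d (T v₁, …, T vₙ) = |det T|^{1/2} d (v₁, …, vₙ)` for every endomorphism `T` of `V`; an element
of the tensor product is a function of a tuple in `V` and a tuple in `W` which is a half-density in
each of the two. -/
@[ext]
structure BiHalfDensity (ι V W : Type*) [AddCommGroup V] [Module ℝ V]
    [AddCommGroup W] [Module ℝ W] where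
  toFun : (ι → V) → (ι → W) → ℂ
  map_det : ∀ (S : V →ₗ[ℝ] V) (T : W →ₗ[ℝ] W) (v : ι → V) (w : ι → W),
    toFun (fun i => S (v i)) (fun i => T (w i)) =
      ((|LinearMap.det S| ^ (1 / 2 : ℝ) * |LinearMap.det T| ^ (1 / 2 : ℝ) : ℝ) : ℂ) * toFun v w

namespace BiHalfDensity

variable {ι V W : Type*} [AddCommGroup V] [Module ℝ V] [AddCommGroup W] [Module ℝ W]

instance : CoeFun (BiHalfDensity ι V W) (fun _ => (ι → V) → (ι → W) → ℂ) := ⟨toFun⟩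

/-- Multiplication by a complex number. -/
def smul (c : ℂ) (d : BiHalfDensity ι V W) : BiHalfDensity ι V W where
  toFun v w := c * d v w
  map_det S T v w := by rw [d.map_det]; ring

/-- Complex conjugation. -/
def conj (d : BiHalfDensity ι V W) : BiHalfDensity ι V W where
  toFun v w := starRingEnd ℂ (d v w)
  map_det S T v w := by rw [d.map_det, map_mul, Complex.conj_ofReal]

/-- The bi-half-density `v ⊗ w ↦ d (S w ⊗ T v)`. -/
def pullSwap (d : BiHalfDensity ι V V) (S T : V →ₗ[ℝ] V) : BiHalfDensity ι V V where
  toFun v w := d (fun i => S (w i)) (fun i => T (v i))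
  map_det P P' v w := by
    rw [d.map_det, d.map_det, d.map_det S T]
    push_cast
    ring

/-- The bi-half-density `v ⊗ w ↦ d (S v ⊗ T w)`. -/
def pull (d : BiHalfDensity ι V W) (S : V →ₗ[ℝ] V) (T : W →ₗ[ℝ] W) : BiHalfDensity ι V W where
  toFun v w := d (fun i => S (v i)) (fun i => T (w i))
  map_det P P' v w := by
    rw [d.map_det, d.map_det, d.map_det S T]
    push_cast
    ring

/-- The unique bi-half-density whose value on the pair of bases `e`, `f` is `c`. -/
def ofValue [Fintype ι] [DecidableEq ι] (e : Module.Basis ι ℝ V) (f : Module.Basis ι ℝ W) (c : ℂ) :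
    BiHalfDensity ι V W where
  toFun v w := ((|e.det v| ^ (1 / 2 : ℝ) * |f.det w| ^ (1 / 2 : ℝ) : ℝ) : ℂ) * c
  map_det S T v w := by
    have h1 := e.det_comp S v
    have h2 := f.det_comp T w
    simp only [Function.comp_def] at h1 h2
    rw [h1, h2, abs_mul, abs_mul, Real.mul_rpow (abs_nonneg _) (abs_nonneg _),
      Real.mul_rpow (abs_nonneg _) (abs_nonneg _)]
    push_cast
    ring

theorem ofValue_self [Fintype ι] [DecidableEq ι] (e : Module.Basis ι ℝ V)
    (f : Module.Basis ι ℝ W) (c : ℂ) : ofValue e f c e f = c := by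
  simp [ofValue, Module.Basis.det_self]

end BiHalfDensity

/-! ## Double Lie groups -/

/-- `(G; A, B)` is a double Lie group: `A` and `B` are closed Lie subgroups of the Lie group `G`
(closed subgroups which, with their own Lie group structures, are embedded submanifolds of `G`;
they carry the subspace topology) with `A ∩ B = {e}` and `G = AB`. -/
structure IsDoubleLieGroup (E EA EB : Type*)
    [NormedAddCommGroup E] [NormedSpace ℝ E]
    [NormedAddCommGroup EA] [NormedSpace ℝ EA]
    [NormedAddCommGroup EB] [NormedSpace ℝ EB]
    {G : Type*} [TopologicalSpace G] [ChartedSpace E G] [Group G]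
    (A B : Subgroup G) [ChartedSpace EA A] [ChartedSpace EB B] : Prop where
  lieGroup : LieGroup 𝓘(ℝ, E) (⊤ : ℕ∞) G
  lieGroup_left : LieGroup 𝓘(ℝ, EA) (⊤ : ℕ∞) A
  lieGroup_right : LieGroup 𝓘(ℝ, EB) (⊤ : ℕ∞) B
  isClosed_left : IsClosed (A : Set G)
  isClosed_right : IsClosed (B : Set G)
  contMDiff_left : ContMDiff 𝓘(ℝ, EA) 𝓘(ℝ, E) (⊤ : ℕ∞) (fun a : A => (a : G))
  contMDiff_right : ContMDiff 𝓘(ℝ, EB) 𝓘(ℝ, E) (⊤ : ℕ∞) (fun b : B => (b : G))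
  immersion_left : ∀ a : A,
    Function.Injective (mfderiv 𝓘(ℝ, EA) 𝓘(ℝ, E) (fun a : A => (a : G)) a)
  immersion_right : ∀ b : B,
    Function.Injective (mfderiv 𝓘(ℝ, EB) 𝓘(ℝ, E) (fun b : B => (b : G)) b)
  inf_eq_bot : A ⊓ B = ⊥
  exists_mul_eq : ∀ g : G, ∃ a ∈ A, ∃ b ∈ B, g = a * b

namespace IsDoubleLieGroup

variable {E EA EB : Type*}
  [NormedAddCommGroup E] [NormedSpace ℝ E]
  [NormedAddCommGroup EA] [NormedSpace ℝ EA]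
  [NormedAddCommGroup EB] [NormedSpace ℝ EB]
  {G : Type*} [TopologicalSpace G] [ChartedSpace E G] [Group G]
  {A B : Subgroup G} [ChartedSpace EA A] [ChartedSpace EB B]

theorem isComplement (D : IsDoubleLieGroup E EA EB A B) : Subgroup.IsComplement' A B := by
  refine Subgroup.isComplement'_of_disjoint_and_mul_eq_univ (disjoint_iff.2 D.inf_eq_bot) ?_
  refine Set.eq_univ_of_forall fun g => ?_
  obtain ⟨a, ha, b, hb, rfl⟩ := D.exists_mul_eq g
  exact Set.mul_mem_mul ha hb

/-! ### The projections `g = a_L(g) b_R(g) = b_L(g) a_R(g)` -/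

def aL (D : IsDoubleLieGroup E EA EB A B) (g : G) : A := (D.isComplement.equiv g).1
def bR (D : IsDoubleLieGroup E EA EB A B) (g : G) : B := (D.isComplement.equiv g).2
def bL (D : IsDoubleLieGroup E EA EB A B) (g : G) : B := (D.isComplement.symm.equiv g).1
def aR (D : IsDoubleLieGroup E EA EB A B) (g : G) : A := (D.isComplement.symm.equiv g).2

theorem aL_mul_bR (D : IsDoubleLieGroup E EA EB A B) (g : G) : (D.aL g * D.bR g : G) = g :=
  D.isComplement.equiv_fst_mul_equiv_snd g

theorem bL_mul_aR (D : IsDoubleLieGroup E EA EB A B) (g : G) : (D.bL g * D.aR g : G) = g :=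
  D.isComplement.symm.equiv_fst_mul_equiv_snd g

theorem aL_bR_unique (D : IsDoubleLieGroup E EA EB A B) (a : A) (b : B) :
    D.aL (a * b) = a ∧ D.bR (a * b) = b :=
  Prod.ext_iff.1 (D.isComplement.equiv.apply_symm_apply (a, b))

theorem bL_aR_unique (D : IsDoubleLieGroup E EA EB A B) (b : B) (a : A) :
    D.bL (b * a) = b ∧ D.aR (b * a) = a :=
  Prod.ext_iff.1 (D.isComplement.symm.equiv.apply_symm_apply (b, a))

/-! ### The groupoid `G_A`

The set of units is `A`, the left (target) projection is `a_L`, the right (source) projection is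
`a_R`; hence the left and right fibers through `g` are the cosets `F_l(g) = g B` and
`F_r(g) = B g`. -/

/-- The inverse of the groupoid `G_A`. -/
def sA (D : IsDoubleLieGroup E EA EB A B) (g : G) : G := D.aR g * (D.bR g : G)⁻¹

/-- The graph of the multiplication relation `m_A` of `G_A`: the product of `b₁ a` and `a b₂` is
`b₁ a b₂`. -/
def mulGraph (_D : IsDoubleLieGroup E EA EB A B) : Set (G × G × G) :=
  {p | ∃ (b₁ b₂ : B) (a : A), p = ((b₁ * a * b₂ : G), (b₁ * a : G), (a * b₂ : G))}

/-- The product of `G_A`, as a total function; only its values on composable pairs matter. -/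
def mulA (D : IsDoubleLieGroup E EA EB A B) (g h : G) : G := D.bL g * h

theorem mem_mulGraph_iff (D : IsDoubleLieGroup E EA EB A B) (k g h : G) :
    (k, g, h) ∈ D.mulGraph ↔ D.aR g = D.aL h ∧ k = D.mulA g h := by
  constructor
  · rintro ⟨b₁, b₂, a, hp⟩
    simp only [Prod.mk.injEq] at hp
    obtain ⟨rfl, rfl, rfl⟩ := hp
    refine ⟨(D.bL_aR_unique b₁ a).2.trans (D.aL_bR_unique a b₂).1.symm, ?_⟩
    rw [mulA, (D.bL_aR_unique b₁ a).1, mul_assoc]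
  · rintro ⟨h1, rfl⟩
    refine ⟨D.bL g, D.bR h, D.aL h, ?_⟩
    have hg : (D.bL g * D.aL h : G) = g := by rw [← h1, D.bL_mul_aR]
    have hh := D.aL_mul_bR h
    simp only [Prod.mk.injEq]
    exact ⟨by rw [mulA, mul_assoc, hh], hg.symm, hh.symm⟩

/-- The graph of the relation `δ = m_B^T` from `G_A` to `G_A × G_A`, that is, of the transpose of
the multiplication of `G_B`: the pairs `((a₁ b, b a₂), a₁ b a₂)`. -/
def deltaGraph (_D : IsDoubleLieGroup E EA EB A B) : Set ((G × G) × G) :=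
  {p | ∃ (a₁ a₂ : A) (b : B), p = (((a₁ * b : G), (b * a₂ : G)), (a₁ * b * a₂ : G))}

/-- The map `δ^L` induced by `δ` on left fibers: for `a_L(x) = a₁ a₂`, the unique point of the left
fiber of `G_A × G_A` over `(a₁, a₂)` which is related to `x` by `δ`. -/
def deltaL (D : IsDoubleLieGroup E EA EB A B) (x : G) (a₁ a₂ : A) : G × G :=
  (a₁ * D.bL (a₂ * D.bR x), a₂ * D.bR x)

/-- The map `δ^R` induced by `δ` on right fibers: for `a_R(x) = a₁ a₂`, the unique point of the
right fiber of `G_A × G_A` over `(a₁, a₂)` which is related to `x` by `δ`. -/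
def deltaR (D : IsDoubleLieGroup E EA EB A B) (x : G) (a₁ a₂ : A) : G × G :=
  (D.bL x * a₁, D.bR (D.bL x * a₁) * a₂)

theorem deltaL_spec (D : IsDoubleLieGroup E EA EB A B) (x : G) (a₁ a₂ : A) (p : G × G) :
    ((p, x) ∈ D.deltaGraph ∧ D.aL p.1 = a₁ ∧ D.aL p.2 = a₂) ↔
      (D.aL x = a₁ * a₂ ∧ p = D.deltaL x a₁ a₂) := by
  constructor
  · rintro ⟨⟨c₁, c₂, b, hp⟩, h1, h2⟩
    simp only [Prod.mk.injEq] at hp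
    obtain ⟨rfl, rfl⟩ := hp
    rw [(D.aL_bR_unique c₁ b).1] at h1
    subst h1
    have h3 : (a₂ * D.bR (b * c₂) : G) = b * c₂ := by rw [← h2, D.aL_mul_bR]
    have h4 : (c₁ * b * c₂ : G) = (c₁ * a₂ : A) * D.bR (b * c₂) := by
      rw [mul_assoc, Subgroup.coe_mul, mul_assoc, h3]
    have h5 := D.aL_bR_unique (c₁ * a₂) (D.bR (b * c₂))
    rw [← h4] at h5
    refine ⟨h5.1, ?_⟩
    rw [deltaL, h5.2, h3, (D.bL_aR_unique b c₂).1]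
  · rintro ⟨h, rfl⟩
    have h1 := D.bL_mul_aR (a₂ * D.bR x)
    refine ⟨⟨a₁, D.aR (a₂ * D.bR x), D.bL (a₂ * D.bR x), ?_⟩, (D.aL_bR_unique _ _).1,
      (D.aL_bR_unique _ _).1⟩
    simp only [deltaL, Prod.mk.injEq, true_and]
    refine ⟨h1.symm, ?_⟩
    rw [mul_assoc, h1, ← mul_assoc, ← Subgroup.coe_mul, ← h, D.aL_mul_bR]

theorem deltaR_spec (D : IsDoubleLieGroup E EA EB A B) (x : G) (a₁ a₂ : A) (p : G × G) :
    ((p, x) ∈ D.deltaGraph ∧ D.aR p.1 = a₁ ∧ D.aR p.2 = a₂) ↔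
      (D.aR x = a₁ * a₂ ∧ p = D.deltaR x a₁ a₂) := by
  constructor
  · rintro ⟨⟨c₁, c₂, b, hp⟩, h1, h2⟩
    simp only [Prod.mk.injEq] at hp
    obtain ⟨rfl, rfl⟩ := hp
    rw [(D.bL_aR_unique b c₂).2] at h2
    subst h2
    have h3 : (D.bL (c₁ * b) * a₁ : G) = c₁ * b := by rw [← h1, D.bL_mul_aR]
    have h4 : (c₁ * b * c₂ : G) = D.bL (c₁ * b) * (a₁ * c₂ : A) := by
      rw [Subgroup.coe_mul, ← mul_assoc, h3]
    have h5 := D.bL_aR_unique (D.bL (c₁ * b)) (a₁ * c₂)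
    rw [← h4] at h5
    refine ⟨h5.2, ?_⟩
    rw [deltaR, h5.1, h3, (D.aL_bR_unique c₁ b).2]
  · rintro ⟨h, rfl⟩
    have h1 := D.aL_mul_bR (D.bL x * a₁)
    refine ⟨⟨D.aL (D.bL x * a₁), a₂, D.bR (D.bL x * a₁), ?_⟩, (D.bL_aR_unique _ _).2,
      (D.bL_aR_unique _ _).2⟩
    simp only [deltaR, Prod.mk.injEq, and_true]
    refine ⟨h1.symm, ?_⟩
    rw [h1, mul_assoc, ← Subgroup.coe_mul, ← h, D.bL_mul_aR]

/-- The map `m_δ : (x, y) ↦ δ^R(x) y` (product in `G_A × G_A`), defined for `(x, y)` in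
`G_A ×_δ (G_A × G_A) = {(x, y) : a_R(x) = a_L(y₁) a_L(y₂)}`.  The diffeomorphism `t_δ` sends
`(x, y)` to `(x, m_δ(x, y))` in `G_A *_δ (G_A × G_A) = {(x, z) : a_L(x) = a_L(z₁) a_L(z₂)}`. -/
def mDelta (D : IsDoubleLieGroup E EA EB A B) (x : G) (y : G × G) : G × G :=
  (D.mulA (D.deltaR x (D.aL y.1) (D.aL y.2)).1 y.1, D.mulA (D.deltaR x (D.aL y.1) (D.aL y.2)).2 y.2)

/-- For `(x, z)` in `G_A *_δ (G_A × G_A)`, the point `y = s(δ^L(x)) z` with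
`t_δ(x, y) = (x, z)`. -/
def mDeltaInv (D : IsDoubleLieGroup E EA EB A B) (x : G) (z : G × G) : G × G :=
  (D.mulA (D.sA (D.deltaL x (D.aL z.1) (D.aL z.2)).1) z.1,
    D.mulA (D.sA (D.deltaL x (D.aL z.1) (D.aL z.2)).2) z.2)

/-! ### Tangent spaces of the fibers

Let `𝔟 = T_e B`; in Mathlib this is the model space `EB`.  The tangent space of the left fiber
`F_l(g) = g B` at `g` is `g 𝔟` and that of the right fiber `F_r(g) = B g` is `𝔟 g`.  Vectors of
`T_g^l G_A` are written as `g X` and vectors of `T_g^r G_A` as `X g`, with `X ∈ 𝔟`. -/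

/-- The coordinate `c ∈ B` of a point `p = g c` of the left fiber through `g`. -/
def leftCoord (D : IsDoubleLieGroup E EA EB A B) (g p : G) : B := (D.bR g)⁻¹ * D.bR p

/-- The coordinate `c ∈ B` of a point `p = c g` of the right fiber through `g`. -/
def rightCoord (D : IsDoubleLieGroup E EA EB A B) (g p : G) : B := D.bL p * (D.bL g)⁻¹

theorem leftCoord_mul (D : IsDoubleLieGroup E EA EB A B) (g : G) (c : B) :
    D.leftCoord g (g * c) = c := by
  have h := (D.aL_bR_unique (D.aL g) (D.bR g * c)).2
  rw [Subgroup.coe_mul, ← mul_assoc, D.aL_mul_bR] at h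
  rw [leftCoord, h, inv_mul_cancel_left]

theorem rightCoord_mul (D : IsDoubleLieGroup E EA EB A B) (g : G) (c : B) :
    D.rightCoord g (c * g) = c := by
  have h := (D.bL_aR_unique (c * D.bL g) (D.aR g)).1
  rw [Subgroup.coe_mul, mul_assoc, D.bL_mul_aR] at h
  rw [rightCoord, h, mul_inv_cancel_right]

/-- The tangent map at `g` of a map `Φ` sending `F_l(g)` to `F_r(Φ g)`: it sends `g X` to
`Y Φ(g)` with `Y` the value of this linear map at `X`. -/
def tangentLR (D : IsDoubleLieGroup E EA EB A B) (Φ : G → G) (g : G) : EB →ₗ[ℝ] EB :=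
  (mfderiv 𝓘(ℝ, EB) 𝓘(ℝ, EB) (fun b : B => D.rightCoord (Φ g) (Φ (g * b))) 1).toLinearMap

/-- The tangent map at `g` of a map `Φ` sending `F_r(g)` to `F_l(Φ g)`: it sends `X g` to
`Φ(g) Y` with `Y` the value of this linear map at `X`. -/
def tangentRL (D : IsDoubleLieGroup E EA EB A B) (Φ : G → G) (g : G) : EB →ₗ[ℝ] EB :=
  (mfderiv 𝓘(ℝ, EB) 𝓘(ℝ, EB) (fun b : B => D.leftCoord (Φ g) (Φ (b * g))) 1).toLinearMap

end IsDoubleLieGroup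

/-! ### Bidensities -/

/-- The index set of the tuples of vectors of `𝔟 = T_e B`. -/
abbrev FrameIndex (EB : Type*) [NormedAddCommGroup EB] [NormedSpace ℝ EB] : Type :=
  Fin (Module.finrank ℝ EB)

/-- Sections of `Ω^{1/2}(e_L) ⊗ Ω^{1/2}(e_R)` over `G_A`.  For such a section `ω`, the number
`ω g v w` is the value of `ω(g)` on `(g v₁, …, g vₙ) ⊗ (w₁ g, …, wₙ g)`. -/
abbrev Bidensity (EB G : Type*) [NormedAddCommGroup EB] [NormedSpace ℝ EB] : Type _ :=
  G → BiHalfDensity (FrameIndex EB) EB EB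

/-- Sections of the corresponding bundle over the groupoid `G_A × G_A`, whose left (right) fiber
through `(g₁, g₂)` is the product of the left (right) fibers through `g₁` and `g₂` and has therefore
tangent space `g₁ 𝔟 ⊕ g₂ 𝔟` (respectively `𝔟 g₁ ⊕ 𝔟 g₂`). -/
abbrev Bidensity₂ (EB G : Type*) [NormedAddCommGroup EB] [NormedSpace ℝ EB] : Type _ :=
  G × G → BiHalfDensity (FrameIndex EB ⊕ FrameIndex EB) (EB × EB) (EB × EB)

namespace IsDoubleLieGroup

/-- Some basis of `𝔟 = T_e B`.  No definition below depends on its choice. -/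
def frame (EB : Type*) [NormedAddCommGroup EB] [NormedSpace ℝ EB] [FiniteDimensional ℝ EB] :
    Module.Basis (FrameIndex EB) ℝ EB := Module.finBasis ℝ EB

/-- The corresponding basis of `𝔟 ⊕ 𝔟`. -/
def frame₂ (EB : Type*) [NormedAddCommGroup EB] [NormedSpace ℝ EB] [FiniteDimensional ℝ EB] :
    Module.Basis (FrameIndex EB ⊕ FrameIndex EB) ℝ (EB × EB) := (frame EB).prod (frame EB)

variable {E EA EB : Type*}
  [NormedAddCommGroup E] [NormedSpace ℝ E]
  [NormedAddCommGroup EA] [NormedSpace ℝ EA]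
  [NormedAddCommGroup EB] [NormedSpace ℝ EB]
  {G : Type*} [TopologicalSpace G] [ChartedSpace E G] [Group G]
  {A B : Subgroup G} [ChartedSpace EA A] [ChartedSpace EB B]

/-- The space `𝒜(G_A)` of smooth bidensities with compact support.  (The fields `g ↦ g X` and
`g ↦ X g`, for `X` in a basis of `𝔟`, are smooth frames of the tangent spaces of the fibers.) -/
def algebra (_D : IsDoubleLieGroup E EA EB A B) : Set (Bidensity EB G) :=
  {ω | ∀ v w : FrameIndex EB → EB,
    ContMDiff 𝓘(ℝ, E) 𝓘(ℝ, ℂ) (⊤ : ℕ∞) (fun g => ω g v w) ∧ HasCompactSupport (fun g => ω g v w)}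

/-- The tensor product `ω₁ ⊗ ω₂`, a bidensity on `G_A × G_A`. -/
def tensor [FiniteDimensional ℝ EB] (_D : IsDoubleLieGroup E EA EB A B) (ω₁ ω₂ : Bidensity EB G) :
    Bidensity₂ EB G :=
  fun g => .ofValue (frame₂ EB) (frame₂ EB)
    (ω₁ g.1 (frame EB) (frame EB) * ω₂ g.2 (frame EB) (frame EB))

/-- The involution `ω*(g)(v ⊗ w) = conj (ω(s g)(s w ⊗ s v))`. -/
def adj (D : IsDoubleLieGroup E EA EB A B) (ω : Bidensity EB G) : Bidensity EB G :=
  fun g => ((ω (D.sA g)).pullSwap (D.tangentRL D.sA g) (D.tangentLR D.sA g)).conj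

/-- The involution of bidensities on the groupoid `G_A × G_A`. -/
def adj₂ (D : IsDoubleLieGroup E EA EB A B) (Ω : Bidensity₂ EB G) : Bidensity₂ EB G :=
  fun g => ((Ω (D.sA g.1, D.sA g.2)).pullSwap
    ((D.tangentRL D.sA g.1).prodMap (D.tangentRL D.sA g.2))
    ((D.tangentLR D.sA g.1).prodMap (D.tangentLR D.sA g.2))).conj

/-- The unitary antipode `(R ω)(g)(v ⊗ w) = ω(g⁻¹)(w⁻¹ ⊗ v⁻¹)`, where `v⁻¹`, `w⁻¹` are the images
of `v`, `w` under the tangent map of the group inverse. -/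
def unitaryAntipode (D : IsDoubleLieGroup E EA EB A B) (ω : Bidensity EB G) : Bidensity EB G :=
  fun g => (ω g⁻¹).pullSwap (D.tangentRL (fun h => h⁻¹) g) (D.tangentLR (fun h => h⁻¹) g)

/-- The natural extension `R ⊗ R` to bidensities on `G_A × G_A`. -/
def unitaryAntipode₂ (D : IsDoubleLieGroup E EA EB A B) (Ω : Bidensity₂ EB G) : Bidensity₂ EB G :=
  fun g => (Ω (g.1⁻¹, g.2⁻¹)).pullSwap
    ((D.tangentRL (fun h => h⁻¹) g.1).prodMap (D.tangentRL (fun h => h⁻¹) g.2))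
    ((D.tangentLR (fun h => h⁻¹) g.1).prodMap (D.tangentLR (fun h => h⁻¹) g.2))

/-- The flip `∼` of bidensities on `G_A × G_A`: `(∼Ω)(g₁, g₂) = Ω(g₂, g₁)`, where the tangent spaces
of the fibers through `(g₁, g₂)` and `(g₂, g₁)` are identified by exchanging the summands. -/
def flip (_D : IsDoubleLieGroup E EA EB A B) (Ω : Bidensity₂ EB G) : Bidensity₂ EB G :=
  fun g => {
    toFun := fun v w => Ω (g.2, g.1) (fun i => (v i).swap) (fun i => (w i).swap)
    map_det := by
      intro S T v w
      let e : (EB × EB) ≃ₗ[ℝ] (EB × EB) := LinearEquiv.prodComm ℝ EB EB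
      have h := (Ω (g.2, g.1)).map_det (e.toLinearMap ∘ₗ S ∘ₗ e.symm.toLinearMap)
        (e.toLinearMap ∘ₗ T ∘ₗ e.symm.toLinearMap) (fun i => (v i).swap) (fun i => (w i).swap)
      rw [LinearMap.det_conj, LinearMap.det_conj] at h
      exact h }

/-! ### The scaling group -/

/-- The Lie algebra `𝔞` of `A`, a subspace of `𝔤 = T_e G`. -/
def lieA (_D : IsDoubleLieGroup E EA EB A B) : Submodule ℝ E :=
  LinearMap.range (mfderiv 𝓘(ℝ, EA) 𝓘(ℝ, E) (fun a : A => (a : G)) 1).toLinearMap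

/-- The Lie algebra `𝔟` of `B`, as a subspace of `𝔤 = T_e G`. -/
def lieB (_D : IsDoubleLieGroup E EA EB A B) : Submodule ℝ E :=
  LinearMap.range (mfderiv 𝓘(ℝ, EB) 𝓘(ℝ, E) (fun b : B => (b : G)) 1).toLinearMap

/-- The adjoint representation of `G` on `𝔤 = T_e G`. -/
def Ad (_D : IsDoubleLieGroup E EA EB A B) (g : G) : E →ₗ[ℝ] E :=
  (mfderiv 𝓘(ℝ, E) 𝓘(ℝ, E) (fun h : G => g * h * g⁻¹) 1).toLinearMap

open scoped Classical in
/-- The function `Q(g) = det (Ad g) / (det g₁ · det g₄)`, where `g₁ = P_A Ad(g)|_𝔞` and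
`g₄ = P_B Ad(g)|_𝔟` are the diagonal blocks of `Ad g` with respect to `𝔤 = 𝔞 ⊕ 𝔟`.  (The
decomposition `𝔤 = 𝔞 ⊕ 𝔟` holds for every finite-dimensional double Lie group with a countable
basis of topology, so that the second case does not occur.) -/
def Q (D : IsDoubleLieGroup E EA EB A B) (g : G) : ℝ :=
  if h : IsCompl D.lieA D.lieB then
    LinearMap.det (D.Ad g) /
      (LinearMap.det
          (Submodule.projectionOnto D.lieA D.lieB h ∘ₗ D.Ad g ∘ₗ D.lieA.subtype) *
        LinearMap.det
          (Submodule.projectionOnto D.lieB D.lieA h.symm ∘ₗ D.Ad g ∘ₗ D.lieB.subtype))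
  else 1

/-- The scaling group `τ_z ω = |Q|^{iz} ω`, `z ∈ ℂ`. -/
def scaling (D : IsDoubleLieGroup E EA EB A B) (z : ℂ) (ω : Bidensity EB G) : Bidensity EB G :=
  fun g => (ω g).smul (((|D.Q g| : ℝ) : ℂ) ^ (Complex.I * z))

/-- The natural extension `τ_z ⊗ τ_z` to bidensities on `G_A × G_A`. -/
def scaling₂ (D : IsDoubleLieGroup E EA EB A B) (z : ℂ) (Ω : Bidensity₂ EB G) : Bidensity₂ EB G :=
  fun g => (Ω g).smul
    (((|D.Q g.1| : ℝ) : ℂ) ^ (Complex.I * z) * ((|D.Q g.2| : ℝ) : ℂ) ^ (Complex.I * z))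

/-! ### The comultiplication `δ̂` -/

/-- The left-invariant measure on `B` of the left-invariant density whose value at `e` on the basis
`frame EB` of `𝔟` is `1`: the left Haar measure whose density at `e`, relative to the Lebesgue
measure (in the chart at `e`) for which `frame EB` spans a parallelepiped of volume `1`, is `1`. -/
def haarB [FiniteDimensional ℝ EB] [MeasurableSpace G] [BorelSpace G]
    (D : IsDoubleLieGroup E EA EB A B) : Measure B :=
  haveI := D.lieGroup
  haveI : IsTopologicalGroup G := topologicalGroup_of_lieGroup 𝓘(ℝ, E) (⊤ : ℕ∞)
  haveI : LocallyCompactSpace B := Manifold.locallyCompact_of_finiteDimensional 𝓘(ℝ, EB)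
  letI : MeasurableSpace EB := borel EB
  haveI : BorelSpace EB := ⟨rfl⟩
  (limUnder (𝓝[>] (0 : ℝ)) fun r =>
    (frame EB).addHaar (Metric.ball (chartAt EB (1 : B) 1) r) /
      (Measure.haar : Measure B)
        {b | b ∈ (chartAt EB (1 : B)).source ∧
          chartAt EB (1 : B) b ∈ Metric.ball (chartAt EB (1 : B) 1) r}) •
  (Measure.haar : Measure B)

/-- The diffeomorphism `t_δ : (x', y') ↦ (x', m_δ(x', y'))` from `G_A ×_δ F_r(y)` to
`G_A *_δ F_r(z)`, `z = m_δ(x, y)`, in the following coordinates with values in `B × B × B`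
around `(x, y)` and `(x, z)`.

* On `G_A ×_δ F_r(y)`, the coordinates `(b₁, b₂, b₃)` of `(x', y')` are given by `y'₁ = b₂ y₁`,
  `y'₂ = b₃ y₂` and `x' = b₁ b_L(x) a_L(y'₁) a_L(y'₂)`.  The fiber of `(x', y') ↦ y'` through
  `(x, y)` is `F_r(x)`, with coordinate `x' = b₁ x`.
* On `G_A *_δ F_r(z)`, the coordinates `(c₁, c₂, c₃)` of `(x', z')` are given by `z'₁ = c₂ z₁`,
  `z'₂ = c₃ z₂` and `x' = a_L(z'₁) a_L(z'₂) b_R(x) c₁`.  The fiber of `(x', z') ↦ z'` through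
  `(x, z)` is `F_l(x)`, with coordinate `x' = x c₁`. -/
def tDeltaCoord (D : IsDoubleLieGroup E EA EB A B) (x : G) (y : G × G) (b : B × B × B) :
    B × B × B :=
  let y' : G × G := ((b.2.1 * y.1 : G), (b.2.2 * y.2 : G))
  let x' : G := b.1 * D.bL x * D.aL y'.1 * D.aL y'.2
  let z' : G × G := D.mDelta x' y'
  (D.leftCoord x x', D.rightCoord (D.mDelta x y).1 z'.1, D.rightCoord (D.mDelta x y).2 z'.2)

/-- The absolute value of the determinant of the tangent map of `t_δ` at `(x, y)`, with respect to a
basis of `T_{(x,y)}(G_A ×_δ F_r(y))` which consists of the basis `Xᵢ x` of `T_x^r G_A` (the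
kernel of the projection to `T_y^r`) and of lifts of the basis `Xᵢ y₁, Xᵢ y₂` of `T_y^r`, and a
basis of `T_{(x,z)}(G_A *_δ F_r(z))` which consists of the basis `x Xᵢ` of `T_x^l G_A` (the kernel
of the projection to `T_z^r`) and of lifts of the basis `Xᵢ z₁, Xᵢ z₂` of `T_z^r`. -/
def jacobian (D : IsDoubleLieGroup E EA EB A B) (x : G) (y : G × G) : ℝ :=
  |LinearMap.det (M := EB × EB × EB) (mfderiv (𝓘(ℝ, EB).prod (𝓘(ℝ, EB).prod 𝓘(ℝ, EB)))
    (𝓘(ℝ, EB).prod (𝓘(ℝ, EB).prod 𝓘(ℝ, EB))) (D.tDeltaCoord x y) (1, 1, 1)).toLinearMap|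

/-- The action `δ̂(ω) Ω` of a bidensity `ω` on `G_A` on a bidensity `Ω` on `G_A × G_A` given by the
morphism `δ`.  At `z`, it is the integral over `x` in the left fiber
`F_l(a_L(z₁) a_L(z₂)) = {a_L(z₁) a_L(z₂) b : b ∈ B}` of the following 1-density with values in
`Ω_L^{1/2}(z) ⊗ Ω_R^{1/2}(z)`.  Put `y = s(δ^L(x)) z`, so that `t_δ(x, y) = (x, z)`, and write
`ω(x) = λ(x) ⊗ ρ(x)`, `Ω(y) = λ'(y) ⊗ ρ'(y)`.  The isomorphisms
`Ω_R^{1/2}(x) ⊗ Ω_R^{1/2}(y) ≅ Ω^{1/2} T_{(x,y)}(G_A ×_δ F_r(y))`,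
`Ω_L^{1/2}(x) ⊗ Ω_R^{1/2}(z) ≅ Ω^{1/2} T_{(x,z)}(G_A *_δ F_r(z))` and the push-forward by `t_δ` turn
`ρ(x) ⊗ ρ'(y)` into some `μ_x ⊗ ρ''_z`; the map `u ↦ δ^R(x) u` from `F_l(y)` to `F_l(z)`, which is a
left translation by an element of `B × B` and sends `y X` to `z X`, turns `λ'(y)` into some `λ''_z`.
The 1-density is `(λ(x) μ_x) ⊗ λ''_z ⊗ ρ''_z`.

Below it is evaluated on the basis `x Xᵢ` of `T_x^l G_A` and on the bases of
`T_z^l = z₁ 𝔟 ⊕ z₂ 𝔟` and `T_z^r = 𝔟 z₁ ⊕ 𝔟 z₂` given by `Xᵢ`. -/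
def deltaHat [FiniteDimensional ℝ EB] [MeasurableSpace G] [BorelSpace G]
    (D : IsDoubleLieGroup E EA EB A B) (ω : Bidensity EB G) (Ω : Bidensity₂ EB G) :
    Bidensity₂ EB G :=
  fun z => .ofValue (frame₂ EB) (frame₂ EB)
    (∫ b : B,
      let x : G := D.aL z.1 * D.aL z.2 * b
      let y : G × G := D.mDeltaInv x z
      ω x (frame EB) (frame EB) * Ω y (frame₂ EB) (frame₂ EB) *
        ((D.jacobian x y ^ (-(1 / 2) : ℝ) : ℝ) : ℂ) ∂D.haarB)

/-- The product `Ω δ̂(ω)` of a bidensity on `G_A × G_A` with the multiplier `δ̂(ω)` from the right.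
The adjoint of the multiplier `δ̂(ω)` is `δ̂(ω*)`, so that `Ω δ̂(ω) = (δ̂(ω*) Ω*)*`. -/
def mulDeltaHat [FiniteDimensional ℝ EB] [MeasurableSpace G] [BorelSpace G]
    (D : IsDoubleLieGroup E EA EB A B) (Ω : Bidensity₂ EB G) (ω : Bidensity EB G) :
    Bidensity₂ EB G :=
  D.adj₂ (D.deltaHat (D.adj ω) (D.adj₂ Ω))

end IsDoubleLieGroup

end

open scoped Manifold Topology
open MeasureTheory Filter

noncomputable section

namespace BiHalfDensity

variable {ι V W : Type*} [AddCommGroup V] [Module ℝ V] [AddCommGroup W] [Module ℝ W]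

/-! The fields g ↦ gX and g ↦ Xg, with X in a basis of 𝔟, trivialise the tangent spaces of the left
and right fibers, and a bi-half-density is determined by its value on one pair of bases
(`ext_basis`). Both identities thus become equalities of scalar integrals over B, once all modular
factors are known. These factors are expressed through two characters: `detB b`, the modulus of Ad b
on 𝔟, and `detA a`, the modulus of Ad a on 𝔤/𝔞.

In the frames R is plainly ω(g) ↦ ω(g⁻¹), since inversion has determinant ±1
(`unitaryAntipode_frame`). The involution carries the weight (detA(a_R(g)) / detA(a_L(g)))^{1/2}
(`adj_frame`). The Jacobian of t_δ at (x, y) is detB(b_R(b_L(x) a_L(y₁))) / detA(a_R(x))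
(`jacobian_eq`), read off from a factorisation into maps that change one coordinate at a time
(`tDeltaCoord_eq`).

For the first identity, g ↦ s(g⁻¹) carries a triple (x, y, z) to a triple of the same kind with the
two components of y and z exchanged (`mDeltaInv_sA_inv`). On the integration variable it is the
dressing action b ↦ b_L(ab) with a = a_L(z₁)a_L(z₂), which multiplies the left Haar measure of B by
detA(a_R(ab)) (`integral_bL_coe_mul`). The weights of the three involutions cancel, and the Haar
factor turns one Jacobian into the other (`jacobian_antipode`).

For the second identity, |Q| is a quotient of values of `detA` and `detB` at the four projections
(`abs_Q_eq`), and it satisfies |Q(z₁)Q(z₂)| = |Q(x)Q(y₁)Q(y₂)| (`abs_Q_mDeltaInv`). The two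
integrands therefore agree pointwise.

Two analytic facts support this. The projections are smooth: 𝔞 ∩ 𝔟 = 0 by uniqueness of integral
curves, 𝔞 + 𝔟 = 𝔤 by a dimension count, and the inverse function theorem applies to A × B → G. The
change of variables formula for Haar measure comes from the Lebesgue formula in the chart at 1 and
local uniqueness of invariant measures. -/

theorem ext_basis [Fintype ι] [DecidableEq ι] (e : Module.Basis ι ℝ V) (f : Module.Basis ι ℝ W)
    {d d' : BiHalfDensity ι V W} (h : d e f = d' e f) : d = d' := by
  ext v w
  have hv : v = fun i => e.constr ℝ v (e i) := by
    funext i; simp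
  have hw : w = fun i => f.constr ℝ w (f i) := by
    funext i; simp
  rw [hv, hw, d.map_det, d'.map_det, h]

end BiHalfDensity

namespace IsDoubleLieGroup

variable {E EA EB : Type*}
  [NormedAddCommGroup E] [NormedSpace ℝ E]
  [NormedAddCommGroup EA] [NormedSpace ℝ EA]
  [NormedAddCommGroup EB] [NormedSpace ℝ EB]
  {G : Type*} [TopologicalSpace G] [ChartedSpace E G] [Group G]
  {A B : Subgroup G} [ChartedSpace EA A] [ChartedSpace EB B]
  (D : IsDoubleLieGroup E EA EB A B)

/-! ### Algebra of the projections -/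

@[simp] theorem aL_coe_mul_coe (a : A) (b : B) : D.aL (a * b) = a := (D.aL_bR_unique a b).1

@[simp] theorem bR_coe_mul_coe (a : A) (b : B) : D.bR (a * b) = b := (D.aL_bR_unique a b).2

@[simp] theorem bL_coe_mul_coe (b : B) (a : A) : D.bL (b * a) = b := (D.bL_aR_unique b a).1

@[simp] theorem aR_coe_mul_coe (b : B) (a : A) : D.aR (b * a) = a := (D.bL_aR_unique b a).2

theorem aL_coe_mul (a : A) (g : G) : D.aL (a * g) = a * D.aL g := by
  conv_lhs => rw [← D.aL_mul_bR g, ← mul_assoc, ← Subgroup.coe_mul]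
  exact D.aL_coe_mul_coe _ _

theorem bR_coe_mul (a : A) (g : G) : D.bR (a * g) = D.bR g := by
  conv_lhs => rw [← D.aL_mul_bR g, ← mul_assoc, ← Subgroup.coe_mul]
  exact D.bR_coe_mul_coe _ _

theorem aL_mul_coe (g : G) (b : B) : D.aL (g * b) = D.aL g := by
  conv_lhs => rw [← D.aL_mul_bR g, mul_assoc, ← Subgroup.coe_mul]
  exact D.aL_coe_mul_coe _ _

theorem bR_mul_coe (g : G) (b : B) : D.bR (g * b) = D.bR g * b := by
  conv_lhs => rw [← D.aL_mul_bR g, mul_assoc, ← Subgroup.coe_mul]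
  exact D.bR_coe_mul_coe _ _

theorem bL_coe_mul (b : B) (g : G) : D.bL (b * g) = b * D.bL g := by
  conv_lhs => rw [← D.bL_mul_aR g, ← mul_assoc, ← Subgroup.coe_mul]
  exact D.bL_coe_mul_coe _ _

theorem aR_coe_mul (b : B) (g : G) : D.aR (b * g) = D.aR g := by
  conv_lhs => rw [← D.bL_mul_aR g, ← mul_assoc, ← Subgroup.coe_mul]
  exact D.aR_coe_mul_coe _ _

theorem bL_mul_coe (g : G) (a : A) : D.bL (g * a) = D.bL g := by
  conv_lhs => rw [← D.bL_mul_aR g, mul_assoc, ← Subgroup.coe_mul]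
  exact D.bL_coe_mul_coe _ _

theorem bL_coe (b : B) : D.bL (b : G) = b := by simpa using D.bL_coe_mul_coe b 1

theorem bR_coe (b : B) : D.bR (b : G) = b := by simpa using D.bR_coe_mul_coe 1 b

theorem bL_coe_left (a : A) : D.bL (a : G) = 1 := by simpa using D.bL_coe_mul_coe 1 a

theorem bR_coe_left (a : A) : D.bR (a : G) = 1 := by simpa using D.bR_coe_mul_coe a 1

theorem aL_coe (a : A) : D.aL (a : G) = a := by simpa using D.aL_coe_mul_coe a 1

theorem aR_coe (a : A) : D.aR (a : G) = a := by simpa using D.aR_coe_mul_coe 1 a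

theorem aL_coe_right (b : B) : D.aL (b : G) = 1 := by simpa using D.aL_coe_mul_coe 1 b

theorem bR_inv (g : G) : D.bR g⁻¹ = (D.bL g)⁻¹ := by
  have : g⁻¹ = ((D.aR g)⁻¹ : A) * ((D.bL g)⁻¹ : B) := by
    conv_lhs => rw [← D.bL_mul_aR g, mul_inv_rev]
    simp
  rw [this, bR_coe_mul_coe]

theorem aL_inv (g : G) : D.aL g⁻¹ = (D.aR g)⁻¹ := by
  have : g⁻¹ = ((D.aR g)⁻¹ : A) * ((D.bL g)⁻¹ : B) := by
    conv_lhs => rw [← D.bL_mul_aR g, mul_inv_rev]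
    simp
  rw [this, aL_coe_mul_coe]

theorem bL_inv (g : G) : D.bL g⁻¹ = (D.bR g)⁻¹ := by
  have : g⁻¹ = ((D.bR g)⁻¹ : B) * ((D.aL g)⁻¹ : A) := by
    conv_lhs => rw [← D.aL_mul_bR g, mul_inv_rev]
    simp
  rw [this, bL_coe_mul_coe]

theorem aR_inv (g : G) : D.aR g⁻¹ = (D.aL g)⁻¹ := by
  have : g⁻¹ = ((D.bR g)⁻¹ : B) * ((D.aL g)⁻¹ : A) := by
    conv_lhs => rw [← D.aL_mul_bR g, mul_inv_rev]
    simp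
  rw [this, aR_coe_mul_coe]

/-- A cocycle identity: moving b_L(g) out of the product leaves only the A-part a_R(g) acting on h.
It reduces derivatives at an arbitrary point to derivatives at 1. -/
theorem bL_mul (g h : G) : D.bL (g * h) = D.bL g * D.bL (D.aR g * h) := by
  conv_lhs => rw [← D.bL_mul_aR g, mul_assoc]
  exact D.bL_coe_mul _ _

theorem bR_mul (g h : G) : D.bR (g * h) = D.bR (g * D.aL h) * D.bR h := by
  conv_lhs => rw [← D.aL_mul_bR h, ← mul_assoc]
  exact D.bR_mul_coe _ _

/-- The inverse law of the dressing action of A on B. The factor a_R(ab) discarded by b_L stands on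
the right, where b_L does not see it. -/
theorem bL_inv_mul_bL (a : A) (b : B) :
    D.bL ((a⁻¹ : A) * D.bL (a * b) : G) = b := by
  have h : ((a⁻¹ : A) * D.bL (a * b) : G) = b * ((D.aR (a * b))⁻¹ : A) := by
    rw [Subgroup.coe_inv, inv_mul_eq_iff_eq_mul, Subgroup.coe_inv, ← mul_assoc,
      eq_mul_inv_iff_mul_eq, D.bL_mul_aR]
  rw [h, bL_coe_mul_coe]

theorem sA_eq (g : G) : D.sA g = ((D.bL g)⁻¹ : B) * D.aL g := by
  rw [sA, Subgroup.coe_inv, mul_inv_eq_iff_eq_mul, mul_assoc, D.aL_mul_bR, eq_inv_mul_iff_mul_eq,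
    D.bL_mul_aR]

theorem sA_eq' (g : G) : D.sA g = D.aR g * ((D.bR g)⁻¹ : B) := by
  rw [sA, Subgroup.coe_inv]

@[simp] theorem aL_sA (g : G) : D.aL (D.sA g) = D.aR g := by rw [sA_eq', aL_coe_mul_coe]

@[simp] theorem bR_sA (g : G) : D.bR (D.sA g) = (D.bR g)⁻¹ := by rw [sA_eq', bR_coe_mul_coe]

@[simp] theorem bL_sA (g : G) : D.bL (D.sA g) = (D.bL g)⁻¹ := by rw [sA_eq, bL_coe_mul_coe]

@[simp] theorem aR_sA (g : G) : D.aR (D.sA g) = D.aL g := by rw [sA_eq, aR_coe_mul_coe]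

end IsDoubleLieGroup

/-! ### Tangent spaces of Lie subgroups with trivial intersection -/

section LieSubgroups

variable {E EA EB : Type*}
  [NormedAddCommGroup E] [NormedSpace ℝ E]
  [NormedAddCommGroup EA] [NormedSpace ℝ EA]
  [NormedAddCommGroup EB] [NormedSpace ℝ EB]
  {G : Type*} [TopologicalSpace G] [ChartedSpace E G] [Group G]

theorem lieGroup_minSmoothness (h : LieGroup 𝓘(ℝ, E) (⊤ : ℕ∞) G) :
    LieGroup 𝓘(ℝ, E) (minSmoothness ℝ 3) G := by
  have := h
  refine LieGroup.of_le (n := ((⊤ : ℕ∞) : WithTop ℕ∞)) ?_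
  rw [minSmoothness_of_isRCLikeNormedField]
  exact WithTop.coe_le_coe.2 (le_top : (3 : ℕ∞) ≤ ⊤)

theorem one_le_minSmoothness_two : (1 : WithTop ℕ∞) ≤ minSmoothness ℝ 2 := by
  rw [minSmoothness_of_isRCLikeNormedField]
  norm_num

/-- The inclusion is a homomorphism, so it intertwines left translations; differentiate this at 1.
-/
theorem mfderiv_coe_mulInvariantVectorField {A : Subgroup G} [ChartedSpace EA A]
    [LieGroup 𝓘(ℝ, E) (⊤ : ℕ∞) G] [LieGroup 𝓘(ℝ, EA) (⊤ : ℕ∞) A]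
    (hA : ContMDiff 𝓘(ℝ, EA) 𝓘(ℝ, E) (⊤ : ℕ∞) (fun a : A => (a : G))) (X : EA) (a : A) :
    mfderiv 𝓘(ℝ, EA) 𝓘(ℝ, E) (fun a : A => (a : G)) a
        (mulInvariantVectorField (I := 𝓘(ℝ, EA)) (G := A) X a) =
      mulInvariantVectorField (I := 𝓘(ℝ, E)) (G := G)
        (mfderiv 𝓘(ℝ, EA) 𝓘(ℝ, E) (fun a : A => (a : G)) 1 X : E) (a : G) := by
  have h1 : MDifferentiable 𝓘(ℝ, EA) 𝓘(ℝ, E) (fun a : A => (a : G)) :=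
    hA.mdifferentiable (by simp)
  have h2 : MDifferentiable 𝓘(ℝ, EA) 𝓘(ℝ, EA) (fun b : A => a * b) :=
    (contMDiff_mul_left (I := 𝓘(ℝ, EA)) (n := ((⊤ : ℕ∞) : WithTop ℕ∞))).mdifferentiable (by simp)
  have h3 : MDifferentiable 𝓘(ℝ, E) 𝓘(ℝ, E) (fun b : G => (a : G) * b) :=
    (contMDiff_mul_left (I := 𝓘(ℝ, E)) (n := ((⊤ : ℕ∞) : WithTop ℕ∞))).mdifferentiable (by simp)
  have e1 := mfderiv_comp_apply_of_eq (x := (1 : A)) (y := a) (h1 a) (h2 1) (mul_one a) X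
  have e2 := mfderiv_comp_apply_of_eq (x := (1 : A)) (y := (1 : G)) (h3 1) (h1 1) rfl X
  unfold mulInvariantVectorField
  exact e1.symm.trans e2

/-- Solve the differential equation inside A. The inclusion relates the two left-invariant fields,
so the solution stays an integral curve when viewed in G. -/
theorem exists_curve_in_subgroup {A : Subgroup G} [ChartedSpace EA A] [CompleteSpace EA]
    [LieGroup 𝓘(ℝ, E) (⊤ : ℕ∞) G] [LieGroup 𝓘(ℝ, EA) (⊤ : ℕ∞) A]
    (hA : ContMDiff 𝓘(ℝ, EA) 𝓘(ℝ, E) (⊤ : ℕ∞) (fun a : A => (a : G))) (X : EA) :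
    ∃ γ : ℝ → A, γ 0 = 1 ∧ IsMIntegralCurveAt (I := 𝓘(ℝ, E)) (fun t => (γ t : G))
      (mulInvariantVectorField (I := 𝓘(ℝ, E)) (G := G)
        (mfderiv 𝓘(ℝ, EA) 𝓘(ℝ, E) (fun a : A => (a : G)) 1 X : E)) 0 := by
  have := lieGroup_minSmoothness (G := A) (E := EA) inferInstance
  have : IsManifold 𝓘(ℝ, EA) 1 A :=
    IsManifold.of_le (n := ((⊤ : ℕ∞) : WithTop ℕ∞)) (by exact_mod_cast le_top)
  have hv := contMDiffAt_mulInvariantVectorField (I := 𝓘(ℝ, EA)) (G := A) X (g := 1)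
  obtain ⟨γ, h0, hγ⟩ := exists_isMIntegralCurveAt_of_contMDiffAt_boundaryless 0
    (hv.of_le one_le_minSmoothness_two)
  refine ⟨γ, h0, ?_⟩
  unfold IsMIntegralCurveAt at hγ ⊢
  filter_upwards [hγ] with t ht
  have h1 : MDifferentiable 𝓘(ℝ, EA) 𝓘(ℝ, E) (fun a : A => (a : G)) :=
    hA.mdifferentiable (by simp)
  have h2 := HasMFDerivAt.comp t (h1 (γ t)).hasMFDerivAt ht
  have e : (mfderiv 𝓘(ℝ, EA) 𝓘(ℝ, E) (fun a : A => (a : G)) (γ t)).comp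
      ((1 : ℝ →L[ℝ] ℝ).smulRight
        (mulInvariantVectorField (I := 𝓘(ℝ, EA)) (G := A) X (γ t))) =
      (1 : ℝ →L[ℝ] ℝ).smulRight (mulInvariantVectorField (I := 𝓘(ℝ, E)) (G := G)
        (mfderiv 𝓘(ℝ, EA) 𝓘(ℝ, E) (fun a : A => (a : G)) 1 X : E) (γ t : G)) := by
    rw [← mfderiv_coe_mulInvariantVectorField hA]
    apply ContinuousLinearMap.ext
    intro r
    exact ContinuousLinearMap.map_smul _ r _
  rw [← e]
  exact h2

/-- A common tangent vector defines one left-invariant field on G, with an integral curve through 1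
inside A and another inside B. By uniqueness they agree near 0, so the curve lies in A ∩ B, is
constant, and has zero velocity. -/
theorem mfderiv_coe_eq_zero_of_disjoint {A B : Subgroup G} [ChartedSpace EA A] [ChartedSpace EB B]
    [CompleteSpace EA] [CompleteSpace EB] [CompleteSpace E]
    [LieGroup 𝓘(ℝ, E) (⊤ : ℕ∞) G] [LieGroup 𝓘(ℝ, EA) (⊤ : ℕ∞) A]
    [LieGroup 𝓘(ℝ, EB) (⊤ : ℕ∞) B]
    (hA : ContMDiff 𝓘(ℝ, EA) 𝓘(ℝ, E) (⊤ : ℕ∞) (fun a : A => (a : G)))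
    (hB : ContMDiff 𝓘(ℝ, EB) 𝓘(ℝ, E) (⊤ : ℕ∞) (fun b : B => (b : G)))
    (hAB : A ⊓ B = ⊥) (X : EA) (Y : EB)
    (h : (mfderiv 𝓘(ℝ, EA) 𝓘(ℝ, E) (fun a : A => (a : G)) 1 X : E) =
      (mfderiv 𝓘(ℝ, EB) 𝓘(ℝ, E) (fun b : B => (b : G)) 1 Y : E)) :
    (mfderiv 𝓘(ℝ, EA) 𝓘(ℝ, E) (fun a : A => (a : G)) 1 X : E) = 0 := by
  have := lieGroup_minSmoothness (G := G) (E := E) inferInstance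
  have : IsManifold 𝓘(ℝ, E) 1 G :=
    IsManifold.of_le (n := ((⊤ : ℕ∞) : WithTop ℕ∞)) (by exact_mod_cast le_top)
  obtain ⟨γ, hγ0, hγ⟩ := exists_curve_in_subgroup hA X
  obtain ⟨σ, hσ0, hσ⟩ := exists_curve_in_subgroup hB Y
  rw [← h] at hσ
  set Z : E := (mfderiv 𝓘(ℝ, EA) 𝓘(ℝ, E) (fun a : A => (a : G)) 1 X : E) with hZ
  have hv := contMDiffAt_mulInvariantVectorField (I := 𝓘(ℝ, E)) (G := G) Z (g := ((γ 0 : A) : G))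
  have heq := isMIntegralCurveAt_eventuallyEq_of_contMDiffAt_boundaryless
    (hv.of_le one_le_minSmoothness_two) hγ hσ (by simp [hγ0, hσ0])
  have hone : (fun t => (γ t : G)) =ᶠ[𝓝 0] fun _ => (1 : G) := by
    filter_upwards [heq] with t ht
    have : (γ t : G) ∈ A ⊓ B := ⟨(γ t).2, by rw [ht]; exact (σ t).2⟩
    rwa [hAB, Subgroup.mem_bot] at this
  have hd := hγ.self_of_nhds
  have hc : HasMFDerivAt 𝓘(ℝ, ℝ) 𝓘(ℝ, E) (fun t => (γ t : G)) 0 0 :=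
    (hasMFDerivAt_const (1 : G) (0 : ℝ)).congr_of_eventuallyEq hone
  have h3 := hasMFDerivAt_unique hd hc
  have h4 := DFunLike.congr_fun h3 (1 : ℝ)
  have h5 : mulInvariantVectorField (I := 𝓘(ℝ, E)) (G := G) Z ((γ 0 : A) : G) = (0 : E) :=
    (one_smul ℝ (mulInvariantVectorField (I := 𝓘(ℝ, E)) (G := G) Z ((γ 0 : A) : G) : E)).symm.trans
      h4
  have h6 : ((γ 0 : A) : G) = 1 := by simp [hγ0]
  have h7 : ∀ g : G, g = 1 → mulInvariantVectorField (I := 𝓘(ℝ, E)) (G := G) Z g = (Z : E) := by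
    rintro g rfl
    unfold mulInvariantVectorField
    have : (fun h : G => 1 * h) = id := by funext h; simp
    rw [this, mfderiv_id]
    rfl
  exact (h7 _ h6).symm.trans h5

end LieSubgroups

/-! ### Dimension of smooth images, and the inverse function theorem on manifolds -/

/-- Hausdorff dimension does the work of Sard's theorem. In charts f is locally Lipschitz, so small
pieces of M have images of dimension at most dim F. Countably many pieces suffice by second
countability, and together they cover an open set of E. -/
theorem finrank_le_of_contMDiff_surjective {E F M N : Type*}
    [NormedAddCommGroup E] [NormedSpace ℝ E] [FiniteDimensional ℝ E]
    [NormedAddCommGroup F] [NormedSpace ℝ F] [FiniteDimensional ℝ F]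
    {H : Type*} [TopologicalSpace H] {I : ModelWithCorners ℝ F H} [I.Boundaryless]
    [TopologicalSpace M] [ChartedSpace H M] [SecondCountableTopology M] [IsManifold I 1 M]
    [TopologicalSpace N] [ChartedSpace E N] [IsManifold 𝓘(ℝ, E) 1 N] [Nonempty N]
    {f : M → N} (hf : ContMDiff I 𝓘(ℝ, E) 1 f) (hs : Function.Surjective f) :
    Module.finrank ℝ E ≤ Module.finrank ℝ F := by
  obtain ⟨q⟩ := ‹Nonempty N›
  set U : Set N := (extChartAt 𝓘(ℝ, E) q).source with hU
  have hUo : IsOpen (f ⁻¹' U) := (isOpen_extChartAt_source q).preimage hf.continuous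
  have key : ∀ p ∈ f ⁻¹' U, ∃ O ∈ 𝓝[f ⁻¹' U] p, dimH (extChartAt 𝓘(ℝ, E) q '' (f '' O)) ≤
      Module.finrank ℝ F := by
    intro p hp
    have h1 : ContMDiffAt I 𝓘(ℝ, E) 1 (fun m => extChartAt 𝓘(ℝ, E) q (f m)) p :=
      (contMDiffAt_extChartAt' (I := 𝓘(ℝ, E)) (by simpa [hU] using hp)).comp p hf.contMDiffAt
    have h2 : ContDiffAt ℝ 1
        ((fun m => extChartAt 𝓘(ℝ, E) q (f m)) ∘ (extChartAt I p).symm) (extChartAt I p p) := by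
      have := (contMDiffAt_iff.1 h1).2
      rw [I.range_eq_univ, contDiffWithinAt_univ] at this
      exact this
    obtain ⟨C, t, ht, hC⟩ := h2.exists_lipschitzOnWith
    refine ⟨(extChartAt I p).source ∩ extChartAt I p ⁻¹' t, mem_nhdsWithin_of_mem_nhds
      (inter_mem (extChartAt_source_mem_nhds p) ((continuousAt_extChartAt p).preimage_mem_nhds ht)),
      ?_⟩
    have h3 : extChartAt 𝓘(ℝ, E) q '' (f '' ((extChartAt I p).source ∩ extChartAt I p ⁻¹' t)) ⊆
        ((fun m => extChartAt 𝓘(ℝ, E) q (f m)) ∘ (extChartAt I p).symm) '' t := by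
      rintro _ ⟨_, ⟨m, ⟨hm, hm'⟩, rfl⟩, rfl⟩
      exact ⟨_, hm', by
        rw [Function.comp_apply, (extChartAt I p).left_inv hm]⟩
    calc _ ≤ _ := dimH_mono h3
      _ ≤ _ := hC.dimH_image_le
      _ ≤ _ := dimH_mono (Set.subset_univ _)
      _ = _ := Real.dimH_univ_eq_finrank F
  choose! O hO hd using key
  obtain ⟨s, hsU, hsc, hcov⟩ := TopologicalSpace.countable_cover_nhdsWithin hO
  have h4 : (extChartAt 𝓘(ℝ, E) q).target ⊆ ⋃ p ∈ s, extChartAt 𝓘(ℝ, E) q '' (f '' O p) := by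
    intro v hv
    obtain ⟨m, hm⟩ := hs ((extChartAt 𝓘(ℝ, E) q).symm v)
    have hmU : m ∈ f ⁻¹' U := by
      rw [Set.mem_preimage, hm]
      exact (extChartAt 𝓘(ℝ, E) q).map_target hv
    obtain ⟨p, hp, hmp⟩ := Set.mem_iUnion₂.1 (hcov hmU)
    exact Set.mem_iUnion₂.2 ⟨p, hp, _, ⟨m, hmp, rfl⟩, by
      rw [hm, (extChartAt 𝓘(ℝ, E) q).right_inv hv]⟩
  have h5 : dimH (extChartAt 𝓘(ℝ, E) q).target = Module.finrank ℝ E :=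
    Real.dimH_of_mem_nhds (extChartAt_target_mem_nhds q)
  have h6 : (Module.finrank ℝ E : ENNReal) ≤ Module.finrank ℝ F := by
    rw [← h5]
    refine (dimH_mono h4).trans ?_
    rw [dimH_bUnion hsc]
    exact iSup₂_le fun p hp => hd p (hsU hp)
  exact_mod_cast h6

/-- The inverse function theorem: a right inverse near `f p`. -/
theorem exists_contMDiffAt_right_inverse {E F M N : Type*}
    [NormedAddCommGroup E] [NormedSpace ℝ E]
    [NormedAddCommGroup F] [NormedSpace ℝ F] [CompleteSpace F]
    {H : Type*} [TopologicalSpace H] {I : ModelWithCorners ℝ F H} [I.Boundaryless]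
    {n : WithTop ℕ∞} (hn : n ≠ 0)
    [TopologicalSpace M] [ChartedSpace H M] [IsManifold I n M]
    [TopologicalSpace N] [ChartedSpace E N] [IsManifold 𝓘(ℝ, E) n N]
    {f : M → N} {p : M} (hf : ContMDiffAt I 𝓘(ℝ, E) n f p) (f' : F ≃L[ℝ] E)
    (hf' : mfderiv I 𝓘(ℝ, E) f p = (f' : F →L[ℝ] E)) :
    ∃ g : N → M, ContMDiffAt 𝓘(ℝ, E) I n g (f p) ∧ ∀ᶠ q in 𝓝 (f p), f (g q) = q := by
  set Φ := extChartAt I p with hΦ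
  set Ψ := extChartAt 𝓘(ℝ, E) (f p) with hΨ
  have hmd : MDifferentiableAt I 𝓘(ℝ, E) f p := hf.mdifferentiableAt hn
  have h2 : ContDiffAt ℝ n (Ψ ∘ f ∘ Φ.symm) (Φ p) := by
    have := (contMDiffAt_iff.1 hf).2
    rw [I.range_eq_univ, contDiffWithinAt_univ] at this
    exact this
  have h3 : HasFDerivAt (Ψ ∘ f ∘ Φ.symm) (f' : F →L[ℝ] E) (Φ p) := by
    refine hasFDerivWithinAt_univ.1 ?_
    have := hmd.hasMFDerivAt.2
    rw [hf', I.range_eq_univ] at this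
    exact this
  have hval : (Ψ ∘ f ∘ Φ.symm) (Φ p) = Ψ (f p) := by simp [hΦ]
  have h4 := h2.to_localInverse h3 hn
  have h5 := h2.localInverse_apply_image h3 hn
  have h6 : ∀ᶠ v in 𝓝 ((Ψ ∘ f ∘ Φ.symm) (Φ p)),
      (Ψ ∘ f ∘ Φ.symm) (h2.localInverse h3 hn v) = v :=
    (h2.hasStrictFDerivAt' h3 hn).eventually_right_inverse
  set k := h2.localInverse h3 hn with hk
  rw [hval] at h4 h5 h6
  refine ⟨Φ.symm ∘ k ∘ Ψ, ?_, ?_⟩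
  · have c1 : ContMDiffAt 𝓘(ℝ, E) 𝓘(ℝ, E) n Ψ (f p) := contMDiffAt_extChartAt
    have c2 : ContMDiffAt 𝓘(ℝ, E) 𝓘(ℝ, F) n k (Ψ (f p)) := h4.contMDiffAt
    have c3 : ContMDiffAt 𝓘(ℝ, F) I n Φ.symm (k (Ψ (f p))) := by
      rw [h5]
      exact (contMDiffOn_extChartAt_symm p).contMDiffAt (extChartAt_target_mem_nhds p)
    exact ContMDiffAt.comp (f p) (g := Φ.symm) (f := k ∘ Ψ) c3 (c2.comp _ c1)
  · have t1 : Tendsto Ψ (𝓝 (f p)) (𝓝 (Ψ (f p))) := continuousAt_extChartAt (f p)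
    have t2 : Tendsto k (𝓝 (Ψ (f p))) (𝓝 (Φ p)) := by
      have := h4.continuousAt
      unfold ContinuousAt at this
      rwa [h5] at this
    have t3 : Tendsto Φ.symm (𝓝 (Φ p)) (𝓝 p) := by
      have := continuousAt_extChartAt_symm (I := I) p
      unfold ContinuousAt at this
      rwa [extChartAt_to_inv] at this
    have t4 : Tendsto f (𝓝 p) (𝓝 (f p)) := hmd.continuousAt
    have hs : ∀ᶠ q in 𝓝 (f p), f ((Φ.symm ∘ k ∘ Ψ) q) ∈ Ψ.source :=
      (t4.comp (t3.comp (t2.comp t1))).eventually (extChartAt_source_mem_nhds (f p))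
    filter_upwards [t1.eventually h6, hs, extChartAt_source_mem_nhds (I := 𝓘(ℝ, E)) (f p)]
      with q hq hq1 hq2
    exact Ψ.injOn hq1 hq2 hq

namespace IsDoubleLieGroup

variable {E EA EB : Type*}
  [NormedAddCommGroup E] [NormedSpace ℝ E]
  [NormedAddCommGroup EA] [NormedSpace ℝ EA]
  [NormedAddCommGroup EB] [NormedSpace ℝ EB]
  {G : Type*} [TopologicalSpace G] [ChartedSpace E G] [Group G]
  {A B : Subgroup G} [ChartedSpace EA A] [ChartedSpace EB B]

/-! ### Smoothness of the projections -/

/-- The inclusion `𝔞 → 𝔤`. -/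
def inclA (_D : IsDoubleLieGroup E EA EB A B) : EA →L[ℝ] E :=
  mfderiv 𝓘(ℝ, EA) 𝓘(ℝ, E) (fun a : A => (a : G)) 1

/-- The inclusion `𝔟 → 𝔤`. -/
def inclB (_D : IsDoubleLieGroup E EA EB A B) : EB →L[ℝ] E :=
  mfderiv 𝓘(ℝ, EB) 𝓘(ℝ, E) (fun b : B => (b : G)) 1

variable (D : IsDoubleLieGroup E EA EB A B)

theorem contMDiff_mul_coe (D : IsDoubleLieGroup E EA EB A B) :
    ContMDiff (𝓘(ℝ, EA).prod 𝓘(ℝ, EB)) 𝓘(ℝ, E) (⊤ : ℕ∞)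
    (fun p : A × B => (p.1 * p.2 : G)) := by
  have := D.lieGroup
  exact (D.contMDiff_left.comp contMDiff_fst).mul (D.contMDiff_right.comp contMDiff_snd)

theorem mfderiv_mul_coe (v : EA × EB) :
    mfderiv (𝓘(ℝ, EA).prod 𝓘(ℝ, EB)) 𝓘(ℝ, E) (fun p : A × B => (p.1 * p.2 : G)) (1, 1) v =
      D.inclA v.1 + D.inclB v.2 := by
  have h := D.contMDiff_mul_coe.mdifferentiable (by simp) (1, 1)
  refine (mfderiv_prod_eq_add_apply h).trans ?_
  have h1 : (fun z : A => ((z, ((1 : A), (1 : B)).2).1 * (z, ((1 : A), (1 : B)).2).2 : G)) =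
      fun a : A => (a : G) := by funext z; simp
  have h2 : (fun z : B => ((((1 : A), (1 : B)).1, z).1 * (((1 : A), (1 : B)).1, z).2 : G)) =
      fun b : B => (b : G) := by funext z; simp
  rw [h1, h2]
  rfl

/-- This is 𝔞 ∩ 𝔟 = 0. -/
theorem inclA_eq_zero_of_eq_inclB [CompleteSpace E] [CompleteSpace EA] [CompleteSpace EB]
    {X : EA} {Y : EB} (h : D.inclA X = D.inclB Y) : D.inclA X = 0 := by
  have := D.lieGroup
  have := D.lieGroup_left
  have := D.lieGroup_right
  exact mfderiv_coe_eq_zero_of_disjoint D.contMDiff_left D.contMDiff_right D.inf_eq_bot X Y h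

/-- The derivative (X, Y) ↦ X + Y is injective because 𝔞 ∩ 𝔟 = 0. Surjectivity is a dimension count:
A × B → G is a smooth surjection from a second countable manifold, so dim 𝔤 ≤ dim 𝔞 + dim 𝔟. -/
theorem exists_equiv_mfderiv_mul_coe (D : IsDoubleLieGroup E EA EB A B)
    [SecondCountableTopology G] [FiniteDimensional ℝ E]
    [FiniteDimensional ℝ EA] [FiniteDimensional ℝ EB] :
    ∃ e : (EA × EB) ≃L[ℝ] E,
      mfderiv (𝓘(ℝ, EA).prod 𝓘(ℝ, EB)) 𝓘(ℝ, E) (fun p : A × B => (p.1 * p.2 : G)) (1, 1) =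
        (e : (EA × EB) →L[ℝ] E) := by
  have := D.lieGroup
  have := D.lieGroup_left
  have := D.lieGroup_right
  have := FiniteDimensional.complete ℝ E
  have := FiniteDimensional.complete ℝ EA
  have := FiniteDimensional.complete ℝ EB
  have : IsManifold 𝓘(ℝ, E) 1 G :=
    IsManifold.of_le (n := ((⊤ : ℕ∞) : WithTop ℕ∞)) (by exact_mod_cast le_top)
  have : IsManifold 𝓘(ℝ, EA) 1 A :=
    IsManifold.of_le (n := ((⊤ : ℕ∞) : WithTop ℕ∞)) (by exact_mod_cast le_top)
  have : IsManifold 𝓘(ℝ, EB) 1 B :=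
    IsManifold.of_le (n := ((⊤ : ℕ∞) : WithTop ℕ∞)) (by exact_mod_cast le_top)
  let L : (EA × EB) →ₗ[ℝ] E := (D.inclA.coprod D.inclB).toLinearMap
  have hL : ∀ v, L v = D.inclA v.1 + D.inclB v.2 := fun v => rfl
  have hinj : Function.Injective L := by
    rw [injective_iff_map_eq_zero]
    rintro ⟨X, Y⟩ h
    rw [hL] at h
    have h1 : D.inclA X = D.inclB (-Y) := by
      rw [map_neg]; exact eq_neg_of_add_eq_zero_left h
    have h2 : D.inclA X = 0 := D.inclA_eq_zero_of_eq_inclB h1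
    have h3 : D.inclB Y = 0 := by simpa [h2] using h
    have hX : X = 0 := D.immersion_left 1 (h2.trans (map_zero D.inclA).symm)
    have hY : Y = 0 := D.immersion_right 1 (h3.trans (map_zero D.inclB).symm)
    rw [hX, hY]; rfl
  have hle : Module.finrank ℝ E ≤ Module.finrank ℝ (EA × EB) := by
    have : SecondCountableTopology A :=
      TopologicalSpace.Subtype.secondCountableTopology (A : Set G)
    have : SecondCountableTopology B :=
      TopologicalSpace.Subtype.secondCountableTopology (B : Set G)
    refine finrank_le_of_contMDiff_surjective (M := A × B) (N := G)
      (I := 𝓘(ℝ, EA).prod 𝓘(ℝ, EB)) (f := fun p : A × B => (p.1 * p.2 : G))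
      (D.contMDiff_mul_coe.of_le (by exact_mod_cast le_top)) ?_
    intro g
    exact ⟨(D.aL g, D.bR g), D.aL_mul_bR g⟩
  have heq : Module.finrank ℝ (EA × EB) = Module.finrank ℝ E :=
    le_antisymm (LinearMap.finrank_le_finrank_of_injective hinj) hle
  refine ⟨(LinearMap.linearEquivOfInjective L hinj heq).toContinuousLinearEquiv, ?_⟩
  ext v
  rw [D.mfderiv_mul_coe v]
  rfl

section

variable [SecondCountableTopology G] [FiniteDimensional ℝ E]
    [FiniteDimensional ℝ EA] [FiniteDimensional ℝ EB]

/-- The local right inverse of A × B → G given by the inverse function theorem must coincide with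
(a_L, b_R), because the factorisation is unique. -/
theorem contMDiffAt_aL_bR_one :
    ContMDiffAt 𝓘(ℝ, E) (𝓘(ℝ, EA).prod 𝓘(ℝ, EB)) (⊤ : ℕ∞) (fun g => (D.aL g, D.bR g)) 1 := by
  have := D.lieGroup
  have := D.lieGroup_left
  have := D.lieGroup_right
  have := FiniteDimensional.complete ℝ EA
  have := FiniteDimensional.complete ℝ EB
  obtain ⟨e, he⟩ := D.exists_equiv_mfderiv_mul_coe
  obtain ⟨g, hg, hg'⟩ := exists_contMDiffAt_right_inverse (M := A × B) (N := G)
    (n := ((⊤ : ℕ∞) : WithTop ℕ∞)) (by simp) (D.contMDiff_mul_coe.contMDiffAt (x := (1, 1))) e he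
  simp only [OneMemClass.coe_one, mul_one] at hg hg'
  refine hg.congr_of_eventuallyEq ?_
  filter_upwards [hg'] with q hq
  have h := D.aL_bR_unique (g q).1 (g q).2
  rw [hq] at h
  rw [h.1, h.2]

/-- Smoothness at 1 spreads to any q by the translation g ↦ a_L(q)⁻¹ g b_R(q)⁻¹, which moves q to 1
and under which a_L is equivariant. -/
theorem contMDiff_aL : ContMDiff 𝓘(ℝ, E) 𝓘(ℝ, EA) (⊤ : ℕ∞) D.aL := by
  have := D.lieGroup
  have := D.lieGroup_left
  intro q
  have h1 : ContMDiffAt 𝓘(ℝ, E) 𝓘(ℝ, EA) (⊤ : ℕ∞) D.aL 1 := D.contMDiffAt_aL_bR_one.fst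
  have h2 : ContMDiffAt 𝓘(ℝ, E) 𝓘(ℝ, E) (⊤ : ℕ∞)
      (fun g : G => ((D.aL q)⁻¹ : A) * g * ((D.bR q)⁻¹ : B)) q :=
    (contMDiffAt_const.mul contMDiffAt_id).mul contMDiffAt_const
  have h3 : ((D.aL q)⁻¹ : A) * q * ((D.bR q)⁻¹ : B) = (1 : G) := by
    conv_lhs => enter [1, 2]; rw [← D.aL_mul_bR q]
    simp
  have h4 := (contMDiffAt_const (c := D.aL q)).mul (h1.comp_of_eq h2 h3)
  refine h4.congr_of_eventuallyEq (Eventually.of_forall fun g => ?_)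
  change D.aL g = D.aL q * D.aL (((D.aL q)⁻¹ : A) * g * ((D.bR q)⁻¹ : B))
  rw [aL_mul_coe, aL_coe_mul, mul_inv_cancel_left]

theorem contMDiff_bR : ContMDiff 𝓘(ℝ, E) 𝓘(ℝ, EB) (⊤ : ℕ∞) D.bR := by
  have := D.lieGroup
  have := D.lieGroup_right
  intro q
  have h1 : ContMDiffAt 𝓘(ℝ, E) 𝓘(ℝ, EB) (⊤ : ℕ∞) D.bR 1 := D.contMDiffAt_aL_bR_one.snd
  have h2 : ContMDiffAt 𝓘(ℝ, E) 𝓘(ℝ, E) (⊤ : ℕ∞)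
      (fun g : G => ((D.aL q)⁻¹ : A) * g * ((D.bR q)⁻¹ : B)) q :=
    (contMDiffAt_const.mul contMDiffAt_id).mul contMDiffAt_const
  have h3 : ((D.aL q)⁻¹ : A) * q * ((D.bR q)⁻¹ : B) = (1 : G) := by
    conv_lhs => enter [1, 2]; rw [← D.aL_mul_bR q]
    simp
  have h4 := (h1.comp_of_eq h2 h3).mul (contMDiffAt_const (c := D.bR q))
  refine h4.congr_of_eventuallyEq (Eventually.of_forall fun g => ?_)
  change D.bR g = D.bR (((D.aL q)⁻¹ : A) * g * ((D.bR q)⁻¹ : B)) * D.bR q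
  rw [bR_mul_coe, bR_coe_mul, inv_mul_cancel_right]

theorem contMDiff_bL : ContMDiff 𝓘(ℝ, E) 𝓘(ℝ, EB) (⊤ : ℕ∞) D.bL := by
  have := D.lieGroup
  have := D.lieGroup_right
  have h := (D.contMDiff_bR.comp (contMDiff_inv 𝓘(ℝ, E) ((⊤ : ℕ∞) : WithTop ℕ∞))).inv
  convert h using 1
  funext g
  simp [bR_inv]

theorem contMDiff_aR : ContMDiff 𝓘(ℝ, E) 𝓘(ℝ, EA) (⊤ : ℕ∞) D.aR := by
  have := D.lieGroup
  have := D.lieGroup_left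
  have h := (D.contMDiff_aL.comp (contMDiff_inv 𝓘(ℝ, E) ((⊤ : ℕ∞) : WithTop ℕ∞))).inv
  convert h using 1
  funext g
  simp [aL_inv]

end

end IsDoubleLieGroup

/-! ### Determinants of block triangular maps -/

section BlockDeterminants

variable {V W : Type*} [AddCommGroup V] [Module ℝ V] [FiniteDimensional ℝ V]
  [AddCommGroup W] [Module ℝ W] [FiniteDimensional ℝ W]

theorem LinearMap.det_eq_mul_of_snd_inl_eq_zero (L : V × W →ₗ[ℝ] V × W)
    (h : ∀ v, (L (v, 0)).2 = 0) :
    LinearMap.det L = LinearMap.det (LinearMap.fst ℝ V W ∘ₗ L ∘ₗ LinearMap.inl ℝ V W) *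
      LinearMap.det (LinearMap.snd ℝ V W ∘ₗ L ∘ₗ LinearMap.inr ℝ V W) := by
  classical
  let e := Module.finBasis ℝ V
  let f := Module.finBasis ℝ W
  rw [← LinearMap.det_toMatrix (e.prod f), ← LinearMap.det_toMatrix e, ← LinearMap.det_toMatrix f]
  have : LinearMap.toMatrix (e.prod f) (e.prod f) L =
      Matrix.fromBlocks (LinearMap.toMatrix e e (LinearMap.fst ℝ V W ∘ₗ L ∘ₗ LinearMap.inl ℝ V W))
        (LinearMap.toMatrix f e (LinearMap.fst ℝ V W ∘ₗ L ∘ₗ LinearMap.inr ℝ V W)) 0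
        (LinearMap.toMatrix f f (LinearMap.snd ℝ V W ∘ₗ L ∘ₗ LinearMap.inr ℝ V W)) := by
    ext (i | i) (j | j) <;> simp [LinearMap.toMatrix_apply, h]
  rw [this, Matrix.det_fromBlocks_zero₂₁]

theorem LinearMap.det_eq_mul_of_fst_inr_eq_zero (L : V × W →ₗ[ℝ] V × W)
    (h : ∀ w, (L (0, w)).1 = 0) :
    LinearMap.det L = LinearMap.det (LinearMap.fst ℝ V W ∘ₗ L ∘ₗ LinearMap.inl ℝ V W) *
      LinearMap.det (LinearMap.snd ℝ V W ∘ₗ L ∘ₗ LinearMap.inr ℝ V W) := by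
  classical
  let e := Module.finBasis ℝ V
  let f := Module.finBasis ℝ W
  rw [← LinearMap.det_toMatrix (e.prod f), ← LinearMap.det_toMatrix e, ← LinearMap.det_toMatrix f]
  have : LinearMap.toMatrix (e.prod f) (e.prod f) L =
      Matrix.fromBlocks (LinearMap.toMatrix e e (LinearMap.fst ℝ V W ∘ₗ L ∘ₗ LinearMap.inl ℝ V W))
        0 (LinearMap.toMatrix e f (LinearMap.snd ℝ V W ∘ₗ L ∘ₗ LinearMap.inl ℝ V W))
        (LinearMap.toMatrix f f (LinearMap.snd ℝ V W ∘ₗ L ∘ₗ LinearMap.inr ℝ V W)) := by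
    ext (i | i) (j | j) <;> simp [LinearMap.toMatrix_apply, h]
  rw [this, Matrix.det_fromBlocks_zero₁₂]

end BlockDeterminants

/-! ### The adjoint representation in blocks with respect to 𝔤 = 𝔞 ⊕ 𝔟 -/

namespace IsDoubleLieGroup

variable {E EA EB : Type*}
  [NormedAddCommGroup E] [NormedSpace ℝ E]
  [NormedAddCommGroup EA] [NormedSpace ℝ EA]
  [NormedAddCommGroup EB] [NormedSpace ℝ EB]
  {G : Type*} [TopologicalSpace G] [ChartedSpace E G] [Group G]
  {A B : Subgroup G} [ChartedSpace EA A] [ChartedSpace EB B]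

/-- The projection `𝔤 → 𝔞` along `𝔟`. -/
def projA (D : IsDoubleLieGroup E EA EB A B) : E →L[ℝ] EA :=
  mfderiv 𝓘(ℝ, E) 𝓘(ℝ, EA) D.aL 1

/-- The projection `𝔤 → 𝔟` along `𝔞`. -/
def projB (D : IsDoubleLieGroup E EA EB A B) : E →L[ℝ] EB :=
  mfderiv 𝓘(ℝ, E) 𝓘(ℝ, EB) D.bR 1

/-- The block `𝔞 → 𝔞` of `Ad g`. -/
def blockA (D : IsDoubleLieGroup E EA EB A B) (g : G) : EA →ₗ[ℝ] EA :=
  D.projA.toLinearMap ∘ₗ D.Ad g ∘ₗ D.inclA.toLinearMap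

/-- The block `𝔟 → 𝔟` of `Ad g`. -/
def blockB (D : IsDoubleLieGroup E EA EB A B) (g : G) : EB →ₗ[ℝ] EB :=
  D.projB.toLinearMap ∘ₗ D.Ad g ∘ₗ D.inclB.toLinearMap

variable (D : IsDoubleLieGroup E EA EB A B)

theorem mdifferentiable_coe_left (D : IsDoubleLieGroup E EA EB A B) :
    MDifferentiable 𝓘(ℝ, EA) 𝓘(ℝ, E) (fun a : A => (a : G)) :=
  D.contMDiff_left.mdifferentiable (by simp)

theorem mdifferentiable_coe_right (D : IsDoubleLieGroup E EA EB A B) :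
    MDifferentiable 𝓘(ℝ, EB) 𝓘(ℝ, E) (fun b : B => (b : G)) :=
  D.contMDiff_right.mdifferentiable (by simp)

theorem contMDiff_conj (D : IsDoubleLieGroup E EA EB A B) (g : G) :
    ContMDiff 𝓘(ℝ, E) 𝓘(ℝ, E) (⊤ : ℕ∞) (fun h : G => g * h * g⁻¹) := by
  have := D.lieGroup
  exact (contMDiff_const.mul contMDiff_id).mul contMDiff_const

theorem Ad_mul (g h : G) : D.Ad (g * h) = D.Ad g ∘ₗ D.Ad h := by
  have h1 := (D.contMDiff_conj g).mdifferentiable (by simp) 1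
  have h2 := (D.contMDiff_conj h).mdifferentiable (by simp) 1
  have h3 := mfderiv_comp_of_eq (x := (1 : G)) (y := 1) h1 h2 (by simp)
  have h4 : (fun k : G => g * k * g⁻¹) ∘ (fun k : G => h * k * h⁻¹) =
      fun k : G => g * h * k * (g * h)⁻¹ := by
    funext k; simp [mul_assoc]
  rw [h4] at h3
  -- The chain rule takes the outer derivative at h · 1 · h⁻¹; this moves it to 1, all tangent
  -- spaces being the model space.
  have h5 : ∀ y : G, y = 1 →
      (mfderiv 𝓘(ℝ, E) 𝓘(ℝ, E) (fun k : G => g * k * g⁻¹) y : E →L[ℝ] E) =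
        (mfderiv 𝓘(ℝ, E) 𝓘(ℝ, E) (fun k : G => g * k * g⁻¹) 1 : E →L[ℝ] E) := by
    rintro _ rfl; rfl
  ext X
  exact (DFunLike.congr_fun h3 X).trans (DFunLike.congr_fun (h5 (h * 1 * h⁻¹) (by simp)) _)

theorem Ad_one : D.Ad 1 = LinearMap.id := by
  have h : (fun h : G => 1 * h * 1⁻¹) = id := by funext h; simp
  unfold Ad
  rw [h, mfderiv_id]
  rfl

/-- The derivative at `1` of `φ ∘ Ad g ∘ incl`. -/
theorem mfderiv_comp_conj_coe {F P : Type*} [NormedAddCommGroup F] [NormedSpace ℝ F]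
    [TopologicalSpace P] [ChartedSpace F P] {φ : G → P}
    (hφ : MDifferentiableAt 𝓘(ℝ, E) 𝓘(ℝ, F) φ 1) (g : G) (X : EB) :
    mfderiv 𝓘(ℝ, EB) 𝓘(ℝ, F) (fun b : B => φ (g * b * g⁻¹)) 1 X =
      mfderiv 𝓘(ℝ, E) 𝓘(ℝ, F) φ 1 (D.Ad g (D.inclB X)) := by
  have h1 := (D.contMDiff_conj g).mdifferentiable (by simp) 1
  have h2 := D.mdifferentiable_coe_right 1
  have h3 := mfderiv_comp_apply_of_eq (x := (1 : B)) (y := (1 : G)) h1 h2 rfl X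
  have h4 := mfderiv_comp_apply_of_eq (x := (1 : B)) (y := (1 : G)) hφ
    (MDifferentiableAt.comp_of_eq (y := (1 : G)) (1 : B) h1 h2 rfl)
    (by simp) X
  exact h4.trans (congrArg _ h3)

theorem mfderiv_comp_conj_coe_left {F P : Type*} [NormedAddCommGroup F] [NormedSpace ℝ F]
    [TopologicalSpace P] [ChartedSpace F P] {φ : G → P}
    (hφ : MDifferentiableAt 𝓘(ℝ, E) 𝓘(ℝ, F) φ 1) (g : G) (X : EA) :
    mfderiv 𝓘(ℝ, EA) 𝓘(ℝ, F) (fun a : A => φ (g * a * g⁻¹)) 1 X =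
      mfderiv 𝓘(ℝ, E) 𝓘(ℝ, F) φ 1 (D.Ad g (D.inclA X)) := by
  have h1 := (D.contMDiff_conj g).mdifferentiable (by simp) 1
  have h2 := D.mdifferentiable_coe_left 1
  have h3 := mfderiv_comp_apply_of_eq (x := (1 : A)) (y := (1 : G)) h1 h2 rfl X
  have h4 := mfderiv_comp_apply_of_eq (x := (1 : A)) (y := (1 : G)) hφ
    (MDifferentiableAt.comp_of_eq (y := (1 : G)) (1 : A) h1 h2 rfl)
    (by simp) X
  exact h4.trans (congrArg _ h3)

section

variable [SecondCountableTopology G] [FiniteDimensional ℝ E]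
    [FiniteDimensional ℝ EA] [FiniteDimensional ℝ EB]

theorem mdifferentiable_aL : MDifferentiable 𝓘(ℝ, E) 𝓘(ℝ, EA) D.aL :=
  D.contMDiff_aL.mdifferentiable (by simp)

theorem mdifferentiable_bR : MDifferentiable 𝓘(ℝ, E) 𝓘(ℝ, EB) D.bR :=
  D.contMDiff_bR.mdifferentiable (by simp)

theorem mdifferentiable_bL : MDifferentiable 𝓘(ℝ, E) 𝓘(ℝ, EB) D.bL :=
  D.contMDiff_bL.mdifferentiable (by simp)

/-- Conjugation by a preserves A, and b_R is constant on A. -/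
theorem projB_Ad_coe_inclA (a : A) (X : EA) : D.projB (D.Ad a (D.inclA X)) = 0 := by
  refine (D.mfderiv_comp_conj_coe_left (D.mdifferentiable_bR 1) a X).symm.trans ?_
  have : (fun c : A => D.bR ((a : G) * c * (a : G)⁻¹)) = fun _ => 1 := by
    funext c
    rw [← Subgroup.coe_inv, ← Subgroup.coe_mul, ← Subgroup.coe_mul, bR_coe_left]
  rw [this, mfderiv_const]
  rfl

theorem projA_Ad_coe_inclB (b : B) (X : EB) : D.projA (D.Ad b (D.inclB X)) = 0 := by
  refine (D.mfderiv_comp_conj_coe (D.mdifferentiable_aL 1) b X).symm.trans ?_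
  have : (fun c : B => D.aL ((b : G) * c * (b : G)⁻¹)) = fun _ => 1 := by
    funext c
    rw [← Subgroup.coe_inv, ← Subgroup.coe_mul, ← Subgroup.coe_mul, aL_coe_right]
  rw [this, mfderiv_const]
  rfl

theorem projB_inclA (X : EA) : D.projB (D.inclA X) = 0 := by
  simpa [Ad_one] using D.projB_Ad_coe_inclA 1 X

theorem projA_inclB (X : EB) : D.projA (D.inclB X) = 0 := by
  simpa [Ad_one] using D.projA_Ad_coe_inclB 1 X

theorem projA_inclA (X : EA) : D.projA (D.inclA X) = X := by
  have h := mfderiv_comp_apply_of_eq (x := (1 : A)) (y := (1 : G)) (D.mdifferentiable_aL 1)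
    (D.mdifferentiable_coe_left 1) rfl X
  have h1 : D.aL ∘ (fun a : A => (a : G)) = id := by funext a; exact D.aL_coe a
  rw [h1, mfderiv_id] at h
  exact h.symm

theorem projB_inclB (X : EB) : D.projB (D.inclB X) = X := by
  have h := mfderiv_comp_apply_of_eq (x := (1 : B)) (y := (1 : G)) (D.mdifferentiable_bR 1)
    (D.mdifferentiable_coe_right 1) rfl X
  have h1 : D.bR ∘ (fun b : B => (b : G)) = id := by funext b; exact D.bR_coe b
  rw [h1, mfderiv_id] at h
  exact h.symm

theorem inclA_projA_add_inclB_projB (v : E) :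
    D.inclA (D.projA v) + D.inclB (D.projB v) = v := by
  obtain ⟨e, he⟩ := D.exists_equiv_mfderiv_mul_coe
  obtain ⟨w, rfl⟩ := e.surjective v
  have h : e w = D.inclA w.1 + D.inclB w.2 :=
    (DFunLike.congr_fun he w).symm.trans (D.mfderiv_mul_coe w)
  rw [h, map_add D.projA, map_add D.projB, projA_inclA, projA_inclB, projB_inclA, projB_inclB,
    add_zero, zero_add]

/-- Both b_L and b_R restrict to the identity on B and to a constant on A. As 𝔤 = 𝔞 ⊕ 𝔟, their
derivatives at 1 coincide. -/
theorem mfderiv_bL_one (v : E) : mfderiv 𝓘(ℝ, E) 𝓘(ℝ, EB) D.bL 1 v = D.projB v := by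
  have hB (X : EB) : mfderiv 𝓘(ℝ, E) 𝓘(ℝ, EB) D.bL 1 (D.inclB X) = X := by
    have h := mfderiv_comp_apply_of_eq (x := (1 : B)) (y := (1 : G)) (D.mdifferentiable_bL 1)
      (D.mdifferentiable_coe_right 1) rfl X
    have h1 : D.bL ∘ (fun b : B => (b : G)) = id := by funext b; exact D.bL_coe b
    rw [h1, mfderiv_id] at h
    exact h.symm
  have hA (X : EA) : mfderiv 𝓘(ℝ, E) 𝓘(ℝ, EB) D.bL 1 (D.inclA X) = (0 : EB) := by
    have h := mfderiv_comp_apply_of_eq (x := (1 : A)) (y := (1 : G)) (D.mdifferentiable_bL 1)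
      (D.mdifferentiable_coe_left 1) rfl X
    have h1 : D.bL ∘ (fun a : A => (a : G)) = fun _ => 1 := by funext a; exact D.bL_coe_left a
    rw [h1, mfderiv_const] at h
    exact h.symm
  have h := congrArg (mfderiv 𝓘(ℝ, E) 𝓘(ℝ, EB) D.bL 1) (D.inclA_projA_add_inclB_projB v)
  refine h.symm.trans ((ContinuousLinearMap.map_add _ _ _).trans ?_)
  exact (congrArg₂ (fun x y : EB => x + y) (hA _) (hB _)).trans (zero_add _)

/-! ### The blocks of the adjoint representation -/

/-- The block is not multiplicative on G. It is so for a left factor in A, because Ad a preserves 𝔞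
and the 𝔞-component of Ad g X contributes nothing; a right factor in B works because Ad b preserves
𝔟. -/
theorem blockB_coe_mul (a : A) (g : G) : D.blockB (a * g) = D.blockB a ∘ₗ D.blockB g := by
  ext X
  simp only [blockB, Ad_mul, LinearMap.comp_apply, ContinuousLinearMap.coe_coe]
  conv_lhs => rw [← D.inclA_projA_add_inclB_projB (D.Ad g (D.inclB X))]
  rw [map_add, map_add, projB_Ad_coe_inclA, zero_add]

theorem blockB_mul_coe (g : G) (b : B) : D.blockB (g * b) = D.blockB g ∘ₗ D.blockB b := by
  ext X
  simp only [blockB, Ad_mul, LinearMap.comp_apply, ContinuousLinearMap.coe_coe]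
  conv_lhs => rw [← D.inclA_projA_add_inclB_projB (D.Ad b (D.inclB X))]
  rw [projA_Ad_coe_inclB, map_zero, zero_add]

theorem blockA_mul_coe (g : G) (a : A) : D.blockA (g * a) = D.blockA g ∘ₗ D.blockA a := by
  ext X
  simp only [blockA, Ad_mul, LinearMap.comp_apply, ContinuousLinearMap.coe_coe]
  conv_lhs => rw [← D.inclA_projA_add_inclB_projB (D.Ad a (D.inclA X))]
  rw [projB_Ad_coe_inclA, map_zero, add_zero]

theorem blockB_one : D.blockB 1 = LinearMap.id := by
  ext X
  simp [blockB, Ad_one, projB_inclB]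

/-- The decomposition `𝔞 × 𝔟 ≃ 𝔤`. -/
def splitting : (EA × EB) ≃ₗ[ℝ] E :=
  LinearEquiv.ofLinearMap (D.inclA.toLinearMap.coprod D.inclB.toLinearMap)
    (D.projA.toLinearMap.prod D.projB.toLinearMap)
    (by ext v; simp [inclA_projA_add_inclB_projB])
    (by ext v <;> simp [projA_inclA, projA_inclB, projB_inclA, projB_inclB])

theorem det_Ad_eq_of_inclA (g : G) (h : ∀ X, D.projB (D.Ad g (D.inclA X)) = 0) :
    LinearMap.det (D.Ad g) = LinearMap.det (D.blockA g) * LinearMap.det (D.blockB g) := by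
  rw [← LinearMap.det_conj (D.Ad g) D.splitting.symm, LinearMap.det_eq_mul_of_snd_inl_eq_zero]
  · congr 2
    · ext X; simp [splitting, blockA]
    · ext X; simp [splitting, blockB]
  · intro X
    simpa [splitting] using h X

theorem det_Ad_eq_of_inclB (g : G) (h : ∀ X, D.projA (D.Ad g (D.inclB X)) = 0) :
    LinearMap.det (D.Ad g) = LinearMap.det (D.blockA g) * LinearMap.det (D.blockB g) := by
  rw [← LinearMap.det_conj (D.Ad g) D.splitting.symm, LinearMap.det_eq_mul_of_fst_inr_eq_zero]
  · congr 2
    · ext X; simp [splitting, blockA]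
    · ext X; simp [splitting, blockB]
  · intro X
    simpa [splitting] using h X

theorem det_blockB_mul_inv_left (a : A) :
    LinearMap.det (D.blockB a) * LinearMap.det (D.blockB (a⁻¹ : A)) = 1 := by
  rw [← LinearMap.det_comp, ← blockB_coe_mul, ← Subgroup.coe_mul, mul_inv_cancel,
    Subgroup.coe_one, blockB_one, LinearMap.det_id]

theorem det_blockB_mul_inv_right (b : B) :
    LinearMap.det (D.blockB b) * LinearMap.det (D.blockB (b⁻¹ : B)) = 1 := by
  rw [← LinearMap.det_comp, ← blockB_mul_coe, ← Subgroup.coe_mul, mul_inv_cancel,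
    Subgroup.coe_one, blockB_one, LinearMap.det_id]

/-- The character `|det (Ad b)|` of `B`. -/
def detB : B →* ℝ where
  toFun b := |LinearMap.det (D.blockB b)|
  map_one' := by rw [Subgroup.coe_one, blockB_one, LinearMap.det_id, abs_one]
  map_mul' b c := by rw [Subgroup.coe_mul, blockB_mul_coe, LinearMap.det_comp, abs_mul]

/-- The modulus of the action of `A` on `𝔤 / 𝔞`. -/
def detA : A →* ℝ where
  toFun a := |LinearMap.det (D.blockB a)|
  map_one' := by rw [Subgroup.coe_one, blockB_one, LinearMap.det_id, abs_one]
  map_mul' b c := by rw [Subgroup.coe_mul, blockB_coe_mul, LinearMap.det_comp, abs_mul]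

theorem detA_pos (a : A) : 0 < D.detA a :=
  abs_pos.2 (left_ne_zero_of_mul_eq_one (D.det_blockB_mul_inv_left a))

theorem detB_pos (b : B) : 0 < D.detB b :=
  abs_pos.2 (left_ne_zero_of_mul_eq_one (D.det_blockB_mul_inv_right b))

theorem detA_inv (a : A) : D.detA a⁻¹ = (D.detA a)⁻¹ :=
  eq_inv_of_mul_eq_one_left (by rw [← map_mul, inv_mul_cancel, map_one])

end

end IsDoubleLieGroup

/-! ### The function Q in terms of the characters of A and B -/

namespace IsDoubleLieGroup

variable {E EA EB : Type*}
  [NormedAddCommGroup E] [NormedSpace ℝ E]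
  [NormedAddCommGroup EA] [NormedSpace ℝ EA]
  [NormedAddCommGroup EB] [NormedSpace ℝ EB]
  {G : Type*} [TopologicalSpace G] [ChartedSpace E G] [Group G]
  {A B : Subgroup G} [ChartedSpace EA A] [ChartedSpace EB B]
  (D : IsDoubleLieGroup E EA EB A B)

theorem inclA_mem_lieA (X : EA) : D.inclA X ∈ D.lieA := ⟨X, rfl⟩

theorem inclB_mem_lieB (X : EB) : D.inclB X ∈ D.lieB := ⟨X, rfl⟩

variable [SecondCountableTopology G] [FiniteDimensional ℝ E]
    [FiniteDimensional ℝ EA] [FiniteDimensional ℝ EB]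

theorem isCompl_lieA_lieB : IsCompl D.lieA D.lieB := by
  constructor
  · rw [Submodule.disjoint_def]
    rintro _ ⟨X, rfl⟩ ⟨Y, hY⟩
    change D.inclB Y = D.inclA X at hY
    change D.inclA X = 0
    have h : (0 : EA) = X :=
      ((D.projA_inclB Y).symm.trans (congrArg D.projA hY)).trans (D.projA_inclA X)
    rw [← h, map_zero]
  · rw [codisjoint_iff, eq_top_iff]
    intro v _
    rw [← D.inclA_projA_add_inclB_projB v]
    exact Submodule.add_mem_sup ⟨D.projA v, rfl⟩ ⟨D.projB v, rfl⟩

/-- `𝔞`, as the tangent space of `A` and as a subspace of `𝔤`. -/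
def equivLieA : EA ≃ₗ[ℝ] D.lieA :=
  LinearEquiv.ofBijective (D.inclA.toLinearMap.codRestrict D.lieA D.inclA_mem_lieA)
    ⟨fun X Y h => by
      have := congrArg D.projA (Subtype.ext_iff.1 h)
      simpa [projA_inclA] using this, by
      rintro ⟨_, X, rfl⟩
      exact ⟨X, rfl⟩⟩

/-- `𝔟`, as the tangent space of `B` and as a subspace of `𝔤`. -/
def equivLieB : EB ≃ₗ[ℝ] D.lieB :=
  LinearEquiv.ofBijective (D.inclB.toLinearMap.codRestrict D.lieB D.inclB_mem_lieB)
    ⟨fun X Y h => by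
      have := congrArg D.projB (Subtype.ext_iff.1 h)
      simpa [projB_inclB] using this, by
      rintro ⟨_, X, rfl⟩
      exact ⟨X, rfl⟩⟩

theorem projectionOnto_lieA (h : IsCompl D.lieA D.lieB) (v : E) :
    Submodule.projectionOnto D.lieA D.lieB h v = D.equivLieA (D.projA v) := by
  conv_lhs => rw [← D.inclA_projA_add_inclB_projB v]
  rw [map_add, Submodule.projectionOnto_apply_of_mem_right h (D.inclB_mem_lieB _), add_zero]
  exact Submodule.projectionOnto_apply_left h (D.equivLieA (D.projA v))

theorem projectionOnto_lieB (h : IsCompl D.lieB D.lieA) (v : E) :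
    Submodule.projectionOnto D.lieB D.lieA h v = D.equivLieB (D.projB v) := by
  conv_lhs => rw [← D.inclA_projA_add_inclB_projB v]
  rw [map_add, Submodule.projectionOnto_apply_of_mem_right h (D.inclA_mem_lieA _), zero_add]
  exact Submodule.projectionOnto_apply_left h (D.equivLieB (D.projB v))

theorem Q_eq (g : G) : D.Q g = LinearMap.det (D.Ad g) /
    (LinearMap.det (D.blockA g) * LinearMap.det (D.blockB g)) := by
  rw [Q, dif_pos D.isCompl_lieA_lieB]
  congr 2
  · rw [← LinearMap.det_conj (D.blockA g) D.equivLieA]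
    congr 1
    ext ⟨_, X, rfl⟩
    have hX : D.equivLieA.symm ⟨_, D.inclA_mem_lieA X⟩ = X :=
      (LinearEquiv.symm_apply_eq _).2 rfl
    simp only [LinearMap.comp_apply, projectionOnto_lieA, LinearEquiv.coe_coe, blockA]
    erw [hX]
    rfl
  · rw [← LinearMap.det_conj (D.blockB g) D.equivLieB]
    congr 1
    ext ⟨_, X, rfl⟩
    have hX : D.equivLieB.symm ⟨_, D.inclB_mem_lieB X⟩ = X :=
      (LinearEquiv.symm_apply_eq _).2 rfl
    simp only [LinearMap.comp_apply, projectionOnto_lieB, LinearEquiv.coe_coe, blockB]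
    erw [hX]
    rfl

/-- Factor g = b_L a_R in det Ad and in the 𝔞-block, and g = a_L b_R in the 𝔟-block. Since Ad b_L
and Ad a_R are block triangular, the 𝔞-blocks cancel and only determinants of 𝔟-blocks remain. -/
theorem abs_Q_eq (g : G) : |D.Q g| =
    D.detA (D.aR g) * D.detB (D.bL g) / (D.detA (D.aL g) * D.detB (D.bR g)) := by
  have hAd : LinearMap.det (D.Ad g) =
      (LinearMap.det (D.blockA (D.bL g)) * LinearMap.det (D.blockB (D.bL g))) *
      (LinearMap.det (D.blockA (D.aR g)) * LinearMap.det (D.blockB (D.aR g))) := by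
    conv_lhs => rw [← D.bL_mul_aR g, Ad_mul, LinearMap.det_comp]
    rw [D.det_Ad_eq_of_inclB _ (D.projA_Ad_coe_inclB _),
      D.det_Ad_eq_of_inclA _ (D.projB_Ad_coe_inclA _)]
  have hA : LinearMap.det (D.blockA g) =
      LinearMap.det (D.blockA (D.bL g)) * LinearMap.det (D.blockA (D.aR g)) := by
    conv_lhs => rw [← D.bL_mul_aR g, blockA_mul_coe, LinearMap.det_comp]
  have hB : LinearMap.det (D.blockB g) =
      LinearMap.det (D.blockB (D.aL g)) * LinearMap.det (D.blockB (D.bR g)) := by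
    conv_lhs => rw [← D.aL_mul_bR g, blockB_coe_mul, LinearMap.det_comp]
  have hne : LinearMap.det (D.Ad g) ≠ 0 := by
    refine left_ne_zero_of_mul_eq_one (b := LinearMap.det (D.Ad g⁻¹)) ?_
    rw [← LinearMap.det_comp, ← Ad_mul, mul_inv_cancel, Ad_one, LinearMap.det_id]
  rw [Q_eq, hA, hB]
  rw [hAd] at hne ⊢
  have h1 := (D.detA_pos (D.aL g)).ne'
  have h2 := (D.detB_pos (D.bR g)).ne'
  change |LinearMap.det (D.blockB (D.aL g))| ≠ 0 at h1
  change |LinearMap.det (D.blockB (D.bR g))| ≠ 0 at h2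
  change _ = |LinearMap.det (D.blockB (D.aR g))| * |LinearMap.det (D.blockB (D.bL g))| /
    (|LinearMap.det (D.blockB (D.aL g))| * |LinearMap.det (D.blockB (D.bR g))|)
  rw [← abs_mul, ← abs_mul, ← abs_div]
  rw [abs_ne_zero] at h1 h2
  simp only [mul_ne_zero_iff] at hne
  obtain ⟨⟨h3, h4⟩, h5, h6⟩ := hne
  congr 1
  field_simp

theorem abs_Q_pos (g : G) : 0 < |D.Q g| := by
  rw [abs_Q_eq]
  exact div_pos (mul_pos (D.detA_pos _) (D.detB_pos _)) (mul_pos (D.detA_pos _) (D.detB_pos _))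

end IsDoubleLieGroup

/-! ### Determinants of tangent maps at fixed points -/

section TangentDet

variable {F : Type*} [NormedAddCommGroup F] [NormedSpace ℝ F]
  {H : Type*} [TopologicalSpace H]

/-- The determinant of the tangent map of `f` at a fixed point `p`. -/
def tangentDet (I : ModelWithCorners ℝ F H) {P : Type*} [TopologicalSpace P] [ChartedSpace H P]
    (f : P → P) (p : P) : ℝ :=
  LinearMap.det (M := F) (mfderiv I I f p).toLinearMap

variable {I : ModelWithCorners ℝ F H} {P : Type*} [TopologicalSpace P] [ChartedSpace H P]

theorem tangentDet_id (p : P) : tangentDet I (fun x => x) p = 1 := by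
  have h : mfderiv I I (fun x : P => x) p = ContinuousLinearMap.id ℝ (TangentSpace I p) :=
    mfderiv_id
  unfold tangentDet
  rw [h]
  exact LinearMap.det_id

theorem tangentDet_comp {f g : P → P} {p : P} (hf : MDifferentiableAt I I f p)
    (hg : MDifferentiableAt I I g p) (hp : g p = p) :
    tangentDet I (fun x => f (g x)) p = tangentDet I f p * tangentDet I g p := by
  have h := mfderiv_comp_of_eq (x := p) (y := p) hf hg hp
  have h5 : ∀ y : P, y = p → (mfderiv I I f y : F →L[ℝ] F) = (mfderiv I I f p : F →L[ℝ] F) := by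
    rintro _ rfl; rfl
  unfold tangentDet
  refine (congrArg (LinearMap.det (M := F)) ?_).trans (LinearMap.det_comp (M := F) _ _)
  ext X
  exact (DFunLike.congr_fun h X).trans (DFunLike.congr_fun (h5 (g p) hp) _)

theorem tangentDet_comp₅ {f₁ f₂ f₃ f₄ f₅ : P → P} {p : P} (h₁ : MDifferentiableAt I I f₁ p)
    (h₂ : MDifferentiableAt I I f₂ p) (h₃ : MDifferentiableAt I I f₃ p)
    (h₄ : MDifferentiableAt I I f₄ p) (h₅ : MDifferentiableAt I I f₅ p)
    (e₂ : f₂ p = p) (e₃ : f₃ p = p) (e₄ : f₄ p = p) (e₅ : f₅ p = p) :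
    tangentDet I (fun x => f₁ (f₂ (f₃ (f₄ (f₅ x))))) p = tangentDet I f₁ p *
      (tangentDet I f₂ p * (tangentDet I f₃ p * (tangentDet I f₄ p * tangentDet I f₅ p))) := by
  have g₄ : MDifferentiableAt I I (fun x => f₄ (f₅ x)) p := MDifferentiableAt.comp_of_eq p h₄ h₅ e₅
  have k₄ : f₄ (f₅ p) = p := by rw [e₅, e₄]
  have g₃ : MDifferentiableAt I I (fun x => f₃ (f₄ (f₅ x))) p := MDifferentiableAt.comp_of_eq p h₃ g₄ k₄
  have k₃ : f₃ (f₄ (f₅ p)) = p := by rw [k₄, e₃]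
  have g₂ : MDifferentiableAt I I (fun x => f₂ (f₃ (f₄ (f₅ x)))) p := MDifferentiableAt.comp_of_eq p h₂ g₃ k₃
  have k₂ : f₂ (f₃ (f₄ (f₅ p))) = p := by rw [k₃, e₂]
  rw [tangentDet_comp h₁ g₂ k₂, tangentDet_comp h₂ g₃ k₃, tangentDet_comp h₃ g₄ k₄,
    tangentDet_comp h₄ h₅ e₅]

/-- The cyclic permutation has order three, so its determinant is a real cube root of 1. -/
theorem tangentDet_rotate (p : P) :
    tangentDet (I.prod (I.prod I)) (fun x : P × P × P => (x.2.2, x.1, x.2.1)) (p, p, p) = 1 := by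
  have hd : MDifferentiable (I.prod (I.prod I)) (I.prod (I.prod I))
      (fun x : P × P × P => (x.2.2, x.1, x.2.1)) :=
    (mdifferentiable_snd.comp mdifferentiable_snd).prodMk
      (mdifferentiable_fst.prodMk (mdifferentiable_fst.comp mdifferentiable_snd))
  have h2 := tangentDet_comp (hd (p, p, p)) (hd (p, p, p)) rfl
  have h3 := tangentDet_comp (hd (p, p, p))
    (MDifferentiableAt.comp (p, p, p) (hd (p, p, p)) (hd (p, p, p))) rfl
  have h4 := h3.symm.trans (tangentDet_id (p, p, p))
  rw [Function.comp_def, h2] at h4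
  set d := tangentDet (I.prod (I.prod I)) (fun x : P × P × P => (x.2.2, x.1, x.2.1)) (p, p, p)
  nlinarith [sq_nonneg (d + 1), sq_nonneg d]

/-- Inversion is an involution, so its determinant squares to 1. -/
theorem abs_tangentDet_inv {P : Type*} [TopologicalSpace P] [ChartedSpace H P] [Group P]
    [LieGroup I (⊤ : ℕ∞) P] : |tangentDet I (fun x : P => x⁻¹) 1| = 1 := by
  have hd : MDifferentiable I I (fun x : P => x⁻¹) :=
    (contMDiff_inv I ((⊤ : ℕ∞) : WithTop ℕ∞)).mdifferentiable (by simp)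
  have h2 := tangentDet_comp (hd 1) (hd 1) inv_one
  simp only [inv_inv, tangentDet_id] at h2
  rw [← abs_one (α := ℝ), ← sq_eq_sq_iff_abs_eq_abs, one_pow, sq, ← h2]

variable {F' : Type*} [NormedAddCommGroup F'] [NormedSpace ℝ F']
  {H' : Type*} [TopologicalSpace H'] {J : ModelWithCorners ℝ F' H'}
  {N : Type*} [TopologicalSpace N] [ChartedSpace H' N]
  [FiniteDimensional ℝ F] [FiniteDimensional ℝ F']

/-- A map altering a single coordinate has a block triangular derivative with an identity block, so
only the partial derivative in that coordinate matters. -/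
theorem tangentDet_prod_left {f : P × N → P} {p : P} {q : N}
    (hf : MDifferentiableAt (I.prod J) I f (p, q)) :
    tangentDet (I.prod J) (fun x => (f x, x.2)) (p, q) = tangentDet I (fun x => f (x, q)) p := by
  have h1 (v : F × F') : (mfderiv (I.prod J) (I.prod J) (fun x : P × N => (f x, x.2)) (p, q) v :
      F × F') = ((mfderiv (I.prod J) I f (p, q) v : F), v.2) := by
    rw [mfderiv_prodMk hf mdifferentiableAt_snd]
    rw [mfderiv_snd]
    rfl
  have h2 (v : F) : (mfderiv I I (fun x => f (x, q)) p v : F) =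
      (mfderiv (I.prod J) I f (p, q) ((v, 0) : F × F') : F) := by
    have h3 : MDifferentiableAt I (I.prod J) (fun x : P => (x, q)) p :=
      mdifferentiableAt_id.prodMk mdifferentiableAt_const
    have h4 := mfderiv_comp_apply (x := p) (g := f) (f := fun x : P => (x, q)) hf h3 v
    rw [mfderiv_prod_left] at h4
    exact h4
  unfold tangentDet
  refine (LinearMap.det_eq_mul_of_snd_inl_eq_zero (V := F) (W := F') _ ?_).trans ?_
  · intro v
    exact congrArg Prod.snd (h1 (v, 0))
  · have e1 : LinearMap.snd ℝ F F' ∘ₗ (mfderiv (I.prod J) (I.prod J)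
        (fun x : P × N => (f x, x.2)) (p, q)).toLinearMap ∘ₗ LinearMap.inr ℝ F F' =
        LinearMap.id := by
      ext v
      exact congrArg Prod.snd (h1 (0, v))
    have e2 : LinearMap.fst ℝ F F' ∘ₗ (mfderiv (I.prod J) (I.prod J)
        (fun x : P × N => (f x, x.2)) (p, q)).toLinearMap ∘ₗ LinearMap.inl ℝ F F' =
        (mfderiv I I (fun x => f (x, q)) p).toLinearMap := by
      ext v
      exact (congrArg Prod.fst (h1 (v, 0))).trans (h2 v).symm
    erw [e1, e2]
    rw [LinearMap.det_id, mul_one]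
    rfl

theorem tangentDet_prod_right {f : P × N → N} {p : P} {q : N}
    (hf : MDifferentiableAt (I.prod J) J f (p, q)) :
    tangentDet (I.prod J) (fun x => (x.1, f x)) (p, q) = tangentDet J (fun x => f (p, x)) q := by
  have h1 (v : F × F') : (mfderiv (I.prod J) (I.prod J) (fun x : P × N => (x.1, f x)) (p, q) v :
      F × F') = (v.1, (mfderiv (I.prod J) J f (p, q) v : F')) := by
    rw [mfderiv_prodMk mdifferentiableAt_fst hf]
    rw [mfderiv_fst]
    rfl
  have h2 (v : F') : (mfderiv J J (fun x => f (p, x)) q v : F') =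
      (mfderiv (I.prod J) J f (p, q) ((0, v) : F × F') : F') := by
    have h3 : MDifferentiableAt J (I.prod J) (fun x : N => (p, x)) q :=
      mdifferentiableAt_const.prodMk mdifferentiableAt_id
    have h4 := mfderiv_comp_apply (x := q) (g := f) (f := fun x : N => (p, x)) hf h3 v
    rw [mfderiv_prod_right] at h4
    exact h4
  unfold tangentDet
  refine (LinearMap.det_eq_mul_of_fst_inr_eq_zero (V := F) (W := F') _ ?_).trans ?_
  · intro v
    exact congrArg Prod.fst (h1 (0, v))
  · have e1 : LinearMap.fst ℝ F F' ∘ₗ (mfderiv (I.prod J) (I.prod J)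
        (fun x : P × N => (x.1, f x)) (p, q)).toLinearMap ∘ₗ LinearMap.inl ℝ F F' =
        LinearMap.id := by
      ext v
      exact congrArg Prod.fst (h1 (v, 0))
    have e2 : LinearMap.snd ℝ F F' ∘ₗ (mfderiv (I.prod J) (I.prod J)
        (fun x : P × N => (x.1, f x)) (p, q)).toLinearMap ∘ₗ LinearMap.inr ℝ F F' =
        (mfderiv J J (fun x => f (p, x)) q).toLinearMap := by
      ext v
      exact (congrArg Prod.snd (h1 (0, v))).trans (h2 v).symm
    erw [e1, e2]
    rw [LinearMap.det_id, one_mul]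
    rfl

end TangentDet

/-! ### Tangent maps of the group inverse, of the groupoid inverse and of t_δ -/

namespace IsDoubleLieGroup

variable {E EA EB : Type*}
  [NormedAddCommGroup E] [NormedSpace ℝ E]
  [NormedAddCommGroup EA] [NormedSpace ℝ EA]
  [NormedAddCommGroup EB] [NormedSpace ℝ EB]
  {G : Type*} [TopologicalSpace G] [ChartedSpace E G] [Group G]
  {A B : Subgroup G} [ChartedSpace EA A] [ChartedSpace EB B]
  (D : IsDoubleLieGroup E EA EB A B)

theorem mdifferentiable_inv_right (D : IsDoubleLieGroup E EA EB A B) :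
    MDifferentiable 𝓘(ℝ, EB) 𝓘(ℝ, EB) (fun b : B => b⁻¹) := by
  have := D.lieGroup_right
  exact (contMDiff_inv 𝓘(ℝ, EB) ((⊤ : ℕ∞) : WithTop ℕ∞)).mdifferentiable (by simp)

/-- In the fiber coordinates the group inverse is b ↦ b⁻¹, independently of g. -/
theorem abs_det_tangentLR_inv (g : G) :
    |LinearMap.det (D.tangentLR (fun h => h⁻¹) g)| = 1 := by
  have := D.lieGroup_right
  have h : (fun b : B => D.rightCoord g⁻¹ (g * b)⁻¹) = fun b : B => b⁻¹ := by
    funext b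
    rw [mul_inv_rev, ← Subgroup.coe_inv, rightCoord_mul]
  rw [← abs_tangentDet_inv (I := 𝓘(ℝ, EB)) (P := B), ← h]
  rfl

theorem abs_det_tangentRL_inv (g : G) :
    |LinearMap.det (D.tangentRL (fun h => h⁻¹) g)| = 1 := by
  have := D.lieGroup_right
  have h : (fun b : B => D.leftCoord g⁻¹ (b * g)⁻¹) = fun b : B => b⁻¹ := by
    funext b
    rw [mul_inv_rev, ← Subgroup.coe_inv, leftCoord_mul]
  rw [← abs_tangentDet_inv (I := 𝓘(ℝ, EB)) (P := B), ← h]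
  rfl

/-! ### The map `t_δ` in coordinates -/

theorem mDelta_eq (x : G) (y : G × G) : D.mDelta x y =
    ((D.bL x * y.1 : G), (D.bR (D.bL x * D.aL y.1) * y.2 : G)) := by
  simp only [mDelta, mulA, deltaR, bL_coe_mul_coe]

/-- A factorisation into steps which each replace one coordinate, followed by a rotation. With β =
b_L(x) and ε = b_R(β a_L(y₁)), the first slot becomes the coordinate of z'₁. The second slot becomes
mε⁻¹ with m = b_R(b₁β a_L(b₂y₁)), then the coordinate m b₃ ε⁻¹ of z'₂. Finally the third slot
becomes the coordinate of x'. Each step can be computed from the slots still available. -/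
theorem tDeltaCoord_eq (x : G) (y : G × G) (b : B × B × B) :
    D.tDeltaCoord x y b =
      (fun q : B × B × B => (q.2.2, q.1, q.2.1))
      ((fun q : B × B × B => (q.1, q.2.1, (D.bR x)⁻¹ *
        D.bR (q.2.1 * (D.bR (D.bL x * D.aL y.1) * y.2)) * (D.bR (q.2.2 * y.2))⁻¹))
      ((fun q : B × B × B => (q.1, q.2.1 * (D.bR (D.bL x * D.aL y.1) * q.2.2 *
        (D.bR (D.bL x * D.aL y.1))⁻¹), q.2.2))
      ((fun q : B × B × B => (q.1, D.bR (q.1 * (D.bL x * y.1)) * (D.bR (q.2.1 * y.1))⁻¹ *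
        (D.bR (D.bL x * D.aL y.1))⁻¹, q.2.2))
      ((fun q : B × B × B => (q.1 * (D.bL x * q.2.1 * (D.bL x)⁻¹), q.2)) b)))) := by
  obtain ⟨b₁, b₂, b₃⟩ := b
  simp only [tDeltaCoord, mDelta_eq, leftCoord, rightCoord, Prod.mk.injEq]
  set β := D.bL x with hβ
  set ε := D.bR (β * D.aL y.1) with hε
  rw [← B.coe_mul b₁ β]
  have hbx : D.bL ((b₁ * β : B) * D.aL (b₂ * y.1) * D.aL (b₃ * y.2) : G) = b₁ * β := by
    rw [mul_assoc, ← Subgroup.coe_mul, bL_coe_mul_coe]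
  have hbR : D.bR ((b₁ * β : B) * D.aL (b₂ * y.1) * D.aL (b₃ * y.2)) =
      D.bR (D.bR ((b₁ * β : B) * D.aL (b₂ * y.1)) * (b₃ * y.2)) * (D.bR (b₃ * y.2))⁻¹ := by
    rw [eq_mul_inv_iff_mul_eq, ← D.bR_mul]
    conv_lhs => rw [← D.aL_mul_bR ((b₁ * β : B) * D.aL (b₂ * y.1)), mul_assoc, bR_coe_mul]
  have hmid : D.bR ((b₁ * β : B) * D.aL (b₂ * y.1)) =
      D.bR ((b₁ * (β * b₂ * β⁻¹) : B) * (β * y.1)) * (D.bR (b₂ * y.1))⁻¹ := by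
    rw [eq_mul_inv_iff_mul_eq, ← D.bR_mul]
    congr 1
    push_cast
    group
  rw [hbx, hbR, ← hmid]
  generalize D.bR ((b₁ * β : B) * D.aL (b₂ * y.1)) = m
  refine ⟨?_, ?_, ?_⟩
  · rw [mul_assoc (D.bR x)⁻¹]
    congr 3
    push_cast
    group
  · simp only [bL_coe_mul]
    group
  · simp only [bL_coe_mul]
    group

variable [SecondCountableTopology G] [FiniteDimensional ℝ E]
    [FiniteDimensional ℝ EA] [FiniteDimensional ℝ EB]

/-! ### Determinants of tangent maps -/

/-- The derivative of b_L at 1 is the projection to 𝔟 along 𝔞, so composing it with conjugation by g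
gives the 𝔟-block of Ad g. -/
theorem tangentDet_bL_conj (g : G) :
    tangentDet 𝓘(ℝ, EB) (fun b : B => D.bL (g * b * g⁻¹)) 1 = LinearMap.det (D.blockB g) := by
  unfold tangentDet
  refine congrArg (LinearMap.det (M := EB)) ?_
  ext X
  exact (D.mfderiv_comp_conj_coe (D.mdifferentiable_bL 1) g X).trans (D.mfderiv_bL_one _)

theorem tangentDet_bR_conj (g : G) :
    tangentDet 𝓘(ℝ, EB) (fun b : B => D.bR (g * b * g⁻¹)) 1 = LinearMap.det (D.blockB g) := by
  unfold tangentDet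
  refine congrArg (LinearMap.det (M := EB)) ?_
  ext X
  exact D.mfderiv_comp_conj_coe (D.mdifferentiable_bR 1) g X

/-- Inserting a⁻¹ on the right does not change b_L, so left multiplication by a may be replaced by
conjugation. -/
theorem abs_tangentDet_bL_coe_mul (a : A) :
    |tangentDet 𝓘(ℝ, EB) (fun b : B => D.bL (a * b)) 1| = D.detA a := by
  have h : (fun b : B => D.bL (a * b)) = fun b : B => D.bL ((a : G) * b * (a : G)⁻¹) := by
    funext b
    rw [← Subgroup.coe_inv, bL_mul_coe]
  rw [h, tangentDet_bL_conj]
  rfl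

theorem abs_tangentDet_bR_mul_coe (a : A) :
    |tangentDet 𝓘(ℝ, EB) (fun b : B => D.bR (b * a)) 1| = (D.detA a)⁻¹ := by
  have h : (fun b : B => D.bR (b * a)) =
      fun b : B => D.bR (((a⁻¹ : A) : G) * b * ((a⁻¹ : A) : G)⁻¹) := by
    funext b
    rw [mul_assoc, bR_coe_mul, Subgroup.coe_inv, inv_inv]
  rw [h, tangentDet_bR_conj, ← detA_inv]
  rfl

theorem mdifferentiable_bL_coe_mul (a : A) :
    MDifferentiable 𝓘(ℝ, EB) 𝓘(ℝ, EB) (fun b : B => D.bL (a * b)) := by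
  have := D.lieGroup
  have h : ContMDiff 𝓘(ℝ, EB) 𝓘(ℝ, EB) (⊤ : ℕ∞) (fun b : B => D.bL (a * b)) :=
    D.contMDiff_bL.comp (contMDiff_const.mul D.contMDiff_right)
  exact h.mdifferentiable (by simp)

theorem mdifferentiable_bR_mul_coe (a : A) :
    MDifferentiable 𝓘(ℝ, EB) 𝓘(ℝ, EB) (fun b : B => D.bR (b * a)) := by
  have := D.lieGroup
  have h : ContMDiff 𝓘(ℝ, EB) 𝓘(ℝ, EB) (⊤ : ℕ∞) (fun b : B => D.bR (b * a)) :=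
    D.contMDiff_bR.comp (D.contMDiff_right.mul contMDiff_const)
  exact h.mdifferentiable (by simp)

theorem abs_tangentDet_bL_coe_mul_inv (a : A) :
    |tangentDet 𝓘(ℝ, EB) (fun b : B => (D.bL (a * b))⁻¹) 1| = D.detA a := by
  have := D.lieGroup_right
  rw [tangentDet_comp (f := fun b : B => b⁻¹) (D.mdifferentiable_inv_right 1)
    (D.mdifferentiable_bL_coe_mul a 1) (by rw [Subgroup.coe_one, mul_one, bL_coe_left]), abs_mul,
    abs_tangentDet_inv, one_mul, abs_tangentDet_bL_coe_mul]

theorem abs_tangentDet_bR_mul_coe_inv (a : A) :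
    |tangentDet 𝓘(ℝ, EB) (fun b : B => (D.bR (b * a))⁻¹) 1| = (D.detA a)⁻¹ := by
  have := D.lieGroup_right
  rw [tangentDet_comp (f := fun b : B => b⁻¹) (D.mdifferentiable_inv_right 1)
    (D.mdifferentiable_bR_mul_coe a 1) (by rw [Subgroup.coe_one, one_mul, bR_coe_left]), abs_mul,
    abs_tangentDet_inv, one_mul, abs_tangentDet_bR_mul_coe]

theorem abs_tangentDet_conj (c : B) :
    |tangentDet 𝓘(ℝ, EB) (fun b : B => c * b * c⁻¹) 1| = D.detB c := by
  have h : (fun b : B => c * b * c⁻¹) = fun b : B => D.bR ((c : G) * b * (c : G)⁻¹) := by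
    funext b
    rw [← Subgroup.coe_inv, ← Subgroup.coe_mul, ← Subgroup.coe_mul, bR_coe]
  rw [h, tangentDet_bR_conj]
  rfl

/-- By the cocycle identity, in fiber coordinates s is b ↦ b_L(a_R(g) b)⁻¹, the dressing action
followed by inversion. -/
theorem abs_det_tangentLR_sA (g : G) :
    |LinearMap.det (D.tangentLR D.sA g)| = D.detA (D.aR g) := by
  have h : (fun b : B => D.rightCoord (D.sA g) (D.sA (g * b))) =
      fun b : B => (D.bL (D.aR g * b))⁻¹ := by
    funext b
    rw [rightCoord, bL_sA, bL_sA, inv_inv, bL_mul, mul_inv_rev, inv_mul_cancel_right]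
  rw [← abs_tangentDet_bL_coe_mul_inv, ← h]
  rfl

theorem abs_det_tangentRL_sA (g : G) :
    |LinearMap.det (D.tangentRL D.sA g)| = (D.detA (D.aL g))⁻¹ := by
  have h : (fun b : B => D.leftCoord (D.sA g) (D.sA (b * g))) =
      fun b : B => (D.bR (b * D.aL g))⁻¹ := by
    funext b
    rw [leftCoord, bR_sA, bR_sA, inv_inv, bR_mul, mul_inv_rev, mul_inv_cancel_left]
  rw [← abs_tangentDet_bR_mul_coe_inv, ← h]
  rfl

/-! ### The Jacobian of `t_δ` -/

/-- Every factor of `tDeltaCoord_eq` fixes (1, 1, 1), so the determinants multiply. The first and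
third steps and the rotation contribute 1. The second gives detB(ε) / detA(a_L(y₁)) and the fourth 1
/ detA(a_L(y₂)); the hypothesis on a_R(x) merges the two denominators. -/
theorem jacobian_eq (x : G) (y : G × G) (h : D.aR x = D.aL y.1 * D.aL y.2) :
    D.jacobian x y = D.detB (D.bR (D.bL x * D.aL y.1)) / D.detA (D.aR x) := by
  have := D.lieGroup
  have := D.lieGroup_right
  set β := D.bL x with hβ
  set ε := D.bR (β * D.aL y.1) with hε
  have hx : (β * D.aL y.1 * D.aL y.2 : G) = x := by
    rw [mul_assoc, ← Subgroup.coe_mul, ← h, D.bL_mul_aR]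
  have hε1 : ε = D.bR (β * y.1) * (D.bR y.1)⁻¹ := by
    rw [eq_mul_inv_iff_mul_eq, D.bR_mul β y.1]
  have hx2 : D.bR (ε * y.2) = D.bR x * D.bR y.2 := by
    rw [D.bR_mul ε y.2]
    congr 1
    conv_rhs => rw [← hx, ← D.aL_mul_bR (β * D.aL y.1), mul_assoc, bR_coe_mul]
  -- the coordinates of `B × B × B` are smooth
  let I := 𝓘(ℝ, EB)
  let I₃ := I.prod (I.prod I)
  have q1 : ContMDiff I₃ I (⊤ : ℕ∞) (fun q : B × B × B => q.1) := contMDiff_fst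
  have q2 : ContMDiff I₃ I (⊤ : ℕ∞) (fun q : B × B × B => q.2.1) :=
    contMDiff_fst.comp contMDiff_snd
  have q3 : ContMDiff I₃ I (⊤ : ℕ∞) (fun q : B × B × B => q.2.2) :=
    contMDiff_snd.comp contMDiff_snd
  have hR {N : Type _} [TopologicalSpace N] {H F : Type _} [NormedAddCommGroup F]
      [NormedSpace ℝ F] [TopologicalSpace H] [ChartedSpace H N] {J : ModelWithCorners ℝ F H}
      {f : N → B} (hf : ContMDiff J I (⊤ : ℕ∞) f) (g : G) :
      ContMDiff J I (⊤ : ℕ∞) (fun n => D.bR (f n * g)) :=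
    D.contMDiff_bR.comp ((D.contMDiff_right.comp hf).mul contMDiff_const)
  have f1 : ContMDiff I₃ I (⊤ : ℕ∞)
      (fun q : B × B × B => q.1 * (β * q.2.1 * β⁻¹)) :=
    q1.mul ((contMDiff_const.mul q2).mul contMDiff_const)
  have f2 : ContMDiff I₃ I (⊤ : ℕ∞)
      (fun q : B × B × B => D.bR (q.1 * (β * y.1)) * (D.bR (q.2.1 * y.1))⁻¹ * ε⁻¹) :=
    ((hR q1 _).mul (hR q2 _).inv).mul contMDiff_const
  have f3 : ContMDiff I₃ I (⊤ : ℕ∞) (fun q : B × B × B => q.2.1 * (ε * q.2.2 * ε⁻¹)) :=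
    q2.mul ((contMDiff_const.mul q3).mul contMDiff_const)
  have f4 : ContMDiff I₃ I (⊤ : ℕ∞) (fun q : B × B × B => (D.bR x)⁻¹ *
        D.bR (q.2.1 * (ε * y.2)) * (D.bR (q.2.2 * y.2))⁻¹) :=
    (contMDiff_const.mul (hR q2 _)).mul (hR q3 _).inv
  have s0 := (q3.prodMk (q1.prodMk q2)).mdifferentiable (by simp)
  have s1 := (f1.prodMk contMDiff_snd).mdifferentiable (by simp)
  have s2 := (q1.prodMk (f2.prodMk q3)).mdifferentiable (by simp)
  have s3 := (q1.prodMk (f3.prodMk q3)).mdifferentiable (by simp)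
  have s4 := (q1.prodMk (q2.prodMk f4)).mdifferentiable (by simp)
  -- the partial maps
  have p2 (b : B) : D.bR (((1 : B) : G) * (β * y.1)) * (D.bR (b * y.1))⁻¹ * ε⁻¹ =
      ε * (D.bR (b * D.aL y.1))⁻¹ * ε⁻¹ := by
    rw [Subgroup.coe_one, one_mul, D.bR_mul b y.1, mul_inv_rev, ← mul_assoc, ← hε1]
  have p4 (b : B) : (D.bR x)⁻¹ * D.bR (((1 : B) : G) * (ε * y.2)) * (D.bR (b * y.2))⁻¹ =
      (D.bR (b * D.aL y.2))⁻¹ := by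
    rw [Subgroup.coe_one, one_mul, hx2, D.bR_mul b y.2, inv_mul_cancel_left, mul_inv_rev,
      mul_inv_cancel_left]
  have e1 : (fun q : B × B × B => (q.1 * (β * q.2.1 * β⁻¹), q.2)) (1, 1, 1) = (1, 1, 1) := by
    simp
  have e2 : (fun q : B × B × B => (q.1, D.bR (q.1 * (β * y.1)) * (D.bR (q.2.1 * y.1))⁻¹ * ε⁻¹,
      q.2.2)) (1, 1, 1) = (1, 1, 1) := by
    simp only [p2]
    simp [bR_coe_left]
  have e3 : (fun q : B × B × B => (q.1, q.2.1 * (ε * q.2.2 * ε⁻¹), q.2.2)) (1, 1, 1) =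
      (1, 1, 1) := by
    simp
  have e4 : (fun q : B × B × B => (q.1, q.2.1, (D.bR x)⁻¹ *
        D.bR (q.2.1 * (ε * y.2)) * (D.bR (q.2.2 * y.2))⁻¹)) (1, 1, 1) = (1, 1, 1) := by
    simp only [p4]
    simp [bR_coe_left]
  have r : ContMDiff (I.prod I) I₃ (⊤ : ℕ∞) (fun r : B × B => ((1 : B), r)) :=
    contMDiff_const.prodMk contMDiff_id
  have d1 : tangentDet I₃ (fun q : B × B × B => (q.1 * (β * q.2.1 * β⁻¹), q.2)) (1, 1, 1) = 1 := by
    refine (tangentDet_prod_left (I := I) (J := I.prod I) (p := (1 : B)) (q := ((1 : B), (1 : B)))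
      (f1.mdifferentiable (by simp) _)).trans ?_
    simpa using tangentDet_id (I := I) (1 : B)
  have d3 : tangentDet I₃ (fun q : B × B × B => (q.1, q.2.1 * (ε * q.2.2 * ε⁻¹), q.2.2))
      (1, 1, 1) = 1 := by
    refine (tangentDet_prod_right (I := I) (J := I.prod I) (p := (1 : B)) (q := ((1 : B), (1 : B)))
      ((f3.prodMk q3).mdifferentiable (by simp) _)).trans ?_
    refine (tangentDet_prod_left (I := I) (J := I) (p := (1 : B)) (q := (1 : B))
      ((f3.comp r).mdifferentiable (by simp) _)).trans ?_
    simpa using tangentDet_id (I := I) (1 : B)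
  have d2 : |tangentDet I₃ (fun q : B × B × B => (q.1, D.bR (q.1 * (β * y.1)) *
      (D.bR (q.2.1 * y.1))⁻¹ * ε⁻¹, q.2.2)) (1, 1, 1)| = D.detB ε * (D.detA (D.aL y.1))⁻¹ := by
    have h1 := (tangentDet_prod_right (I := I) (J := I.prod I) (p := (1 : B))
      (q := ((1 : B), (1 : B))) ((f2.prodMk q3).mdifferentiable (by simp) _)).trans
      (tangentDet_prod_left (I := I) (J := I) (p := (1 : B)) (q := (1 : B))
      ((f2.comp r).mdifferentiable (by simp) _))
    rw [h1]
    simp only [p2]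
    have h2 : MDifferentiable I I (fun b : B => ε * b * ε⁻¹) :=
      ((contMDiff_const.mul (contMDiff_id (n := ((⊤ : ℕ∞) : WithTop ℕ∞)))).mul
        contMDiff_const).mdifferentiable (by simp)
    rw [tangentDet_comp (I := I) (f := fun b : B => ε * b * ε⁻¹)
      (g := fun b : B => (D.bR (b * D.aL y.1))⁻¹) (h2 1)
      (((hR contMDiff_id _).inv).mdifferentiable (by simp) 1)
      (by rw [Subgroup.coe_one, one_mul, bR_coe_left, inv_one]), abs_mul,
      D.abs_tangentDet_conj ε, D.abs_tangentDet_bR_mul_coe_inv]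
  have d4 : |tangentDet I₃ (fun q : B × B × B => (q.1, q.2.1, (D.bR x)⁻¹ *
        D.bR (q.2.1 * (ε * y.2)) * (D.bR (q.2.2 * y.2))⁻¹)) (1, 1, 1)| =
      (D.detA (D.aL y.2))⁻¹ := by
    have h1 := (tangentDet_prod_right (I := I) (J := I.prod I) (p := (1 : B))
      (q := ((1 : B), (1 : B))) ((q2.prodMk f4).mdifferentiable (by simp) _)).trans
      (tangentDet_prod_right (I := I) (J := I) (p := (1 : B)) (q := (1 : B))
      ((f4.comp r).mdifferentiable (by simp) _))
    rw [h1]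
    simp only [p4]
    rw [← D.abs_tangentDet_bR_mul_coe_inv]
  have hJ : D.jacobian x y = |tangentDet I₃ (D.tDeltaCoord x y) (1, 1, 1)| := rfl
  rw [hJ, funext (D.tDeltaCoord_eq x y)]
  have hc := tangentDet_comp₅ (s0 (1, 1, 1)) (s4 (1, 1, 1)) (s3 (1, 1, 1)) (s2 (1, 1, 1))
    (s1 (1, 1, 1)) e4 e3 e2 e1
  refine (congrArg _ hc).trans ?_
  rw [tangentDet_rotate, d1, d3, one_mul, one_mul, mul_one, abs_mul, d2, d4, h, map_mul]
  ring

end IsDoubleLieGroup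

namespace BiHalfDensity

variable {ι V : Type*} [AddCommGroup V] [Module ℝ V]

theorem pullSwap_apply (d : BiHalfDensity ι V V) (S T : V →ₗ[ℝ] V) (v w : ι → V) :
    d.pullSwap S T v w =
      ((|LinearMap.det S| ^ (1 / 2 : ℝ) * |LinearMap.det T| ^ (1 / 2 : ℝ) : ℝ) : ℂ) * d w v :=
  d.map_det S T w v

end BiHalfDensity

namespace IsDoubleLieGroup

variable {E EA EB : Type*}
  [NormedAddCommGroup E] [NormedSpace ℝ E]
  [NormedAddCommGroup EA] [NormedSpace ℝ EA]
  [NormedAddCommGroup EB] [NormedSpace ℝ EB]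
  {G : Type*} [TopologicalSpace G] [ChartedSpace E G] [Group G]
  {A B : Subgroup G} [ChartedSpace EA A] [ChartedSpace EB B]
  (D : IsDoubleLieGroup E EA EB A B)

/-! ### The points `y` and `z` -/

theorem sA_sA (g : G) : D.sA (D.sA g) = g := by
  rw [sA_eq', aR_sA, bR_sA, inv_inv, aL_mul_bR]

/-- Multiplying by s(δ^L(x)) is left translation by inverses of b_L. If x = a₁ b a₂ and δ^L(x) = (a₁
b, b a₂), then b_L(a₁ b) = b_L(x), which simplifies the first component. -/
theorem mDeltaInv_eq (x : G) (z : G × G) (h : D.aL x = D.aL z.1 * D.aL z.2) :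
    D.mDeltaInv x z = ((((D.bL x)⁻¹ : B) * z.1 : G),
      (((D.bL (D.aL z.2 * D.bR x))⁻¹ : B) * z.2 : G)) := by
  have h1 : D.bL (D.aL z.1 * D.bL (D.aL z.2 * D.bR x)) = D.bL x := by
    conv_rhs => rw [← D.aL_mul_bR x, h, Subgroup.coe_mul, mul_assoc, D.bL_mul, aR_coe, bL_coe_left,
      one_mul]
    conv_rhs => rw [← D.bL_mul_aR (D.aL z.2 * D.bR x), ← mul_assoc, bL_mul_coe]
  simp only [mDeltaInv, mulA, deltaL, bL_sA, h1]

section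

variable {D} {x z₁ z₂ : G}

/-- The last factor of `x = a₁ b a₂`, for the decomposition of `δ^L(x)` over the left units of
`z₁`, `z₂`. -/
theorem bL_mul_eq_of_aL_eq (h : D.aL x = D.aL z₁ * D.aL z₂) :
    (D.bL x * (D.aR x * (D.aR (D.aL z₂ * D.bR x))⁻¹ : A) : G) =
      D.aL z₁ * D.bL (D.aL z₂ * D.bR x) := by
  rw [Subgroup.coe_mul, ← mul_assoc, D.bL_mul_aR, Subgroup.coe_inv, mul_inv_eq_iff_eq_mul,
    mul_assoc, D.bL_mul_aR, ← mul_assoc, ← Subgroup.coe_mul, ← h, D.aL_mul_bR]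

/-- Rewrites the first component of y in the order A·B, by moving b_L(x)⁻¹ past a_L(z₁) with
`bL_mul_eq_of_aL_eq`. Here a_L(y₁) is a_R(x) with the inverse of a_L(y₂) split off on the right. -/
theorem aL_mDeltaInv_fst (h : D.aL x = D.aL z₁ * D.aL z₂) :
    D.aL (((D.bL x)⁻¹ : B) * z₁) = D.aR x * (D.aR (D.aL z₂ * D.bR x))⁻¹ ∧
    D.bR (((D.bL x)⁻¹ : B) * z₁) = (D.bL (D.aL z₂ * D.bR x))⁻¹ * D.bR z₁ := by
  have h1 : (((D.bL x)⁻¹ : B) * z₁ : G) = (D.aR x * (D.aR (D.aL z₂ * D.bR x))⁻¹ : A) *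
      ((D.bL (D.aL z₂ * D.bR x))⁻¹ * D.bR z₁ : B) := by
    rw [Subgroup.coe_inv, inv_mul_eq_iff_eq_mul, ← mul_assoc, bL_mul_eq_of_aL_eq h,
      Subgroup.coe_mul, ← mul_assoc, mul_assoc (D.aL z₁ : G), Subgroup.coe_inv, mul_inv_cancel,
      mul_one, D.aL_mul_bR]
  rw [h1]
  exact D.aL_bR_unique _ _

theorem aL_mDeltaInv_snd :
    D.aL (((D.bL (D.aL z₂ * D.bR x))⁻¹ : B) * z₂) = D.aR (D.aL z₂ * D.bR x) ∧
    D.bR (((D.bL (D.aL z₂ * D.bR x))⁻¹ : B) * z₂) = (D.bR x)⁻¹ * D.bR z₂ := by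
  have h1 : (((D.bL (D.aL z₂ * D.bR x))⁻¹ : B) * z₂ : G) =
      D.aR (D.aL z₂ * D.bR x) * ((D.bR x)⁻¹ * D.bR z₂ : B) := by
    rw [Subgroup.coe_inv, inv_mul_eq_iff_eq_mul, ← mul_assoc, D.bL_mul_aR,
      Subgroup.coe_mul, ← mul_assoc, mul_assoc (D.aL z₂ : G), Subgroup.coe_inv, mul_inv_cancel,
      mul_one, D.aL_mul_bR]
  rw [h1]
  exact D.aL_bR_unique _ _

end

/-! ### Values on the basis -/

section

variable [FiniteDimensional ℝ EB] (ω : Bidensity EB G) (Ω : Bidensity₂ EB G)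

theorem unitaryAntipode_frame (g : G) :
    D.unitaryAntipode ω g (frame EB) (frame EB) = ω g⁻¹ (frame EB) (frame EB) := by
  rw [unitaryAntipode, BiHalfDensity.pullSwap_apply, abs_det_tangentLR_inv, abs_det_tangentRL_inv]
  simp

theorem unitaryAntipode₂_frame (g : G × G) :
    D.unitaryAntipode₂ Ω g (frame₂ EB) (frame₂ EB) =
      Ω (g.1⁻¹, g.2⁻¹) (frame₂ EB) (frame₂ EB) := by
  rw [unitaryAntipode₂, BiHalfDensity.pullSwap_apply, LinearMap.det_prodMap, LinearMap.det_prodMap,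
    abs_mul, abs_mul]
  simp only [abs_det_tangentLR_inv, abs_det_tangentRL_inv]
  simp

/-- Exchanging the two summands is an involution, so its determinant is ±1 and half-densities do not
notice it. -/
theorem flip_frame (g : G × G) :
    D.flip Ω g (frame₂ EB) (frame₂ EB) = Ω (g.2, g.1) (frame₂ EB) (frame₂ EB) := by
  let e : (EB × EB) →ₗ[ℝ] (EB × EB) := (LinearEquiv.prodComm ℝ EB EB).toLinearMap
  have he : |LinearMap.det e| = 1 := by
    have h : e ∘ₗ e = LinearMap.id := rfl
    have h2 : LinearMap.det e * LinearMap.det e = 1 := by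
      rw [← LinearMap.det_comp, h, LinearMap.det_id]
    rw [← abs_one (α := ℝ), ← sq_eq_sq_iff_abs_eq_abs, one_pow, sq, h2]
  have h := (Ω (g.2, g.1)).map_det e e (frame₂ EB) (frame₂ EB)
  rw [he] at h
  refine h.trans ?_
  simp

theorem tensor_frame (ω₁ ω₂ : Bidensity EB G) (g : G × G) :
    D.tensor ω₁ ω₂ g (frame₂ EB) (frame₂ EB) =
      ω₁ g.1 (frame EB) (frame EB) * ω₂ g.2 (frame EB) (frame EB) :=
  BiHalfDensity.ofValue_self _ _ _

end

section

variable [SecondCountableTopology G] [FiniteDimensional ℝ E]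
    [FiniteDimensional ℝ EA] [FiniteDimensional ℝ EB]

/-- Expressed through x and z alone, so that it can be compared at a triple and at its image under g
↦ s(g⁻¹). -/
theorem jacobian_mDeltaInv (x : G) (z : G × G) (h : D.aL x = D.aL z.1 * D.aL z.2) :
    D.jacobian x (D.mDeltaInv x z) = D.detB (D.bL (D.aL z.2 * D.bR x)) / D.detA (D.aR x) := by
  have h1 := aL_mDeltaInv_fst h
  have h2 := aL_mDeltaInv_snd (D := D) (x := x) (z₂ := z.2)
  rw [D.mDeltaInv_eq x z h, D.jacobian_eq]
  · rw [h1.1, bL_mul_eq_of_aL_eq h, bR_coe_mul_coe]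
  · simp only [h1.1, h2.1, inv_mul_cancel_right]

/-- The value of the modular factor in the involution. -/
def modFactor (g : G) : ℝ := (D.detA (D.aL g))⁻¹ * D.detA (D.aR g)

theorem modFactor_pos (g : G) : 0 < D.modFactor g :=
  mul_pos (inv_pos.2 (D.detA_pos _)) (D.detA_pos _)

variable (ω : Bidensity EB G) (Ω : Bidensity₂ EB G)

theorem adj_frame (g : G) :
    D.adj ω g (frame EB) (frame EB) =
      ((D.modFactor g ^ (1 / 2 : ℝ) : ℝ) : ℂ) *
        starRingEnd ℂ (ω (D.sA g) (frame EB) (frame EB)) := by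
  change starRingEnd ℂ ((ω (D.sA g)).pullSwap (D.tangentRL D.sA g) (D.tangentLR D.sA g)
    (frame EB) (frame EB)) = _
  rw [BiHalfDensity.pullSwap_apply, abs_det_tangentLR_sA, abs_det_tangentRL_sA, map_mul,
    Complex.conj_ofReal, modFactor, Real.mul_rpow (inv_pos.2 (D.detA_pos _)).le (D.detA_pos _).le]

theorem adj₂_frame (g : G × G) :
    D.adj₂ Ω g (frame₂ EB) (frame₂ EB) =
      (((D.modFactor g.1 * D.modFactor g.2) ^ (1 / 2 : ℝ) : ℝ) : ℂ) *
        starRingEnd ℂ (Ω (D.sA g.1, D.sA g.2) (frame₂ EB) (frame₂ EB)) := by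
  change starRingEnd ℂ ((Ω (D.sA g.1, D.sA g.2)).pullSwap
    ((D.tangentRL D.sA g.1).prodMap (D.tangentRL D.sA g.2))
    ((D.tangentLR D.sA g.1).prodMap (D.tangentLR D.sA g.2)) (frame₂ EB) (frame₂ EB)) = _
  have hL := fun g : G => (inv_pos.2 (D.detA_pos (D.aL g))).le
  have hR := fun g : G => (D.detA_pos (D.aR g)).le
  rw [BiHalfDensity.pullSwap_apply, LinearMap.det_prodMap, LinearMap.det_prodMap, abs_mul, abs_mul,
    map_mul, Complex.conj_ofReal, ← Real.mul_rpow (by positivity) (by positivity)]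
  simp only [abs_det_tangentLR_sA, abs_det_tangentRL_sA, modFactor]
  congr 3
  ring_nf

end

end IsDoubleLieGroup

/-- Continuity of the partial derivative of a smooth function with a parameter in a manifold. -/
theorem ContMDiffAt.continuousAt_fderiv {EN HN N F F' : Type*} [NormedAddCommGroup EN]
    [NormedSpace ℝ EN] [TopologicalSpace HN] {J : ModelWithCorners ℝ EN HN}
    [TopologicalSpace N] [ChartedSpace HN N] [IsManifold J (⊤ : ℕ∞) N]
    [NormedAddCommGroup F] [NormedSpace ℝ F] [NormedAddCommGroup F'] [NormedSpace ℝ F']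
    {f : N → F → F'} {x : N} {v : F}
    (h : ContMDiffAt (J.prod 𝓘(ℝ, F)) 𝓘(ℝ, F') (⊤ : ℕ∞) (Function.uncurry f) (x, v)) :
    ContinuousAt (fun y => fderiv ℝ (f y) v) x := by
  have h4 := ContMDiffAt.mfderiv (m := 0) f (fun _ => v) h contMDiffAt_const (by simp)
  refine h4.continuousAt.congr (Eventually.of_forall fun c => ?_)
  have h5 := congrFun (inTangentCoordinates_model_space (I := 𝓘(ℝ, F)) (I' := 𝓘(ℝ, F'))
    (fun _ : N => v) (fun y => f y v) (fun y => mfderiv 𝓘(ℝ, F) 𝓘(ℝ, F') (f y) v) x) c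
  exact h5.trans mfderiv_eq_fderiv

/-! ### The left-invariant density in the chart at 1 -/

section ChartDensity

variable {F : Type*} [NormedAddCommGroup F] [NormedSpace ℝ F]
  {H : Type*} [TopologicalSpace H] [ChartedSpace F H] [Group H]

/-- The tangent map of `c ↦ ψ (b c)` at `1`, where `ψ` is the chart at `1`. -/
def chartTangent (b : H) : F →L[ℝ] F :=
  mfderiv 𝓘(ℝ, F) 𝓘(ℝ, F) (fun c : H => chartAt F (1 : H) (b * c)) 1

/-- The density, in the chart at `1`, of the left-invariant density which is `1` on the standard
frame at `1`. -/
def chartDensity (b : H) : ℝ := |LinearMap.det (chartTangent (F := F) b).toLinearMap|⁻¹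

variable [LieGroup 𝓘(ℝ, F) (⊤ : ℕ∞) H]

theorem contMDiffAt_chart_one {b : H} (hb : b ∈ (chartAt F (1 : H)).source) :
    ContMDiffAt 𝓘(ℝ, F) 𝓘(ℝ, F) (⊤ : ℕ∞) (chartAt F (1 : H)) b :=
  contMDiffOn_chart.contMDiffAt ((chartAt F (1 : H)).open_source.mem_nhds hb)

theorem contMDiffAt_chart_one_symm {v : F} (hv : v ∈ (chartAt F (1 : H)).target) :
    ContMDiffAt 𝓘(ℝ, F) 𝓘(ℝ, F) (⊤ : ℕ∞) (chartAt F (1 : H)).symm v :=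
  contMDiffOn_chart_symm.contMDiffAt ((chartAt F (1 : H)).open_target.mem_nhds hv)

theorem contMDiff_mul_left_top (b : H) :
    ContMDiff 𝓘(ℝ, F) 𝓘(ℝ, F) (⊤ : ℕ∞) (fun c : H => b * c) :=
  contMDiff_const.mul contMDiff_id

theorem contMDiffAt_chart_mul {b : H} (hb : b ∈ (chartAt F (1 : H)).source) :
    ContMDiffAt 𝓘(ℝ, F) 𝓘(ℝ, F) (⊤ : ℕ∞) (fun c : H => chartAt F (1 : H) (b * c)) 1 :=
  ContMDiffAt.comp_of_eq (x := (1 : H)) (y := b) (contMDiffAt_chart_one hb)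
    (contMDiff_mul_left_top b).contMDiffAt (mul_one b)

theorem chartTangent_eq_fderiv {b : H} (hb : b ∈ (chartAt F (1 : H)).source) :
    chartTangent (F := F) b =
      fderiv ℝ (fun v => chartAt F (1 : H) (b * (chartAt F (1 : H)).symm v))
        (chartAt F (1 : H) 1) := by
  have h := (contMDiffAt_chart_mul hb).mdifferentiableAt (by simp)
  refine h.mfderiv.trans ?_
  rw [modelWithCornersSelf_coe, Set.range_id, fderivWithin_univ]
  rfl

theorem continuousAt_chartTangent {b : H} (hb : b ∈ (chartAt F (1 : H)).source) :
    ContinuousAt (chartTangent (F := F) (H := H)) b := by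
  set ψ := chartAt F (1 : H) with hψ
  have h1 : (1 : H) ∈ ψ.source := mem_chart_source F 1
  have h2 : ContMDiffAt (𝓘(ℝ, F).prod 𝓘(ℝ, F)) 𝓘(ℝ, F) (⊤ : ℕ∞)
      (Function.uncurry fun (b : H) (v : F) => ψ (b * ψ.symm v)) (b, ψ 1) := by
    have h3 : ContMDiffAt (𝓘(ℝ, F).prod 𝓘(ℝ, F)) 𝓘(ℝ, F) (⊤ : ℕ∞)
        (fun p : H × F => p.1 * ψ.symm p.2) (b, ψ 1) :=
      contMDiffAt_fst.mul (ContMDiffAt.comp (b, ψ 1)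
        (contMDiffAt_chart_one_symm (ψ.map_source h1)) contMDiffAt_snd)
    exact ContMDiffAt.comp_of_eq (x := (b, ψ 1)) (y := b) (contMDiffAt_chart_one hb) h3
      (by simp [ψ.left_inv h1])
  refine (h2.continuousAt_fderiv (f := fun (b : H) (v : F) => ψ (b * ψ.symm v))).congr ?_
  filter_upwards [ψ.open_source.mem_nhds hb] with c hc
  rw [chartTangent_eq_fderiv hc]

/-- The map c ↦ ψ(bc) has the local left inverse v ↦ b⁻¹ψ⁻¹(v), so its derivative is invertible. -/
theorem det_chartTangent_ne_zero {b : H} (hb : b ∈ (chartAt F (1 : H)).source) :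
    LinearMap.det (chartTangent (F := F) b).toLinearMap ≠ 0 := by
  set ψ := chartAt F (1 : H) with hψ
  have h1 : MDifferentiableAt 𝓘(ℝ, F) 𝓘(ℝ, F) (fun c : H => ψ (b * c)) 1 :=
    (contMDiffAt_chart_mul hb).mdifferentiableAt (by simp)
  have h2 : MDifferentiableAt 𝓘(ℝ, F) 𝓘(ℝ, F) (fun v : F => b⁻¹ * ψ.symm v) (ψ b) :=
    ((contMDiff_mul_left_top b⁻¹).contMDiffAt.comp (ψ b)
      (contMDiffAt_chart_one_symm (ψ.map_source hb))).mdifferentiableAt (by simp)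
  have h3 := mfderiv_comp_of_eq (x := (1 : H)) (y := ψ b) h2 h1 (by simp)
  have h4 : (fun v : F => b⁻¹ * ψ.symm v) ∘ (fun c : H => ψ (b * c)) =ᶠ[𝓝 1] id := by
    have : ∀ᶠ c : H in 𝓝 1, b * c ∈ ψ.source := by
      refine (contMDiff_mul_left_top (F := F) b).continuous.continuousAt.eventually ?_
      simpa using ψ.open_source.mem_nhds hb
    filter_upwards [this] with c hc
    simp [ψ.left_inv hc]
  rw [h4.mfderiv_eq, mfderiv_id] at h3
  let Q : F →L[ℝ] F := mfderiv 𝓘(ℝ, F) 𝓘(ℝ, F) (fun v : F => b⁻¹ * ψ.symm v) (ψ (b * 1))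
  have h5 : (ContinuousLinearMap.id ℝ F) = Q.comp (chartTangent (F := F) b) := h3
  have h6 : LinearMap.det Q.toLinearMap *
      LinearMap.det (chartTangent (F := F) b).toLinearMap = 1 := by
    rw [← LinearMap.det_comp, ← ContinuousLinearMap.toLinearMap_comp, ← h5]
    exact LinearMap.det_id
  exact right_ne_zero_of_mul_eq_one h6

theorem chartDensity_pos {b : H} (hb : b ∈ (chartAt F (1 : H)).source) :
    0 < chartDensity (F := F) b :=
  inv_pos.2 (abs_pos.2 (det_chartTangent_ne_zero hb))

theorem continuousAt_chartDensity {b : H} (hb : b ∈ (chartAt F (1 : H)).source) :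
    ContinuousAt (chartDensity (F := F) (H := H)) b := by
  have h1 : ContinuousAt
      (fun b : H => LinearMap.det (chartTangent (F := F) b).toLinearMap) b :=
    (ContinuousLinearMap.continuous_det (𝕜 := ℝ) (E := F)).continuousAt.comp
      (continuousAt_chartTangent hb)
  exact h1.abs.inv₀ (abs_ne_zero.2 (det_chartTangent_ne_zero hb))

theorem continuousOn_chartDensity_symm :
    ContinuousOn (fun v => chartDensity (F := F) ((chartAt F (1 : H)).symm v))
      (chartAt F (1 : H)).target := fun _ hv =>
  (ContinuousAt.comp (g := chartDensity (F := F) (H := H)) (f := (chartAt F (1 : H)).symm)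
    (continuousAt_chartDensity ((chartAt F (1 : H)).map_target hv))
    ((chartAt F (1 : H)).continuousAt_symm hv)).continuousWithinAt

/-- The transformation rule of the left-invariant density. -/
theorem abs_det_fderiv_mul_chartDensity {θ : H → H}
    (hθ : ContMDiff 𝓘(ℝ, F) 𝓘(ℝ, F) (⊤ : ℕ∞) θ) {b : H}
    (hb : b ∈ (chartAt F (1 : H)).source) (hb' : θ b ∈ (chartAt F (1 : H)).source) :
    |(fderiv ℝ (fun v => chartAt F (1 : H) (θ ((chartAt F (1 : H)).symm v)))
        (chartAt F (1 : H) b)).det| * chartDensity (F := F) (θ b) =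
      |tangentDet 𝓘(ℝ, F) (fun c => (θ b)⁻¹ * θ (b * c)) 1| * chartDensity (F := F) b := by
  set ψ := chartAt F (1 : H) with hψ
  have h0 : MDifferentiableAt 𝓘(ℝ, F) 𝓘(ℝ, F) (fun v => ψ (θ (ψ.symm v))) (ψ b) := by
    refine ContMDiffAt.mdifferentiableAt (n := ((⊤ : ℕ∞) : WithTop ℕ∞)) ?_ (by simp)
    refine ContMDiffAt.comp_of_eq (y := θ b) (contMDiffAt_chart_one hb') ?_ (by
      simp [ψ.left_inv hb])
    exact ContMDiffAt.comp (ψ b) hθ.contMDiffAt (contMDiffAt_chart_one_symm (ψ.map_source hb))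
  have h1 : MDifferentiableAt 𝓘(ℝ, F) 𝓘(ℝ, F) (fun c : H => ψ (b * c)) 1 :=
    (contMDiffAt_chart_mul hb).mdifferentiableAt (by simp)
  have h2 : MDifferentiableAt 𝓘(ℝ, F) 𝓘(ℝ, F) (fun c : H => ψ (θ b * c)) 1 :=
    (contMDiffAt_chart_mul hb').mdifferentiableAt (by simp)
  have h3 : MDifferentiable 𝓘(ℝ, F) 𝓘(ℝ, F) (fun c => (θ b)⁻¹ * θ (b * c)) :=
    ((contMDiff_mul_left_top (θ b)⁻¹).comp
      (hθ.comp (contMDiff_mul_left_top b))).mdifferentiable (by simp)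
  have e1 := mfderiv_comp_of_eq (x := (1 : H)) (y := ψ b) h0 h1 (by simp)
  have e2 := mfderiv_comp_of_eq (x := (1 : H)) (y := (1 : H)) h2 (h3 1) (by simp)
  -- Two factorisations of c ↦ ψ(θ(bc)) near 1: through θ read in the chart, and through θ
  -- translated so as to fix 1. The chain rule on both sides gives the transformation rule.
  have e3 : (fun v => ψ (θ (ψ.symm v))) ∘ (fun c : H => ψ (b * c)) =ᶠ[𝓝 1]
      (fun c : H => ψ (θ b * c)) ∘ (fun c => (θ b)⁻¹ * θ (b * c)) := by
    have : ∀ᶠ c : H in 𝓝 1, b * c ∈ ψ.source := by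
      refine (contMDiff_mul_left_top (F := F) b).continuous.continuousAt.eventually ?_
      simpa using ψ.open_source.mem_nhds hb
    filter_upwards [this] with c hc
    simp [ψ.left_inv hc]
  have e4 := e1.symm.trans (e3.mfderiv_eq.trans e2)
  have e5 : ∀ y : H, y = 1 → (mfderiv 𝓘(ℝ, F) 𝓘(ℝ, F) (fun c : H => ψ (θ b * c)) y :
      F →L[ℝ] F) = chartTangent (F := F) (θ b) := by
    rintro _ rfl; rfl
  have e6 : ∀ y : F, y = ψ b → (mfderiv 𝓘(ℝ, F) 𝓘(ℝ, F) (fun v => ψ (θ (ψ.symm v))) y :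
      F →L[ℝ] F) = fderiv ℝ (fun v => ψ (θ (ψ.symm v))) (ψ b) := by
    rintro _ rfl; rw [mfderiv_eq_fderiv]
  let Q : F →L[ℝ] F := mfderiv 𝓘(ℝ, F) 𝓘(ℝ, F) (fun c => (θ b)⁻¹ * θ (b * c)) 1
  have e7 : (fderiv ℝ (fun v => ψ (θ (ψ.symm v))) (ψ b)).comp (chartTangent (F := F) b) =
      (chartTangent (F := F) (θ b)).comp Q := by
    rw [← e5 ((θ b)⁻¹ * θ (b * 1)) (by simp), ← e6 (ψ (b * 1)) (by simp)]
    exact e4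
  have e8 : LinearMap.det (fderiv ℝ (fun v => ψ (θ (ψ.symm v))) (ψ b)).toLinearMap *
      LinearMap.det (chartTangent (F := F) b).toLinearMap =
      LinearMap.det (chartTangent (F := F) (θ b)).toLinearMap * LinearMap.det Q.toLinearMap := by
    rw [← LinearMap.det_comp, ← LinearMap.det_comp, ← ContinuousLinearMap.toLinearMap_comp,
      ← ContinuousLinearMap.toLinearMap_comp, e7]
  have e9 := congrArg abs e8
  rw [abs_mul, abs_mul] at e9
  have n1 := abs_ne_zero.2 (det_chartTangent_ne_zero (F := F) hb)
  have n2 := abs_ne_zero.2 (det_chartTangent_ne_zero (F := F) hb')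
  change |LinearMap.det (fderiv ℝ (fun v => ψ (θ (ψ.symm v))) (ψ b)).toLinearMap| *
    |LinearMap.det (chartTangent (F := F) (θ b)).toLinearMap|⁻¹ =
    |LinearMap.det Q.toLinearMap| * |LinearMap.det (chartTangent (F := F) b).toLinearMap|⁻¹
  rw [← div_eq_mul_inv, ← div_eq_mul_inv, div_eq_div_iff n2 n1, e9, mul_comm]

end ChartDensity

/-! ### Local uniqueness of Haar measure -/

section LocalHaar

variable {H : Type*} [TopologicalSpace H] [Group H] [IsTopologicalGroup H] [LocallyCompactSpace H]
  [T2Space H] [SecondCountableTopology H] [MeasurableSpace H] [BorelSpace H]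

/-- The modular function is a ratio of measures of slices of a measurable subset of H × H, hence
measurable as in Tonelli's theorem. -/
theorem measurable_modularCharacterFun (μ : Measure H) [μ.IsHaarMeasure] :
    Measurable (Measure.modularCharacterFun : H → NNReal) := by
  obtain ⟨K⟩ : Nonempty (TopologicalSpace.PositiveCompacts H) := inferInstance
  have hK : MeasurableSet (K : Set H) := K.isCompact.measurableSet
  have hK0 : μ K ≠ 0 := (Measure.measure_pos_of_nonempty_interior μ K.interior_nonempty).ne'
  have hK1 : μ K ≠ ⊤ := K.isCompact.measure_lt_top.ne
  have h1 : (Measure.modularCharacterFun : H → NNReal) =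
      fun v => (μ ((fun h => (h, v)) ⁻¹' {p : H × H | p.1 * p.2 ∈ (K : Set H)}) / μ K).toNNReal := by
    funext v
    have h2 := congrArg (fun m : Measure H => m K)
      (Measure.map_right_mul_eq_modularCharacterFun_smul μ v)
    simp only [Measure.smul_apply] at h2
    rw [Measure.map_apply (measurable_mul_const v) hK, ENNReal.smul_def, smul_eq_mul] at h2
    have h3 : (fun h => (h, v)) ⁻¹' {p : H × H | p.1 * p.2 ∈ (K : Set H)} =
      (fun x => x * v) ⁻¹' (K : Set H) := rfl
    rw [h3, h2, ENNReal.mul_div_cancel_right hK0 hK1, ENNReal.toNNReal_coe]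
  rw [h1]
  exact ((measurable_measure_prodMk_right (measurable_mul hK)).div_const _).ennreal_toNNReal

/-- Local uniqueness of the Haar measure: a measure which is invariant under the left translations
within an open set `U` agrees on `U` with the Haar measure up to a constant. -/
theorem measure_inv_mul_eq_of_locally_left_invariant (μ : Measure H) [μ.IsHaarMeasure]
    (ν : Measure H) [SFinite ν] {U : Set H}
    (hν : ∀ (h : H) (S : Set H), MeasurableSet S → S ⊆ U → (fun x => h * x) ⁻¹' S ⊆ U →
      ν ((fun x => h * x) ⁻¹' S) = ν S)
    {V S : Set H} (hV : MeasurableSet V) (hVU : V ⊆ U) (hS : MeasurableSet S) (hSU : S ⊆ U) :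
    μ V⁻¹ * ν S = (∫⁻ v in V, (Measure.modularCharacterFun v : ENNReal) ∂ν) * μ S := by
  have hM : MeasurableSet {p : H × H | p.2 ∈ V ∧ p.1 * p.2 ∈ S} :=
    (measurable_snd hV).inter (measurable_mul hS)
  have hM' : MeasurableSet {p : H × H | p.2 ∈ S ∧ p.1⁻¹ * p.2 ∈ V} :=
    (measurable_snd hS).inter ((measurable_fst.inv.mul measurable_snd) hV)
  -- The same double integral is computed twice. Here h is integrated first for fixed v ∈ V: right
  -- translation by v scales μ by the modular function.
  have e1 : ∫⁻ h, ν {v | v ∈ V ∧ h * v ∈ S} ∂μ =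
      ∫⁻ v in V, (Measure.modularCharacterFun v : ENNReal) * μ S ∂ν := by
    rw [← lintegral_indicator hV]
    have h1 : ∫⁻ h, ν {v | v ∈ V ∧ h * v ∈ S} ∂μ = (μ.prod ν) {p | p.2 ∈ V ∧ p.1 * p.2 ∈ S} :=
      (Measure.prod_apply hM).symm
    rw [h1, Measure.prod_apply_symm hM]
    refine lintegral_congr fun v => ?_
    by_cases hv : v ∈ V
    · have h2 := congrArg (fun m : Measure H => m S)
        (Measure.map_right_mul_eq_modularCharacterFun_smul μ v)
      simp only [Measure.smul_apply] at h2
      rw [Measure.map_apply (measurable_mul_const v) hS] at h2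
      rw [Set.indicator_of_mem hv]
      refine Eq.trans (congrArg μ ?_) h2
      ext h; simp [hv]
    · rw [Set.indicator_of_notMem hv]
      simp [hv]
  -- Here s = hv is substituted first, using only the local invariance of ν because both sets lie in
  -- U. For fixed s, the set of h with h⁻¹s ∈ V is sV⁻¹, of measure μ(V⁻¹).
  have e2 : ∫⁻ h, ν {v | v ∈ V ∧ h * v ∈ S} ∂μ = ∫⁻ s in S, μ V⁻¹ ∂ν := by
    have h1 : ∀ h : H, ν {v | v ∈ V ∧ h * v ∈ S} = ν {s | s ∈ S ∧ h⁻¹ * s ∈ V} := by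
      intro h
      have h2 : MeasurableSet {s : H | s ∈ S ∧ h⁻¹ * s ∈ V} :=
        hS.inter ((measurable_const_mul h⁻¹) hV)
      have h3 : (fun x => h * x) ⁻¹' {s : H | s ∈ S ∧ h⁻¹ * s ∈ V} = {v | v ∈ V ∧ h * v ∈ S} := by
        ext v; simp [and_comm]
      rw [← h3]
      refine hν h _ h2 (fun s hs => hSU hs.1) ?_
      rw [h3]
      exact fun v hv => hVU hv.1
    simp only [h1]
    have h1 : ∫⁻ h, ν {s | s ∈ S ∧ h⁻¹ * s ∈ V} ∂μ = (μ.prod ν) {p | p.2 ∈ S ∧ p.1⁻¹ * p.2 ∈ V} :=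
      (Measure.prod_apply hM').symm
    rw [h1, Measure.prod_apply_symm hM', ← lintegral_indicator hS]
    refine lintegral_congr fun s => ?_
    by_cases hs : s ∈ S
    · rw [Set.indicator_of_mem hs, ← measure_preimage_mul μ s⁻¹ V⁻¹]
      refine congrArg μ ?_
      ext h; simp [hs]
    · rw [Set.indicator_of_notMem hs]
      simp [hs]
  rw [e2, setLIntegral_const] at e1
  rw [e1, lintegral_mul_const _ (measurable_modularCharacterFun μ).coe_nnreal_ennreal]

end LocalHaar

/-! ### An explicit locally left-invariant measure -/

section ChartMeasure

theorem measurableSet_chart_image {F : Type*} [NormedAddCommGroup F] [MeasurableSpace F]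
    [BorelSpace F] {H : Type*} [TopologicalSpace H] [ChartedSpace F H] [Group H]
    [MeasurableSpace H] [BorelSpace H] {S : Set H} (hS : MeasurableSet S)
    (hSU : S ⊆ (chartAt F (1 : H)).source) : MeasurableSet (chartAt F (1 : H) '' S) := by
  rw [(chartAt F (1 : H)).image_eq_target_inter_inv_preimage hSU]
  have h := ((chartAt F (1 : H)).continuousOn_symm.domRestrict.measurable hS)
  have h2 := (chartAt F (1 : H)).open_target.measurableSet.subtype_image h
  convert h2 using 1
  ext v
  simp [and_comm]

variable {F : Type*} [NormedAddCommGroup F] [NormedSpace ℝ F] [MeasurableSpace F] [BorelSpace F]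
  {H : Type*} [TopologicalSpace H] [ChartedSpace F H] [Group H]
  [MeasurableSpace H] [BorelSpace H]

/-- The image on the domain of the chart at `1` of a Lebesgue measure, corrected by the density
`chartDensity` so as to become left-invariant. -/
def chartMeasure (m : Measure F) : Measure H :=
  Measure.map (chartAt F (1 : H)).symm ((m.restrict (chartAt F (1 : H)).target).withDensity
    fun v => ENNReal.ofReal (chartDensity (F := F) ((chartAt F (1 : H)).symm v)))

instance (m : Measure F) [SFinite m] : SFinite (chartMeasure (H := H) m) := by
  unfold chartMeasure; infer_instance

variable [LieGroup 𝓘(ℝ, F) (⊤ : ℕ∞) H]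

theorem setLIntegral_chartMeasure (m : Measure F) {S : Set H} (hS : MeasurableSet S)
    (hSU : S ⊆ (chartAt F (1 : H)).source) {k : H → ENNReal} (hk : Measurable k) :
    ∫⁻ b in S, k b ∂chartMeasure m =
      ∫⁻ v in chartAt F (1 : H) '' S, k ((chartAt F (1 : H)).symm v) *
        ENNReal.ofReal (chartDensity (F := F) ((chartAt F (1 : H)).symm v)) ∂m := by
  set ψ := chartAt F (1 : H) with hψ
  have hT : MeasurableSet ψ.target := ψ.open_target.measurableSet
  have h1 : AEMeasurable ψ.symm (m.restrict ψ.target) := ψ.continuousOn_symm.aemeasurable hT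
  have h2 : AEMeasurable (fun v => ENNReal.ofReal (chartDensity (F := F) (ψ.symm v)))
      (m.restrict ψ.target) := by
    exact (continuousOn_chartDensity_symm.aemeasurable hT).ennreal_ofReal
  have hkS : Measurable (S.indicator k) := hk.indicator hS
  rw [← lintegral_indicator hS, chartMeasure, lintegral_map' hkS.aemeasurable
    (h1.mono_ac (withDensity_absolutelyContinuous _ _)),
    lintegral_withDensity_eq_lintegral_mul₀ h2 (hkS.comp_aemeasurable' h1),
    ← lintegral_indicator hT, ← lintegral_indicator (measurableSet_chart_image hS hSU)]
  refine lintegral_congr fun v => ?_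
  rw [ψ.image_eq_target_inter_inv_preimage hSU]
  by_cases hv : v ∈ ψ.target <;> by_cases hv' : ψ.symm v ∈ S <;>
    simp [Set.indicator, hv, hv', mul_comm]

theorem chartMeasure_apply (m : Measure F) {S : Set H} (hS : MeasurableSet S)
    (hSU : S ⊆ (chartAt F (1 : H)).source) :
    chartMeasure m S = ∫⁻ v in chartAt F (1 : H) '' S,
        ENNReal.ofReal (chartDensity (F := F) ((chartAt F (1 : H)).symm v)) ∂m := by
  have h := setLIntegral_chartMeasure m hS hSU (k := fun _ => 1) measurable_const
  simpa using h

/-- The change of variables formula for `chartMeasure`. -/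
theorem chartMeasure_image [FiniteDimensional ℝ F] (m : Measure F) [m.IsAddHaarMeasure] {θ : H → H}
    (hθ : ContMDiff 𝓘(ℝ, F) 𝓘(ℝ, F) (⊤ : ℕ∞) θ) {S : Set H} (hS : MeasurableSet S)
    (hSU : S ⊆ (chartAt F (1 : H)).source) (hS' : MeasurableSet (θ '' S))
    (hSU' : θ '' S ⊆ (chartAt F (1 : H)).source) (hinj : Set.InjOn θ S) {k : H → ENNReal}
    (hk : Measurable k) (hθk : ∀ b ∈ S,
      k b = ENNReal.ofReal |tangentDet 𝓘(ℝ, F) (fun c => (θ b)⁻¹ * θ (b * c)) 1|) :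
    chartMeasure m (θ '' S) = ∫⁻ b in S, k b ∂chartMeasure m := by
  rw [chartMeasure_apply m hS' hSU', setLIntegral_chartMeasure m hS hSU hk]
  set ψ := chartAt F (1 : H) with hψ
  have h1 : ψ '' (θ '' S) = (fun v => ψ (θ (ψ.symm v))) '' (ψ '' S) := by
    rw [Set.image_image, Set.image_image]
    exact Set.image_congr fun b hb => by rw [ψ.left_inv (hSU hb)]
  have hd : ∀ v ∈ ψ '' S, HasFDerivWithinAt (fun v => ψ (θ (ψ.symm v)))
      (fderiv ℝ (fun v => ψ (θ (ψ.symm v))) v) (ψ '' S) v := by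
    rintro _ ⟨b, hb, rfl⟩
    refine (DifferentiableAt.hasFDerivAt ?_).hasFDerivWithinAt
    refine mdifferentiableAt_iff_differentiableAt.1 ?_
    refine ContMDiffAt.mdifferentiableAt (n := ((⊤ : ℕ∞) : WithTop ℕ∞)) ?_ (by simp)
    refine ContMDiffAt.comp_of_eq (y := θ b)
      (contMDiffAt_chart_one (hSU' (Set.mem_image_of_mem θ hb))) ?_ (by
      simp [ψ.left_inv (hSU hb)])
    exact ContMDiffAt.comp (ψ b) hθ.contMDiffAt
      (contMDiffAt_chart_one_symm (ψ.map_source (hSU hb)))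
  have hi : Set.InjOn (fun v => ψ (θ (ψ.symm v))) (ψ '' S) := by
    rintro _ ⟨b, hb, rfl⟩ _ ⟨c, hc, rfl⟩ h
    simp only [ψ.left_inv (hSU hb), ψ.left_inv (hSU hc)] at h
    rw [hinj hb hc (ψ.injOn (hSU' (Set.mem_image_of_mem θ hb))
      (hSU' (Set.mem_image_of_mem θ hc)) h)]
  rw [h1, lintegral_image_eq_lintegral_abs_det_fderiv_mul m (measurableSet_chart_image hS hSU)
    hd hi]
  refine setLIntegral_congr_fun (measurableSet_chart_image hS hSU) ?_
  rintro _ ⟨b, hb, rfl⟩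
  have h3 := abs_det_fderiv_mul_chartDensity hθ (hSU hb) (hSU' (Set.mem_image_of_mem θ hb))
  rw [← hψ] at h3
  simp only [← hψ, ψ.left_inv (hSU hb), hθk b hb,
    ψ.left_inv (hSU' (Set.mem_image_of_mem θ hb))]
  rw [← ENNReal.ofReal_mul (abs_nonneg _), ← ENNReal.ofReal_mul (abs_nonneg _), h3]

/-- In the left trivialisation a left translation has the identity as derivative, so the change of
variables factor is 1. -/
theorem chartMeasure_preimage_mul [FiniteDimensional ℝ F] (m : Measure F) [m.IsAddHaarMeasure] (h : H) {S : Set H}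
    (hS : MeasurableSet S) (hSU : S ⊆ (chartAt F (1 : H)).source)
    (hSU' : (fun x => h * x) ⁻¹' S ⊆ (chartAt F (1 : H)).source) :
    chartMeasure m ((fun x => h * x) ⁻¹' S) = chartMeasure m S := by
  have hc := contMDiff_mul_left_top (F := F) h
  have h1 : (fun x => h * x) '' ((fun x => h * x) ⁻¹' S) = S :=
    Set.image_preimage_eq _ (Group.mulLeft_bijective h).surjective
  have h2 := chartMeasure_image m hc (hc.continuous.measurable hS) hSU' (by rwa [h1])
    (by rwa [h1]) (mul_right_injective h).injOn (k := fun _ => 1) measurable_const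
    (fun b _ => by
      have : (fun c : H => (h * b)⁻¹ * (h * (b * c))) = fun c => c := by
        funext c; simp [mul_assoc]
      simp only [this, tangentDet_id]
      simp)
  rw [h1] at h2
  simpa using h2.symm

end ChartMeasure

/-! ### Change of variables for Haar measure -/

section HaarChange

variable {F : Type*} [NormedAddCommGroup F] [NormedSpace ℝ F]
  {H : Type*} [TopologicalSpace H] [ChartedSpace F H] [Group H]
  [MeasurableSpace H] [BorelSpace H] [LieGroup 𝓘(ℝ, F) (⊤ : ℕ∞) H]

theorem chartMeasure_pos_of_isOpen [MeasurableSpace F] [BorelSpace F] (m : Measure F)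
    [m.IsAddHaarMeasure] {V : Set H} (hV : IsOpen V) (hne : V.Nonempty)
    (hVU : V ⊆ (chartAt F (1 : H)).source) : chartMeasure m V ≠ 0 := by
  rw [chartMeasure_apply m hV.measurableSet hVU]
  set ψ := chartAt F (1 : H) with hψ
  have ho : IsOpen (ψ '' V) := ψ.isOpen_image_of_subset_source hV hVU
  intro h0
  have h1 : ContinuousOn (fun v => chartDensity (F := F) (ψ.symm v)) (ψ '' V) :=
    continuousOn_chartDensity_symm.mono (Set.image_subset_iff.2 fun b hb => ψ.map_source (hVU hb))
  rw [lintegral_eq_zero_iff' (h1.aemeasurable ho.measurableSet).ennreal_ofReal] at h0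
  have h2 : m (ψ '' V) = 0 := by
    have h3 := (ae_restrict_iff' ho.measurableSet).1 h0
    refine measure_mono_null ?_ (mem_ae_iff.1 h3)
    rintro _ ⟨b, hb, rfl⟩ h4
    have h5 := h4 (Set.mem_image_of_mem ψ hb)
    simp only [Pi.zero_apply, ENNReal.ofReal_eq_zero, ψ.left_inv (hVU hb)] at h5
    exact absurd (chartDensity_pos (hVU hb)) h5.not_gt
  exact (ho.measure_pos m (hne.image ψ)).ne' h2

theorem chartMeasure_lt_top_of_isCompact [T2Space H] [MeasurableSpace F] [BorelSpace F]
    (m : Measure F) [m.IsAddHaarMeasure] {K : Set H} (hK : IsCompact K)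
    (hKU : K ⊆ (chartAt F (1 : H)).source) : chartMeasure m K < ⊤ := by
  rw [chartMeasure_apply m hK.measurableSet hKU]
  set ψ := chartAt F (1 : H) with hψ
  have hc : IsCompact (ψ '' K) := hK.image_of_continuousOn (ψ.continuousOn.mono hKU)
  have h1 : ContinuousOn (fun v => chartDensity (F := F) (ψ.symm v)) (ψ '' K) :=
    continuousOn_chartDensity_symm.mono (Set.image_subset_iff.2 fun b hb => ψ.map_source (hKU hb))
  have h2 := hc.bddAbove_image (f := fun v => (chartDensity (F := F) (ψ.symm v)).toNNReal)
    (continuous_real_toNNReal.comp_continuousOn h1)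
  exact setLIntegral_lt_top_of_bddAbove hc.measure_lt_top.ne h2

variable [FiniteDimensional ℝ F] [T2Space H] [SecondCountableTopology H]

/-- Apply local uniqueness with V the interior of a compact neighbourhood of 1 inside the chart
domain. All measures of V and V⁻¹ are then positive and finite. -/
theorem exists_chartMeasure_eq_smul [IsTopologicalGroup H] [LocallyCompactSpace H]
    [MeasurableSpace F] [BorelSpace F] (m : Measure F) [m.IsAddHaarMeasure]
    (μ : Measure H) [μ.IsHaarMeasure] :
    ∃ c : ENNReal, c ≠ 0 ∧ c ≠ ⊤ ∧ (chartMeasure m).restrict (chartAt F (1 : H)).source =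
      c • μ.restrict (chartAt F (1 : H)).source := by
  set U := (chartAt F (1 : H)).source with hU
  have hUo : IsOpen U := (chartAt F (1 : H)).open_source
  obtain ⟨K, hK, h1K, hKU⟩ := exists_compact_subset hUo (mem_chart_source F (1 : H))
  set V := interior K with hV
  have hVo : IsOpen V := isOpen_interior
  have hVU : V ⊆ U := interior_subset.trans hKU
  have key : ∀ S, MeasurableSet S → S ⊆ U → μ V⁻¹ * chartMeasure m S =
      (∫⁻ v in V, (Measure.modularCharacterFun v : ENNReal) ∂chartMeasure m) * μ S := by
    intro S hS hSU
    exact measure_inv_mul_eq_of_locally_left_invariant μ (chartMeasure m)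
      (fun h S hS hSU hSU' => chartMeasure_preimage_mul m h hS hSU hSU')
      hVo.measurableSet hVU hS hSU
  set d := ∫⁻ v in V, (Measure.modularCharacterFun v : ENNReal) ∂chartMeasure m
  have hV1 : μ V⁻¹ ≠ 0 := (hVo.inv.measure_pos μ ⟨1, by simpa using h1K⟩).ne'
  have hV2 : μ V⁻¹ ≠ ⊤ := ((measure_mono (Set.inv_subset_inv.2 interior_subset)).trans_lt
    hK.inv.measure_lt_top).ne
  have hV3 : μ V ≠ 0 := (hVo.measure_pos μ ⟨1, h1K⟩).ne'
  have hV4 : μ V ≠ ⊤ := ((measure_mono interior_subset).trans_lt hK.measure_lt_top).ne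
  have hV5 : chartMeasure m V ≠ 0 := chartMeasure_pos_of_isOpen m hVo ⟨1, h1K⟩ hVU
  have hV6 : chartMeasure m V ≠ ⊤ := ((measure_mono interior_subset).trans_lt
    (chartMeasure_lt_top_of_isCompact m hK hKU)).ne
  -- Testing on S = V shows that the constant d is neither 0 nor infinite.
  have hVk := key V hVo.measurableSet hVU
  have hd0 : d ≠ 0 := by
    intro h; rw [h, zero_mul] at hVk
    exact mul_ne_zero hV1 hV5 hVk
  have hd1 : d ≠ ⊤ := by
    intro h; rw [h, ENNReal.top_mul hV3] at hVk
    exact ENNReal.mul_ne_top hV2 hV6 hVk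
  refine ⟨(μ V⁻¹)⁻¹ * d, mul_ne_zero (ENNReal.inv_ne_zero.2 hV2) hd0,
    ENNReal.mul_ne_top (ENNReal.inv_ne_top.2 hV1) hd1, ?_⟩
  ext S hS
  rw [Measure.smul_apply, Measure.restrict_apply hS, Measure.restrict_apply hS, smul_eq_mul,
    mul_assoc, ← key _ (hS.inter hUo.measurableSet) Set.inter_subset_right, ← mul_assoc,
    ENNReal.inv_mul_cancel hV1 hV2, one_mul]

/-- The change of variables formula for the Haar measure, for sets in the chart domain. -/
theorem haar_image_of_subset_chart_source [IsTopologicalGroup H] [LocallyCompactSpace H]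
    (μ : Measure H) [μ.IsHaarMeasure] {θ : H → H}
    (hθ : ContMDiff 𝓘(ℝ, F) 𝓘(ℝ, F) (⊤ : ℕ∞) θ) {S : Set H} (hS : MeasurableSet S)
    (hSU : S ⊆ (chartAt F (1 : H)).source) (hS' : MeasurableSet (θ '' S))
    (hSU' : θ '' S ⊆ (chartAt F (1 : H)).source) (hinj : Set.InjOn θ S) {k : H → ENNReal}
    (hk : Measurable k) (hθk : ∀ b ∈ S,
      k b = ENNReal.ofReal |tangentDet 𝓘(ℝ, F) (fun c => (θ b)⁻¹ * θ (b * c)) 1|) :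
    μ (θ '' S) = ∫⁻ b in S, k b ∂μ := by
  let : MeasurableSpace F := borel F
  have : BorelSpace F := ⟨rfl⟩
  obtain ⟨c, hc0, hc1, hc⟩ := exists_chartMeasure_eq_smul (Measure.addHaar : Measure F) μ
  have h1 := chartMeasure_image (Measure.addHaar : Measure F) hθ hS hSU hS' hSU' hinj hk hθk
  have hr : ∀ S : Set H, S ⊆ (chartAt F (1 : H)).source →
      (chartMeasure (Measure.addHaar : Measure F)).restrict S = c • μ.restrict S := by
    intro S hS
    rw [← Measure.restrict_restrict_of_subset hS, hc, Measure.restrict_smul,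
      Measure.restrict_restrict_of_subset hS]
  rw [← Measure.restrict_apply_self, hr _ hSU', hr _ hSU, lintegral_smul_measure,
    Measure.smul_apply, Measure.restrict_apply_self, smul_eq_mul, smul_eq_mul] at h1
  exact (ENNReal.mul_right_inj hc0 hc1).1 h1

/-- The change of variables formula for the Haar measure. -/
theorem map_symm_haar_eq_withDensity [IsTopologicalGroup H] [LocallyCompactSpace H]
    (μ : Measure H) [μ.IsHaarMeasure] (θ : H ≃ₜ H)
    (hθ : ContMDiff 𝓘(ℝ, F) 𝓘(ℝ, F) (⊤ : ℕ∞) θ) {k : H → ENNReal}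
    (hk : Measurable k) (hθk : ∀ b,
      k b = ENNReal.ofReal |tangentDet 𝓘(ℝ, F) (fun c => (θ b)⁻¹ * θ (b * c)) 1|) :
    Measure.map θ.symm μ = μ.withDensity k := by
  set U := (chartAt F (1 : H)).source with hU
  have hUo : IsOpen U := (chartAt F (1 : H)).open_source
  have h1U : (1 : H) ∈ U := mem_chart_source F 1
  -- Near b₀, both b₀⁻¹b and θ(b₀)⁻¹θ(b) lie in the chart domain at 1; countably many such
  -- neighbourhoods cover H.
  let O : H → Set H := fun b₀ => {b | b₀⁻¹ * b ∈ U ∧ (θ b₀)⁻¹ * θ b ∈ U}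
  have hO : ∀ b, IsOpen (O b) := fun b =>
    (hUo.preimage (continuous_const.mul continuous_id)).inter
      (hUo.preimage (continuous_const.mul θ.continuous))
  obtain ⟨s, hs, hcov⟩ := TopologicalSpace.countable_cover_nhds
    (f := O) (fun b => (hO b).mem_nhds (by simp [O, h1U]))
  have := hs.to_subtype
  refine Measure.ext_of_iUnion_eq_univ (s := fun b : s => O b) (by rw [← hcov, Set.biUnion_eq_iUnion])
    fun b₀ => ?_
  ext S hS
  rw [Measure.restrict_apply hS, Measure.restrict_apply hS]
  have hS1 : MeasurableSet (S ∩ O b₀) := hS.inter (hO _).measurableSet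
  have hS2 : S ∩ O b₀ ⊆ O b₀ := Set.inter_subset_right
  generalize S ∩ O b₀ = S at hS1 hS2
  clear hS
  generalize (b₀ : H) = b₀ at *
  rw [Measure.map_apply θ.symm.measurable hS1, withDensity_apply _ hS1]
  have e0 : θ.symm ⁻¹' S = θ '' S := θ.image_eq_preimage_symm S |>.symm
  rw [e0]
  -- Translating source and target moves b₀ and θ(b₀) to 1, where the chart version applies; left
  -- invariance of μ removes both translations at the end.
  let θ' : H → H := fun c => (θ b₀)⁻¹ * θ (b₀ * c)
  have e1 : ((fun x => θ b₀ * x) ⁻¹' (θ '' S)) = θ' '' ((fun x => b₀ * x) ⁻¹' S) := by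
    ext x
    constructor
    · rintro ⟨b, hb, hbx⟩
      exact ⟨b₀⁻¹ * b, by simpa using hb, by simp [θ', hbx]⟩
    · rintro ⟨c, hc, rfl⟩
      exact ⟨b₀ * c, hc, by simp [θ']⟩
  have e2 := haar_image_of_subset_chart_source μ (θ := θ') (k := fun c => k (b₀ * c))
    ((contMDiff_mul_left_top (F := F) (θ b₀)⁻¹).comp
      (hθ.comp (contMDiff_mul_left_top (F := F) b₀)))
    (S := (fun x => b₀ * x) ⁻¹' S) (measurable_const_mul b₀ hS1)
    (fun c hc => by simpa using (hS2 hc).1)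
    (by
      rw [← e1, e0.symm]
      exact measurable_const_mul _ (θ.symm.measurable hS1))
    (by
      rintro _ ⟨c, hc, rfl⟩
      exact (hS2 hc).2)
    (fun c _ d _ h => by simpa [θ'] using h)
    (hk.comp (measurable_const_mul b₀))
    (fun c _ => by
      have : (fun d => (θ' c)⁻¹ * θ' (c * d)) =
          fun d => (θ (b₀ * c))⁻¹ * θ (b₀ * c * d) := by
        funext d; simp [θ', mul_assoc]
      rw [this, hθk])
  rw [← e1, measure_preimage_mul] at e2
  rw [e2, ← lintegral_indicator (measurable_const_mul b₀ hS1), ← lintegral_indicator hS1,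
    ← lintegral_mul_left_eq_self (S.indicator k) b₀]
  rfl

end HaarChange

/-! ### The dressing action and the invariant measure on B -/

namespace IsDoubleLieGroup

variable {E EA EB : Type*}
  [NormedAddCommGroup E] [NormedSpace ℝ E] [FiniteDimensional ℝ E]
  [NormedAddCommGroup EA] [NormedSpace ℝ EA] [FiniteDimensional ℝ EA]
  [NormedAddCommGroup EB] [NormedSpace ℝ EB] [FiniteDimensional ℝ EB]
  {G : Type*} [TopologicalSpace G] [SecondCountableTopology G] [ChartedSpace E G] [Group G]
  {A B : Subgroup G} [ChartedSpace EA A] [ChartedSpace EB B]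
  (D : IsDoubleLieGroup E EA EB A B)

theorem contMDiff_bL_coe_mul (a : A) :
    ContMDiff 𝓘(ℝ, EB) 𝓘(ℝ, EB) (⊤ : ℕ∞) (fun b : B => D.bL (a * b)) := by
  have := D.lieGroup
  exact D.contMDiff_bL.comp (contMDiff_const.mul D.contMDiff_right)

/-- In the chart at 1 this is the determinant of a partial derivative of a map jointly smooth in a
and the chart variable. Continuity is what makes the density of the change of variables measurable.
-/
theorem continuous_detA : Continuous D.detA := by
  have := D.lieGroup
  have := D.lieGroup_left
  have := D.lieGroup_right
  set ψ := chartAt EB (1 : B) with hψ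
  have h1 : (1 : B) ∈ ψ.source := mem_chart_source EB 1
  have hv : ψ 1 ∈ ψ.target := ψ.map_source h1
  have h2 : ∀ a : A, D.detA a =
      |(fderiv ℝ (fun v : EB => ψ (D.bL (a * ψ.symm v))) (ψ 1)).det| := by
    intro a
    have h0 : D.bL ((a : G) * (1 : B)) = 1 := by
      rw [Subgroup.coe_one, mul_one, bL_coe_left]
    have h3 : MDifferentiableAt 𝓘(ℝ, EB) 𝓘(ℝ, EB) (fun b : B => D.bL (a * b)) 1 :=
      (D.contMDiff_bL_coe_mul a).contMDiffAt.mdifferentiableAt (by simp)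
    rw [← abs_tangentDet_bL_coe_mul, tangentDet, h3.mfderiv, modelWithCornersSelf_coe,
      Set.range_id, fderivWithin_univ]
    simp only [writtenInExtChartAt, h0]
    rfl
  refine continuous_iff_continuousAt.2 fun a => ?_
  have h3 : ContMDiffAt (𝓘(ℝ, EA).prod 𝓘(ℝ, EB)) 𝓘(ℝ, EB) (⊤ : ℕ∞)
      (Function.uncurry fun (a : A) (v : EB) => ψ (D.bL (a * ψ.symm v))) (a, ψ 1) := by
    have h4 : ContMDiffAt (𝓘(ℝ, EA).prod 𝓘(ℝ, EB)) 𝓘(ℝ, E) (⊤ : ℕ∞)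
        (fun p : A × EB => (p.1 * ψ.symm p.2 : G)) (a, ψ 1) :=
      (D.contMDiff_left.contMDiffAt.comp (a, ψ 1) contMDiffAt_fst).mul
        (D.contMDiff_right.contMDiffAt.comp (a, ψ 1)
          (ContMDiffAt.comp (a, ψ 1) (contMDiffAt_chart_one_symm hv) contMDiffAt_snd))
    refine ContMDiffAt.comp_of_eq (x := (a, ψ 1)) (y := (1 : B)) (contMDiffAt_chart_one h1)
      (D.contMDiff_bL.contMDiffAt.comp (a, ψ 1) h4) ?_
    simp [ψ.left_inv h1, bL_coe_left]
  have h5 := (ContinuousLinearMap.continuous_det (𝕜 := ℝ) (E := EB)).continuousAt.comp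
    h3.continuousAt_fderiv
  exact h5.abs.congr (Eventually.of_forall fun a => (h2 a).symm)

/-- The dressing action of `a ∈ A` on `B`. -/
def dressing (a : A) : B ≃ₜ B where
  toFun b := D.bL (a * b)
  invFun b := D.bL ((a⁻¹ : A) * b : G)
  left_inv b := D.bL_inv_mul_bL a b
  right_inv b := by simpa using D.bL_inv_mul_bL a⁻¹ b
  continuous_toFun := (D.contMDiff_bL_coe_mul a).continuous
  continuous_invFun := (D.contMDiff_bL_coe_mul a⁻¹).continuous

/-- The change of variables `b ↦ b_L(a b)` for the invariant measure on `B`. -/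
theorem integral_bL_coe_mul [T2Space G] [MeasurableSpace G] [BorelSpace G] (a : A) (f : B → ℂ) :
    ∫ b, f (D.bL (a * b)) * (D.detA (D.aR (a * b)) : ℂ) ∂D.haarB = ∫ b, f b ∂D.haarB := by
  have := D.lieGroup
  have := D.lieGroup_right
  have : IsTopologicalGroup G := topologicalGroup_of_lieGroup 𝓘(ℝ, E) (⊤ : ℕ∞)
  have : LocallyCompactSpace B := Manifold.locallyCompact_of_finiteDimensional 𝓘(ℝ, EB)
  have : SecondCountableTopology B :=
    TopologicalSpace.Subtype.secondCountableTopology (B : Set G)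
  -- The normalisation plays no role: the formula is homogeneous in the measure, whatever the
  -- constant.
  obtain ⟨c, hc⟩ : ∃ c : ENNReal, D.haarB = c • (Measure.haar : Measure B) := ⟨_, rfl⟩
  have hk : Continuous fun b : B => D.detA (D.aR (a * b)) :=
    D.continuous_detA.comp (D.contMDiff_aR.continuous.comp
      (continuous_const.mul continuous_subtype_val))
  have h1 := map_symm_haar_eq_withDensity (F := EB) (Measure.haar : Measure B) (D.dressing a)
    (D.contMDiff_bL_coe_mul a) (k := fun b => ENNReal.ofReal (D.detA (D.aR (a * b))))
    hk.measurable.ennreal_ofReal (fun b => by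
      rw [← D.abs_tangentDet_bL_coe_mul]
      -- By the cocycle identity, the translate to 1 of the dressing action of a at b is the
      -- dressing action of a_R(ab), whose determinant at 1 is known.
      congr 3
      funext c
      change D.bL (D.aR (a * b) * c) = (D.bL (a * b))⁻¹ * D.bL (a * (b * c : B))
      rw [Subgroup.coe_mul, ← mul_assoc, D.bL_mul (a * b) c, inv_mul_cancel_left])
  have h2 : ∫ b, f b ∂(Measure.haar : Measure B) =
      ∫ b, f (D.bL (a * b)) ∂(Measure.map (D.dressing a).symm (Measure.haar : Measure B)) := by
    rw [(D.dressing a).symm.measurableEmbedding.integral_map]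
    exact integral_congr_ae (Eventually.of_forall fun b =>
      congrArg f ((D.dressing a).apply_symm_apply b).symm)
  rw [hc, integral_smul_measure, integral_smul_measure, h2, h1,
    integral_withDensity_eq_integral_toReal_smul hk.measurable.ennreal_ofReal
      (Eventually.of_forall fun _ => ENNReal.ofReal_lt_top)]
  congr 1
  refine integral_congr_ae (Eventually.of_forall fun b => ?_)
  simp only [ENNReal.toReal_ofReal (D.detA_pos _).le, Complex.real_smul]
  exact mul_comm _ _

end IsDoubleLieGroup

/-! ### Symmetry of the triples (x, y, z) and cancellation of the numerical factors -/

namespace IsDoubleLieGroup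

section

variable {E EA EB : Type*}
  [NormedAddCommGroup E] [NormedSpace ℝ E]
  [NormedAddCommGroup EA] [NormedSpace ℝ EA]
  [NormedAddCommGroup EB] [NormedSpace ℝ EB]
  {G : Type*} [TopologicalSpace G] [ChartedSpace E G] [Group G]
  {A B : Subgroup G} [ChartedSpace EA A] [ChartedSpace EB B]
  (D : IsDoubleLieGroup E EA EB A B)

theorem sA_inv (g : G) : D.sA g⁻¹ = ((D.aL g)⁻¹ : A) * D.bL g := by
  rw [sA_eq', aR_inv, bR_inv, inv_inv]

theorem bL_inv_aL_mul_bL {x z₁ z₂ : G} (h : D.aL x = D.aL z₁ * D.aL z₂) :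
    D.bL (((D.aL z₁)⁻¹ : A) * D.bL x) = D.bL (D.aL z₂ * D.bR x) := by
  have h1 : (((D.aL z₁)⁻¹ : A) * D.bL x : G) = D.bL (D.aL z₂ * D.bR x) *
      ((D.aR x * (D.aR (D.aL z₂ * D.bR x))⁻¹)⁻¹ : A) := by
    rw [Subgroup.coe_inv, inv_mul_eq_iff_eq_mul, Subgroup.coe_inv, ← mul_assoc,
      eq_mul_inv_iff_mul_eq, bL_mul_eq_of_aL_eq h]
  rw [h1, bL_coe_mul_coe]

/-- The point `y` associated with the images of `x` and `z` under the composition of the group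
inverse with the groupoid inverse. -/
theorem mDeltaInv_sA_inv {x : G} {z : G × G} (h : D.aL x = D.aL z.1 * D.aL z.2) :
    D.mDeltaInv (D.sA x⁻¹) (D.sA z.2⁻¹, D.sA z.1⁻¹) =
      (D.sA (D.mDeltaInv x z).2⁻¹, D.sA (D.mDeltaInv x z).1⁻¹) := by
  have h1 := D.aL_mDeltaInv_fst h
  have h2 := aL_mDeltaInv_snd (D := D) (x := x) (z₂ := z.2)
  have h3 := bL_mul_eq_of_aL_eq h
  rw [D.mDeltaInv_eq _ _ (by simp [aR_inv, h]), D.mDeltaInv_eq x z h]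
  simp only [aL_sA, bL_sA, bR_sA, aR_inv, bL_inv, bR_inv, inv_inv, D.bL_inv_aL_mul_bL h]
  simp only [sA_inv, h1.1, h2.1, bL_coe_mul]
  refine congrArg₂ Prod.mk ?_ ?_
  · simp only [Subgroup.coe_inv, Subgroup.coe_mul, ← mul_assoc, ← mul_inv_rev, D.bL_mul_aR]
  · rw [Subgroup.coe_mul, ← mul_assoc, ← mul_assoc]
    congr 1
    rw [Subgroup.coe_inv, Subgroup.coe_inv, Subgroup.coe_inv, Subgroup.coe_inv, ← mul_inv_rev,
      ← mul_inv_rev, h3]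

end

variable {E EA EB : Type*}
  [NormedAddCommGroup E] [NormedSpace ℝ E] [FiniteDimensional ℝ E]
  [NormedAddCommGroup EA] [NormedSpace ℝ EA] [FiniteDimensional ℝ EA]
  [NormedAddCommGroup EB] [NormedSpace ℝ EB] [FiniteDimensional ℝ EB]
  {G : Type*} [TopologicalSpace G] [SecondCountableTopology G] [ChartedSpace E G] [Group G]
  {A B : Subgroup G} [ChartedSpace EA A] [ChartedSpace EB B]
  (D : IsDoubleLieGroup E EA EB A B)

theorem modFactor_inv (g : G) : D.modFactor g⁻¹ = D.modFactor g := by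
  simp only [modFactor, aL_inv, aR_inv, detA_inv, inv_inv]
  exact mul_comm _ _

theorem modFactor_sA (g : G) : D.modFactor (D.sA g) = (D.modFactor g)⁻¹ := by
  simp only [modFactor, aL_sA, aR_sA, mul_inv, inv_inv]
  exact mul_comm _ _

section

variable {D} {x : G} {z : G × G}

/-- The factor is a ratio of `detA` at the two units of a point. The units telescope: a_L(x) =
a_L(z₁)a_L(z₂), a_R(x) = a_L(y₁)a_L(y₂) and a_R(yᵢ) = a_R(zᵢ). -/
theorem modFactor_mDeltaInv (h : D.aL x = D.aL z.1 * D.aL z.2) :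
    D.modFactor z.1 * D.modFactor z.2 =
      D.modFactor x * (D.modFactor (D.mDeltaInv x z).1 * D.modFactor (D.mDeltaInv x z).2) := by
  have h1 := D.aL_mDeltaInv_fst h
  have h2 := aL_mDeltaInv_snd (D := D) (x := x) (z₂ := z.2)
  simp only [D.mDeltaInv_eq x z h, modFactor, h1.1, h2.1, h, aR_coe_mul, map_mul, detA_inv]
  have p1 := (D.detA_pos (D.aR x)).ne'
  have p2 := (D.detA_pos (D.aR (D.aL z.2 * D.bR x))).ne'
  have p3 := (D.detA_pos (D.aL z.1)).ne'
  have p4 := (D.detA_pos (D.aL z.2)).ne'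
  field_simp

/-- Behind the cancellation, |Q| is multiplicative for the groupoid product and group-like for δ,
that is, |Q(a₁b)||Q(ba₂)| = |Q(a₁ba₂)|. As z = δ^L(x) y, this gives the relation. -/
theorem abs_Q_mDeltaInv (h : D.aL x = D.aL z.1 * D.aL z.2) :
    |D.Q z.1| * |D.Q z.2| =
      |D.Q x| * (|D.Q (D.mDeltaInv x z).1| * |D.Q (D.mDeltaInv x z).2|) := by
  have h1 := D.aL_mDeltaInv_fst h
  have h2 := aL_mDeltaInv_snd (D := D) (x := x) (z₂ := z.2)
  have hB : ∀ b : B, D.detB b⁻¹ = (D.detB b)⁻¹ := fun b =>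
    eq_inv_of_mul_eq_one_left (by rw [← map_mul, inv_mul_cancel, map_one])
  simp only [D.mDeltaInv_eq x z h, abs_Q_eq, h1, h2, h, aR_coe_mul, bL_coe_mul, map_mul, detA_inv,
    hB]
  have p1 := (D.detA_pos (D.aR x)).ne'
  have p2 := (D.detA_pos (D.aR (D.aL z.2 * D.bR x))).ne'
  have p3 := (D.detA_pos (D.aL z.1)).ne'
  have p4 := (D.detA_pos (D.aL z.2)).ne'
  have p5 := (D.detB_pos (D.bL x)).ne'
  have p6 := (D.detB_pos (D.bR x)).ne'
  have p7 := (D.detB_pos (D.bL (D.aL z.2 * D.bR x))).ne'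
  have p8 := (D.detB_pos (D.bR z.1)).ne'
  have p9 := (D.detB_pos (D.bR z.2)).ne'
  field_simp

/-- The equality of the numerical factors in the compatibility of `δ̂` with the antipode. -/
theorem jacobian_antipode (h : D.aL x = D.aL z.1 * D.aL z.2) :
    (D.modFactor z.2⁻¹ * D.modFactor z.1⁻¹) ^ (1 / 2 : ℝ) *
      (D.modFactor (D.sA x⁻¹) ^ (1 / 2 : ℝ) *
        (D.modFactor (D.sA (D.mDeltaInv x z).2⁻¹) *
          D.modFactor (D.sA (D.mDeltaInv x z).1⁻¹)) ^ (1 / 2 : ℝ) *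
        D.jacobian (D.sA x⁻¹) (D.sA (D.mDeltaInv x z).2⁻¹, D.sA (D.mDeltaInv x z).1⁻¹) ^
          (-(1 / 2) : ℝ) * D.detA (D.aR x)) =
      D.jacobian x (D.mDeltaInv x z) ^ (-(1 / 2) : ℝ) := by
  -- The factor is invariant under the group inverse and inverted by s, so the weights of the three
  -- involutions cancel by `modFactor_mDeltaInv`.
  have e1 : (D.modFactor z.2⁻¹ * D.modFactor z.1⁻¹) ^ (1 / 2 : ℝ) *
      (D.modFactor (D.sA x⁻¹) ^ (1 / 2 : ℝ) * (D.modFactor (D.sA (D.mDeltaInv x z).2⁻¹) *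
          D.modFactor (D.sA (D.mDeltaInv x z).1⁻¹)) ^ (1 / 2 : ℝ)) = 1 := by
    have q1 := D.modFactor_pos x
    have q2 := D.modFactor_pos (D.mDeltaInv x z).1
    have q3 := D.modFactor_pos (D.mDeltaInv x z).2
    simp only [modFactor_sA, modFactor_inv]
    rw [mul_comm (D.modFactor z.2), modFactor_mDeltaInv h, ← Real.mul_rpow (by positivity)
      (by positivity), ← Real.mul_rpow (by positivity) (by positivity)]
    convert Real.one_rpow _ using 2
    field_simp
  rw [← D.mDeltaInv_sA_inv h, D.jacobian_mDeltaInv _ _ (by simp [aR_inv, h]),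
    D.jacobian_mDeltaInv _ _ h]
  simp only [aL_sA, aR_sA, bR_sA, aR_inv, aL_inv, bR_inv, inv_inv, D.bL_inv_aL_mul_bL h, detA_inv]
  have p1 := D.detA_pos (D.aR x)
  have p2 := D.detB_pos (D.bL (D.aL z.2 * D.bR x))
  -- The map g ↦ s(g⁻¹) keeps the `detB` part of the Jacobian and inverts a = detA(a_R(x)). Hence
  -- (d·a)^{-1/2} is multiplied by the Haar factor a, which gives (d/a)^{-1/2}.
  have e2 : (D.detB (D.bL (D.aL z.2 * D.bR x)) / (D.detA (D.aR x))⁻¹) ^ (-(1 / 2) : ℝ) *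
      D.detA (D.aR x) =
      (D.detB (D.bL (D.aL z.2 * D.bR x)) / D.detA (D.aR x)) ^ (-(1 / 2) : ℝ) := by
    nth_rewrite 2 [← Real.rpow_one (D.detA (D.aR x))]
    rw [div_inv_eq_mul, Real.mul_rpow p2.le p1.le, mul_assoc, ← Real.rpow_add p1,
      Real.div_rpow p2.le p1.le, div_eq_mul_inv _ (_ ^ _), ← Real.rpow_neg p1.le]
    norm_num
  rw [mul_assoc _ (_ ^ (-(1 / 2) : ℝ)), e2, ← mul_assoc, e1, one_mul]

end

end IsDoubleLieGroup

end

theorem proposition5p4 {E EA EB : Type*}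
    [NormedAddCommGroup E] [NormedSpace ℝ E] [FiniteDimensional ℝ E]
    [NormedAddCommGroup EA] [NormedSpace ℝ EA] [FiniteDimensional ℝ EA]
    [NormedAddCommGroup EB] [NormedSpace ℝ EB] [FiniteDimensional ℝ EB]
    {G : Type*} [TopologicalSpace G] [T2Space G] [SecondCountableTopology G]
    [ChartedSpace E G] [Group G] [MeasurableSpace G] [BorelSpace G]
    (A B : Subgroup G) [ChartedSpace EA A] [ChartedSpace EB B]
    (D : IsDoubleLieGroup E EA EB A B) (z : ℂ) (ω ω₁ ω₂ : Bidensity EB G)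
    (hω : ω ∈ D.algebra) (hω₁ : ω₁ ∈ D.algebra) (hω₂ : ω₂ ∈ D.algebra) :
    D.deltaHat (D.unitaryAntipode ω)
        (D.tensor (D.unitaryAntipode ω₁) (D.unitaryAntipode ω₂)) =
      D.flip (D.unitaryAntipode₂ (D.mulDeltaHat (D.tensor ω₂ ω₁) ω)) ∧
    D.deltaHat (D.scaling z ω) (D.tensor ω₁ ω₂) =
      D.scaling₂ z
        (D.deltaHat ω (D.tensor (D.scaling (-z) ω₁) (D.scaling (-z) ω₂))) := by
  constructor
  · funext p
    refine BiHalfDensity.ext_basis (IsDoubleLieGroup.frame₂ EB) (IsDoubleLieGroup.frame₂ EB) ?_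
    rw [D.flip_frame, D.unitaryAntipode₂_frame, IsDoubleLieGroup.mulDeltaHat, D.adj₂_frame]
    simp only [IsDoubleLieGroup.deltaHat, BiHalfDensity.ofValue_self, D.adj_frame, D.adj₂_frame,
      D.tensor_frame, D.unitaryAntipode_frame, IsDoubleLieGroup.aL_sA, IsDoubleLieGroup.aR_inv]
    rw [← integral_conj, ← integral_const_mul]
    -- The integral on the right runs over the fiber over a_L(p₂)⁻¹a_L(p₁)⁻¹. This substitution
    -- makes its variable the image of x under g ↦ s(g⁻¹).
    conv_rhs => rw [← D.integral_bL_coe_mul (D.aL p.1 * D.aL p.2)]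
    refine integral_congr_ae (Eventually.of_forall fun b => ?_)
    dsimp only
    set x : G := D.aL p.1 * D.aL p.2 * b with hx
    have hxa : D.aL x = D.aL p.1 * D.aL p.2 := by
      rw [hx, ← Subgroup.coe_mul, D.aL_coe_mul_coe]
    have hX : (((D.aL p.2)⁻¹ : A) * ((D.aL p.1)⁻¹ : A) * D.bL x : G) = D.sA x⁻¹ := by
      rw [D.sA_inv, hxa, mul_inv_rev, Subgroup.coe_mul]
    simp only [Subgroup.coe_mul, ← hx, hX, D.mDeltaInv_sA_inv hxa, D.sA_sA]
    rw [← IsDoubleLieGroup.jacobian_antipode hxa]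
    simp only [map_mul, Complex.conj_conj, Complex.conj_ofReal]
    push_cast
    ring
  · funext p
    refine BiHalfDensity.ext_basis (IsDoubleLieGroup.frame₂ EB) (IsDoubleLieGroup.frame₂ EB) ?_
    have hs : ∀ (z : ℂ) (ω : Bidensity EB G) (g : G),
        D.scaling z ω g (IsDoubleLieGroup.frame EB) (IsDoubleLieGroup.frame EB) =
          ((|D.Q g| : ℝ) : ℂ) ^ (Complex.I * z) *
            ω g (IsDoubleLieGroup.frame EB) (IsDoubleLieGroup.frame EB) := fun _ _ _ => rfl
    change _ = ((|D.Q p.1| : ℝ) : ℂ) ^ (Complex.I * z) * ((|D.Q p.2| : ℝ) : ℂ) ^ (Complex.I * z) *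
      D.deltaHat ω (D.tensor (D.scaling (-z) ω₁) (D.scaling (-z) ω₂)) p
        (IsDoubleLieGroup.frame₂ EB) (IsDoubleLieGroup.frame₂ EB)
    simp only [IsDoubleLieGroup.deltaHat, BiHalfDensity.ofValue_self, D.tensor_frame, hs]
    rw [← integral_const_mul]
    refine integral_congr_ae (Eventually.of_forall fun b => ?_)
    dsimp only
    set x : G := D.aL p.1 * D.aL p.2 * b with hx
    have hxa : D.aL x = D.aL p.1 * D.aL p.2 := by
      rw [hx, ← Subgroup.coe_mul, D.aL_coe_mul_coe]
    have hQ := IsDoubleLieGroup.abs_Q_mDeltaInv hxa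
    have hm : ∀ g h : ℝ, ((|g| : ℝ) : ℂ) ^ (Complex.I * z) * ((|h| : ℝ) : ℂ) ^ (Complex.I * z) =
        ((|g| * |h| : ℝ) : ℂ) ^ (Complex.I * z) := fun g h => by
      rw [Complex.ofReal_mul, Complex.mul_cpow_ofReal_nonneg (abs_nonneg _) (abs_nonneg _)]
    have hn : ∀ g : G, ((|D.Q g| : ℝ) : ℂ) ^ (Complex.I * -z) *
        ((|D.Q g| : ℝ) : ℂ) ^ (Complex.I * z) = 1 := fun g => by
      rw [← Complex.cpow_add _ _ (Complex.ofReal_ne_zero.2 (D.abs_Q_pos g).ne')]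
      simp
    -- Complex powers of products split here because the bases are nonnegative reals; the product
    -- over y is regrouped as one absolute value so that `hm` applies twice.
    rw [hm, hQ, ← abs_mul (D.Q _) (D.Q _), ← hm, abs_mul, ← hm]
    have n1 := hn (D.mDeltaInv x p).1
    have n2 := hn (D.mDeltaInv x p).2
    generalize ((|D.Q (D.mDeltaInv x p).1| : ℝ) : ℂ) ^ (Complex.I * -z) = u₁ at n1 ⊢
    generalize ((|D.Q (D.mDeltaInv x p).2| : ℝ) : ℂ) ^ (Complex.I * -z) = u₂ at n2 ⊢
    generalize ((|D.Q (D.mDeltaInv x p).1| : ℝ) : ℂ) ^ (Complex.I * z) = v₁ at n1 ⊢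
    generalize ((|D.Q (D.mDeltaInv x p).2| : ℝ) : ℂ) ^ (Complex.I * z) = v₂ at n2 ⊢
    generalize ω₁ (D.mDeltaInv x p).1 (IsDoubleLieGroup.frame EB) (IsDoubleLieGroup.frame EB) = f₁
    generalize ω₂ (D.mDeltaInv x p).2 (IsDoubleLieGroup.frame EB) (IsDoubleLieGroup.frame EB) = f₂
    generalize ((|D.Q x| : ℝ) : ℂ) ^ (Complex.I * z) = q
    generalize ω x (IsDoubleLieGroup.frame EB) (IsDoubleLieGroup.frame EB) = f
    -- The powers with exponents iz and -iz at y₁ and y₂ cancel in pairs; the coefficients telescope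
    -- u₁v₁u₂v₂ - 1 into the two relations.
    linear_combination (-(q * f * f₁ * f₂ * ((D.jacobian x (D.mDeltaInv x p) ^
      (-(1 / 2) : ℝ) : ℝ) : ℂ))) * (u₂ * v₂ * n1 + n2)
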